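/- Let $M$ be a closed (compact, boundaryless, Hausdorff, smooth) 3-manifold with $H^1(M;\mathbb Z)=H^2(M;\mathbb Z)=0$, and let $\mu$ be a smooth volume form on $M$. Let $\mathfrak X$ be the set of nowhere vanishing $C^1$ vector fields $X$ on $M$ that preserve $\mu$ (that is, $\iota_X\mu$ is closed). For $X\in\mathfrak X$ with flow $\phi$, a normal trivialization $\tau$ is a continuous family of surjective linear maps $\tau_x:T_xM\to\mathbb R^2$ with kernel $\mathrm{span}(X_x)$ and $\det(\tau_x v,\tau_x w)=\mu(X_x,v,w)$. It gives the map $$\Phi:\mathbb R\times M\to SL(2,\mathbb R),\qquad \Phi(t,x)=\tau_{\phi(t,x)}\circ D\phi_{t,x}\circ\tau_x^{-1}.$$ Let $\widetilde\Phi:\mathbb R\times M\to\widetilde{SL}(2,\mathbb R)$ be the continuous lift of $\Phi$ to the universal cover with $\widetilde\Phi(0,x)=\widetilde{\mathrm{Id}}$, and write $\widetilde\Phi_T=\widetilde\Phi(T,\cdot)$. A rotation quasimorphism is a continuous quasimorphism $\rho:\widetilde{SL}(2,\mathbb R)\to\mathbb R$ at bounded distance from the standard rotation number, which counts full turns. The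 Ruelle density and the Ruelle invariant of $X$ are $$\mathrm{ru}(X)=\lim_{T\to\infty}\tfrac1T\,\rho\circ\widetilde\Phi_T\ \text{ in } L^1(M,\mu),\qquad \mathrm{Ru}(X)=\int_M \mathrm{ru}(X)\,\mu .$$ Then the Ruelle invariant is well defined on $\mathfrak X$: for each $X\in\mathfrak X$ a normal trivialization exists, and for each normal trivialization the lift $\widetilde\Phi$ exists and is unique, the $L^1$-limit exists for each rotation quasimorphism $\rho$, and $\mathrm{Ru}(X)$ depends neither on the trivialization nor on $\rho$. Moreover, $\mathrm{Ru}:\mathfrak X\to\mathbb R$ is continuous in the $C^1$-topology. -/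

import Mathlib

open Set Filter Topology MeasureTheory
open scoped Manifold ContDiff ENNReal

noncomputable section

namespace RuelleInvariant

universe u

/-! ### Čech cohomology with coefficients in the constant sheaf `ℤ` -/

section Cech

/-- The Čech differential on cochains of a cover indexed by `ι`. A cochain on `n`-fold intersections
is a family of functions, one for each `n`-tuple of indices (so that it has degree `n - 1`); only
the values on the intersections matter. -/
def cechDifferential {M : Type u} {ι : Type u} {n : ℕ} (c : (Fin n → ι) → M → ℤ) :
    (Fin (n + 1) → ι) → M → ℤ :=
  fun s x => ∑ j : Fin (n + 1), (-1 : ℤ) ^ (j : ℕ) * c (s ∘ j.succAbove) x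

/-- `c` is a cochain with values in the constant sheaf `ℤ`: on every `n`-fold intersection it is
continuous for the discrete topology of `ℤ`, that is, locally constant. -/
def IsCechCochain {M : Type u} [TopologicalSpace M] {ι : Type u} (U : ι → Set M) {n : ℕ}
    (c : (Fin n → ι) → M → ℤ) : Prop :=
  ∀ s : Fin n → ι, ContinuousOn (c s) (⋂ i, U (s i))

def IsOpenCover {M : Type u} [TopologicalSpace M] {ι : Type u} (U : ι → Set M) : Prop :=
  (∀ i, IsOpen (U i)) ∧ ⋃ i, U i = univ

/-- The Čech cohomology group `Ȟ^q(M; ℤ)` (for `q ≥ 1`), the colimit over refinements of open covers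
of the cohomology of the Čech complexes, is zero: each `q`-cocycle of each open cover becomes a
coboundary after passing to a refinement. (For `q = 0` this says that reduced cohomology is zero.)
On manifolds, Čech and singular cohomology agree. -/
def CechCohomologyVanishes (M : Type u) [TopologicalSpace M] (q : ℕ) : Prop :=
  ∀ (ι : Type u) (U : ι → Set M), IsOpenCover U →
    ∀ c : (Fin (q + 1) → ι) → M → ℤ, IsCechCochain U c →
      (∀ s, ∀ x ∈ ⋂ i, U (s i), cechDifferential c s x = 0) →
      ∃ (κ : Type u) (V : κ → Set M) (r : κ → ι), IsOpenCover V ∧ (∀ a, V a ⊆ U (r a)) ∧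
        ∃ b : (Fin q → κ) → M → ℤ, IsCechCochain V b ∧
          ∀ s, ∀ x ∈ ⋂ i, V (s i), c (r ∘ s) x = cechDifferential b s x

end Cech

/-! ### The universal cover of `SL(2, ℝ)` -/

/-- The unit vector whose angle, counted in full turns, is `θ`. -/
def unitVec (θ : ℝ) : Fin 2 → ℝ := ![Real.cos (2 * Real.pi * θ), Real.sin (2 * Real.pi * θ)]

/-- The universal covering group of `SL(2, ℝ)`: pairs `(A, f)` of a matrix `A ∈ SL(2, ℝ)` and a lift
`f : ℝ → ℝ` to the universal cover `θ ↦ unitVec θ` of the circle of the action of `A` on the circle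
of directions. Multiplication is matrix multiplication and composition of lifts. -/
def SL2Cover : Submonoid (Matrix.SpecialLinearGroup (Fin 2) ℝ × CircleDeg1Lift) where
  carrier := {g | ∀ θ : ℝ, ∃ r : ℝ, 0 < r ∧ g.1.1.mulVec (unitVec θ) = r • unitVec (g.2 θ)}
  one_mem' := fun θ => ⟨1, one_pos, by simp⟩
  mul_mem' := by
    rintro ⟨A, f⟩ ⟨B, g⟩ hf hg θ
    obtain ⟨r, hr, h₁⟩ := hg θ
    obtain ⟨s, hs, h₂⟩ := hf (g θ)
    refine ⟨r * s, mul_pos hr hs, ?_⟩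
    simp only at h₁ h₂
    simp [← Matrix.mulVec_mulVec, h₁, h₂, Matrix.mulVec_smul, smul_smul]

/-- A lift `f` is determined by the matrix and by `f 0`; the topology is the one of the set of all
`(A, y)` such that `y` is an angle of the vector `A (1, 0)`, i.e. of the pull-back of the universal
cover of the circle under the homotopy equivalence `SL(2, ℝ) → S¹`, `A ↦ A (1, 0) / |A (1, 0)|`. -/
instance : TopologicalSpace SL2Cover :=
  TopologicalSpace.induced (fun g => (g.1.1, g.1.2 0)) inferInstance

/-- The standard rotation number of an element of the universal cover of `SL(2, ℝ)`, counted in full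
turns: `lim_n (fⁿ(θ) - θ) / n` for the lift `f`. -/
def rotationNumber (g : SL2Cover) : ℝ := g.1.2.translationNumber

/-- Rotation quasimorphisms: continuous quasimorphisms that are equivalent (at bounded distance) to
the standard rotation number. -/
structure IsRotationQuasimorphism (ρ : SL2Cover → ℝ) : Prop where
  continuous : Continuous ρ
  quasimorphism : ∃ C : ℝ, ∀ g h, |ρ (g * h) - ρ g - ρ h| ≤ C
  equivalent : ∃ C : ℝ, ∀ g, |ρ g - rotationNumber g| ≤ C

/-! ### Volume forms and vector fields on 3-manifolds -/

/-- The model space `ℝ³`. -/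
abbrev R3 : Type := EuclideanSpace ℝ (Fin 3)

section Manifold

variable (M : Type u) [TopologicalSpace M] [ChartedSpace R3 M]

/-- `C¹` vector fields on `M`. -/
abbrev C1VectorField [IsManifold (𝓡 3) ∞ M] : Type u :=
  ContMDiffSection (𝓡 3) R3 1 (fun x : M => TangentSpace (𝓡 3) x)

variable {M}

/-- The expression in the chart at `p` of a 3-form on `M`: its pull-back under the inverse chart. -/
def chartForm (α : ∀ x : M, TangentSpace (𝓡 3) x [⋀^Fin 3]→L[ℝ] ℝ) (p : M) (y : R3) :
    R3 [⋀^Fin 3]→L[ℝ] ℝ :=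
  (α ((chartAt R3 p).symm y)).compContinuousLinearMap
    (mfderiv 𝓘(ℝ, R3) (𝓡 3) (chartAt R3 p).symm y)

/-- The expression in the chart at `p` of a vector field on `M`: its push-forward by the chart. -/
def chartField (X : ∀ x : M, TangentSpace (𝓡 3) x) (p : M) (y : R3) : R3 :=
  mfderiv (𝓡 3) 𝓘(ℝ, R3) (chartAt R3 p) ((chartAt R3 p).symm y) (X ((chartAt R3 p).symm y))

variable (M) in
/-- Volume forms: smooth, nowhere vanishing 3-forms on `M`. -/
structure VolumeForm where
  toFun : ∀ x : M, TangentSpace (𝓡 3) x [⋀^Fin 3]→L[ℝ] ℝ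
  smooth : ∀ p : M, ContDiffOn ℝ ∞ (chartForm toFun p) (chartAt R3 p).target
  ne_zero : ∀ x : M, toFun x ≠ 0

/-- The Borel measure on the domain of the chart at `p` given by a volume form: the image under the
inverse chart of `|ω(e₁, e₂, e₃)|` times the Lebesgue measure on the target of the chart. -/
def VolumeForm.chartMeasure [MeasurableSpace M] (μ : VolumeForm M) (p : M) : Measure M :=
  Measure.map (chartAt R3 p).symm
    ((volume.restrict (chartAt R3 p).target).withDensity fun y =>
      ENNReal.ofReal |chartForm μ.toFun p y fun i => EuclideanSpace.single i 1|)

/-- The measure on `M` of a volume form (for the orientation that the form defines): the smallest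
measure that dominates the measure on the domain of each chart. As these agree on overlaps, it
restricts to `μ.chartMeasure p` on the domain of the chart at `p`. -/
def VolumeForm.measure [MeasurableSpace M] (μ : VolumeForm M) : Measure M :=
  ⨆ p : M, μ.chartMeasure p

/-- `X` preserves the volume form `μ`: the 2-form `ι_X μ` is closed. -/
def IsVolumePreserving (μ : VolumeForm M) (X : ∀ x : M, TangentSpace (𝓡 3) x) : Prop :=
  ∀ p : M, ∀ y ∈ (chartAt R3 p).target,
    extDeriv (fun z => (chartForm μ.toFun p z).curryLeft (chartField X p z)) y = 0

variable [IsManifold (𝓡 3) ∞ M]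

/-- The `C¹`-topology on vector fields: uniform convergence, on the compact subsets of each chart,
of the coordinate expressions and of their first derivatives. -/
instance : TopologicalSpace (C1VectorField M) :=
  ⨅ p : M, TopologicalSpace.induced
    (fun X => UniformOnFun.ofFun {K : Set R3 | IsCompact K ∧ K ⊆ (chartAt R3 p).target}
      (fun y => (chartField X p y, fderiv ℝ (chartField X p) y)))
    inferInstance

/-- The nowhere vanishing `C¹` vector fields that preserve the volume form `μ`. -/
def nonvanishingVolumePreserving (μ : VolumeForm M) : Set (C1VectorField M) :=
  {X | IsVolumePreserving μ X ∧ ∀ x, X x ≠ 0}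

/-! ### The Ruelle invariant -/

open scoped Classical in
/-- The flow of `X`: the point `flow X t x` is the value at time `t` of the integral curve of `X`
that starts at `x`. -/
def flow (X : C1VectorField M) (t : ℝ) (x : M) : M :=
  if h : ∃ γ : ℝ → M, γ 0 = x ∧ IsMIntegralCurve γ X then h.choose t else x

/-- `τ` is a (continuous, symplectic) trivialization of the normal bundle `TM / span X`, with the area
form induced by `ι_X μ`: fibrewise, `τ x : T_x M → ℝ²` is surjective with kernel spanned by `X x`, and
it pulls back the standard area form of `ℝ²` to `ι_X μ`. -/
structure IsNormalTrivialization (μ : VolumeForm M) (X : C1VectorField M)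
    (τ : ∀ x : M, TangentSpace (𝓡 3) x →ₗ[ℝ] (Fin 2 → ℝ)) : Prop where
  continuous : Continuous fun v : TangentBundle (𝓡 3) M => τ v.1 v.2
  surjective : ∀ x, Function.Surjective (τ x)
  ker_eq : ∀ x, LinearMap.ker (τ x) = Submodule.span ℝ {X x}
  area : ∀ x (v w : TangentSpace (𝓡 3) x),
    τ x v 0 * τ x w 1 - τ x v 1 * τ x w 0 = μ.toFun x ![X x, v, w]

/-- `Φ : ℝ × M → universal cover of SL(2, ℝ)` is the continuous lift, starting at the identity at time
zero, of the linearized flow `τ_{φ(t, x)} ∘ Dφ_{t, x} ∘ τ_x⁻¹` of `X` on the normal bundle. -/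
structure IsLiftedLinearizedFlow (X : C1VectorField M)
    (τ : ∀ x : M, TangentSpace (𝓡 3) x →ₗ[ℝ] (Fin 2 → ℝ)) (Φ : ℝ → M → SL2Cover) : Prop where
  continuous : Continuous fun z : ℝ × M => Φ z.1 z.2
  zero : ∀ x, Φ 0 x = 1
  linearized : ∀ t x (v : TangentSpace (𝓡 3) x),
    (Φ t x).1.1.1.mulVec (τ x v) =
      τ (flow X t x) (mfderiv (𝓡 3) (𝓡 3) (flow X t) x v)

/-- `ru` is the limit in `L¹(M, μ)` of `(1 / T) ρ(Φ_T)` as `T → ∞`. -/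
structure IsRuelleDensity [MeasurableSpace M] (μ : VolumeForm M) (ρ : SL2Cover → ℝ)
    (Φ : ℝ → M → SL2Cover) (ru : M → ℝ) : Prop where
  integrable : Integrable ru μ.measure
  integrable_rotation : ∀ T : ℝ, Integrable (fun x => ρ (Φ T x)) μ.measure
  tendsto : Tendsto (fun T : ℝ => eLpNorm (fun x => 1 / T * ρ (Φ T x) - ru x) 1 μ.measure)
    atTop (𝓝 0)

/-- The Ruelle invariant of `X`: the integral of the Ruelle density of `X` with respect to some normal
trivialization (and the standard rotation number). -/
def ruelleInvariant [MeasurableSpace M] (μ : VolumeForm M) (X : C1VectorField M) : ℝ :=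
  Classical.epsilon fun r : ℝ => ∃ τ Φ ru, IsNormalTrivialization μ X τ ∧
    IsLiftedLinearizedFlow X τ Φ ∧ IsRuelleDensity μ rotationNumber Φ ru ∧
    r = ∫ x, ru x ∂μ.measure

end Manifold

end RuelleInvariant

end

/-! Everything is read off from one function, the angle `a T x = (Φ T x).1.2 0` by which the lifted
linearized flow turns the first basis vector. On the universal cover, the angle at `0` is a
quasimorphism of defect at most 1 (`abs_angle_mul_sub_le`), and it is at bounded distance from the
rotation number, hence from every rotation quasimorphism. Bounded errors disappear after division by
`T`, so `ρ` may be replaced by the angle throughout. The cocycle identity of the linearized flow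
turns the quasimorphism property into `|a (S + T) - a S ∘ φ_T - a T| ≤ 1`.

Existence of the density. By almost additivity, `a T / T` is uniformly within `D / N + O(1 / T)` of
a Birkhoff average of `a N / N` under the time `N` map. The flow preserves the measure of `μ`, so
these averages converge in `L²` by the mean ergodic theorem. Letting `N` grow shows that `a T / T`
is Cauchy in `L²`, hence convergent in `L¹` (`exists_tendsto_quasiadditive`, `exists_density`); no
subadditive ergodic theorem is needed.

The cohomological hypotheses. A metric makes the oriented normal bundle a hermitian line bundle. Its
unitary transition functions form a Čech 1-cocycle with values in the circle, and `H² = 0` makes it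
a coboundary, so a trivialization exists (`exists_coboundary`, `exists_isNormalTrivialization`). Two
trivializations differ by a continuous map from `M` to `SL(2, ℝ)`. By `H¹ = 0` it lifts to the
universal cover, where its angle is bounded by compactness. Hence the angles of the two lifted flows
differ by a bounded amount and the invariant is the same (`exists_lift_circle`,
`IsLiftedLinearizedFlow.exists_abs_angle_sub_le`).

Continuity. Integrated over an invariant measure, the cocycle `a` is almost additive in time, so
`|(1 / T) ∫ a T - Ru| ≤ vol / T` with a bound independent of the field (`abs_integral_sub_le`). For
fixed `T` the integral is continuous in the field: the derivative of the flow depends continuously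
on the field in the `C¹`-topology, and a trivialization for `X₀` extends to a continuous family for
nearby fields (`IsNormalTrivialization.exists_family`). Thus `Ru` is locally a uniform limit of
continuous functions.

The analytic groundwork is the joint continuity of the tangent map of the flow in field, time and
tangent vector (`continuous_tangentMap_flow`), the invariance of `μ` by Cartan's formula
(`form_mfderiv_flow`), and the invariance of its measure by change of variables in charts
(`measurePreserving_flow`). -/

noncomputable section

namespace RuelleInvariant

/-! ### Ordinary differential equations -/

section ODE

open scoped NNReal

variable {E : Type*} [NormedAddCommGroup E] [NormedSpace ℝ E]

/-- The Picard fixed point is extended by the projection of `ℝ` onto the time interval, so it stays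
in the ball for every real `t`. This confinement is what later keeps curves inside a chart. -/
theorem exists_solution_mem_closedBall [CompleteSpace E] {f : ℝ → E → E} {tmin tmax : ℝ}
    {t₀ : Icc tmin tmax} {x₀ x : E} {a r L K : ℝ≥0} (hf : IsPicardLindelof f t₀ x₀ a r L K)
    (hx : x ∈ Metric.closedBall x₀ r) :
    ∃ α : ℝ → E, α t₀ = x ∧ (∀ t, α t ∈ Metric.closedBall x₀ a) ∧
      ∀ t ∈ Icc tmin tmax, HasDerivWithinAt α (f t (α t)) (Icc tmin tmax) t := by
  obtain ⟨α, hα⟩ := ODE.FunSpace.exists_isFixedPt_next hf hx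
  refine ⟨α.compProj, by rw [ODE.FunSpace.compProj_val, ← hα, ODE.FunSpace.next_apply₀],
    fun t => α.compProj_mem_closedBall hf.mul_max_le, fun t ht ↦ ?_⟩
  apply ODE.hasDerivWithinAt_picard_Icc t₀.2 hf.continuousOn_uncurry
    α.continuous_compProj.continuousOn (fun _ ht' ↦ α.compProj_mem_closedBall hf.mul_max_le)
    x ht |>.congr_of_mem _ ht
  intro t' ht'
  nth_rw 1 [← hα]
  rw [ODE.FunSpace.compProj_of_mem ht', ODE.FunSpace.next_apply]

/-- The bound is `δ eᵗ + ε (eᵗ - 1)`, and `e < 3`. The equations below are scaled to Lipschitz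
constant 1 on `[0, 1]`, so this single estimate serves for all of them. -/
theorem gronwallBound_zero_one_le {δ ε t : ℝ} (hδ : 0 ≤ δ) (hε : 0 ≤ ε) (ht : t ∈ Icc (0 : ℝ) 1) :
    gronwallBound δ 1 ε (t - 0) ≤ 3 * (δ + ε) := by
  rw [gronwallBound_of_K_ne_0 one_ne_zero]
  have h1 : Real.exp (1 * (t - 0)) ≤ 3 :=
    (Real.exp_le_exp.2 (by simpa using ht.2)).trans Real.exp_one_lt_d9.le |>.trans (by norm_num)
  nlinarith

theorem hasDerivWithinAt_Ici_of_Icc {f : ℝ → E} {f' : E} {t : ℝ} (ht : t ∈ Ico (0 : ℝ) 1)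
    (h : HasDerivWithinAt f f' (Icc 0 1) t) : HasDerivWithinAt f f' (Ici t) t := by
  refine (h.mono (Icc_subset_Icc_left ht.1)).mono_of_mem_nhdsWithin ?_
  exact Icc_mem_nhdsGE ht.2

/-- Continuous dependence of the solutions of an ODE on parameters. -/
theorem continuousOn_solution {Q : Type*} [TopologicalSpace Q] {v : Q → ℝ → E → E} {s : Set E}
    {γ : Q → ℝ → E} (hv : ∀ q, ∀ τ ∈ Icc (0 : ℝ) 1, LipschitzOnWith 1 (v q τ) s)
    (hγ : ∀ q, ∀ τ ∈ Icc (0 : ℝ) 1, HasDerivWithinAt (γ q) (v q τ (γ q τ)) (Icc 0 1) τ)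
    (hs : ∀ q, ∀ τ ∈ Icc (0 : ℝ) 1, γ q τ ∈ s) (h0 : Continuous fun q => γ q 0)
    (hc : ∀ q₁, ContinuousOn (fun z : Q × ℝ => v z.1 z.2 (γ q₁ z.2)) (univ ×ˢ Icc 0 1)) :
    ContinuousOn (fun z : Q × ℝ => γ z.1 z.2) (univ ×ˢ Icc 0 1) := by
  have hcont : ∀ q, ContinuousOn (γ q) (Icc 0 1) := fun q τ hτ => (hγ q τ hτ).continuousWithinAt
  -- The curve `γ q₁` solves the equation of `q` up to an error that is uniformly small on `[0, 1]`,
  -- by compactness of the interval. Grönwall for the 1-Lipschitz field `v q` then gives `3 (ε +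
  -- ε)`.
  have key : ∀ q₁, ∀ ε > 0, ∀ᶠ q in 𝓝 q₁, ∀ τ ∈ Icc (0 : ℝ) 1, dist (γ q τ) (γ q₁ τ) ≤ 6 * ε := by
    intro q₁ ε hε
    have h1 : ∀ᶠ q in 𝓝 q₁, ∀ τ ∈ Icc (0 : ℝ) 1,
        dist (v q τ (γ q₁ τ)) (v q₁ τ (γ q₁ τ)) < ε := by
      have h2 : ∀ τ ∈ Icc (0 : ℝ) 1, ∃ u ∈ 𝓝 q₁, ∃ w ∈ 𝓝[Icc 0 1] τ, ∀ q ∈ u, ∀ t ∈ w,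
          dist (v q t (γ q₁ t)) (v q₁ t (γ q₁ t)) < ε := by
        intro τ hτ
        have h3 := Metric.tendsto_nhds.1 (hc q₁ (q₁, τ) ⟨mem_univ _, hτ⟩) (ε / 2) (half_pos hε)
        rw [nhdsWithin_prod_eq, nhdsWithin_univ] at h3
        obtain ⟨u, hu, w, hw, huw⟩ := Filter.mem_prod_iff.1 h3
        refine ⟨u, hu, w, hw, fun q hq t ht => ?_⟩
        have ha : dist (v q t (γ q₁ t)) (v q₁ τ (γ q₁ τ)) < ε / 2 := huw (mk_mem_prod hq ht)
        have hb : dist (v q₁ t (γ q₁ t)) (v q₁ τ (γ q₁ τ)) < ε / 2 :=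
          huw (mk_mem_prod (mem_of_mem_nhds hu) ht)
        linarith [dist_triangle_right (v q t (γ q₁ t)) (v q₁ t (γ q₁ t)) (v q₁ τ (γ q₁ τ))]
      choose! u hu w hw huw using h2
      obtain ⟨T, hT, hTc⟩ := (isCompact_Icc (a := (0:ℝ)) (b := 1)).elim_nhdsWithin_subcover w hw
      filter_upwards [(Filter.biInter_finset_mem T).2 fun τ hτ => hu τ (hT τ hτ)] with q hq τ hτ
      obtain ⟨t, ht, hτt⟩ := mem_iUnion₂.1 (hTc hτ)
      exact huw t (hT t ht) q (mem_iInter₂.1 hq t ht) τ hτt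
    have h4 : ∀ᶠ q in 𝓝 q₁, dist (γ q 0) (γ q₁ 0) < ε := Metric.tendsto_nhds.1 h0.continuousAt ε hε
    filter_upwards [h1, h4] with q hq hq0 τ hτ
    have := dist_le_of_approx_trajectories_ODE_of_mem (v := v q) (K := 1) (s := fun _ => s)
      (f := γ q) (g := γ q₁) (f' := fun τ => v q τ (γ q τ)) (g' := fun τ => v q₁ τ (γ q₁ τ))
      (εf := 0) (εg := ε) (δ := ε) (a := 0) (b := 1)
      (fun t ht => hv q t (Ico_subset_Icc_self ht)) (hcont q)
      (fun t ht => hasDerivWithinAt_Ici_of_Icc ht (hγ q t (Ico_subset_Icc_self ht)))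
      (fun t ht => (dist_self _).le) (fun t ht => hs q t (Ico_subset_Icc_self ht)) (hcont q₁)
      (fun t ht => hasDerivWithinAt_Ici_of_Icc ht (hγ q₁ t (Ico_subset_Icc_self ht)))
      (fun t ht => by rw [dist_comm]; exact (hq t (Ico_subset_Icc_self ht)).le)
      (fun t ht => hs q₁ t (Ico_subset_Icc_self ht)) hq0.le τ hτ
    rw [zero_add, NNReal.coe_one] at this
    linarith [gronwallBound_zero_one_le hε.le hε.le hτ, this]
  rintro ⟨q₁, τ₁⟩ ⟨-, hτ₁⟩
  refine Metric.tendsto_nhds.2 fun ε hε => ?_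
  rw [nhdsWithin_prod_eq, nhdsWithin_univ]
  have h1 := key q₁ (ε / 18) (by positivity)
  have h2 := Metric.tendsto_nhds.1 (hcont q₁ τ₁ hτ₁) (ε / 2) (half_pos hε)
  filter_upwards [h1.prod_mk (h2.and self_mem_nhdsWithin)] with z hz
  have h3 : dist (γ z.1 z.2) (γ q₁ z.2) ≤ 6 * (ε / 18) := hz.1 z.2 hz.2.2
  have h4 : dist (γ q₁ z.2) (γ q₁ τ₁) < ε / 2 := hz.2.1
  refine (dist_triangle (γ z.1 z.2) (γ q₁ z.2) (γ q₁ τ₁)).trans_lt ?_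
  linarith

/-- On the unit ball around the identity `‖W‖ ≤ 2`, so the bound `1 / 2` makes the speed at most 1.
Picard–Lindelöf therefore covers all of `[0, 1]` at once, without gluing. -/
theorem exists_linear_solution [CompleteSpace E] {A : ℝ → E →L[ℝ] E}
    (hA : ContinuousOn A (Icc 0 1)) (hA' : ∀ τ ∈ Icc (0 : ℝ) 1, ‖A τ‖ ≤ 1 / 2) :
    ∃ W : ℝ → E →L[ℝ] E, W 0 = ContinuousLinearMap.id ℝ E ∧
      ∀ τ ∈ Icc (0 : ℝ) 1, HasDerivWithinAt W (A τ ∘L W τ) (Icc 0 1) τ := by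
  have hid : ‖ContinuousLinearMap.id ℝ E‖ ≤ 1 := ContinuousLinearMap.norm_id_le
  have hPL : IsPicardLindelof (fun τ (W : E →L[ℝ] E) => A τ ∘L W) (tmin := 0) (tmax := 1)
      ⟨0, by simp⟩ (ContinuousLinearMap.id ℝ E) 1 0 1 1 := by
    refine ⟨fun τ hτ => ?_, fun W _ => ?_, fun τ hτ W hW => ?_, by simp⟩
    · refine LipschitzWith.lipschitzOnWith (LipschitzWith.of_dist_le_mul fun W W' => ?_)
      rw [dist_eq_norm, dist_eq_norm, ← ContinuousLinearMap.comp_sub]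
      refine (ContinuousLinearMap.opNorm_comp_le _ _).trans ?_
      refine mul_le_mul_of_nonneg_right ((hA' τ hτ).trans (by norm_num)) (norm_nonneg _)
    · exact hA.clm_comp continuousOn_const
    · refine (ContinuousLinearMap.opNorm_comp_le _ _).trans ?_
      have : ‖W‖ ≤ 2 := by
        rw [mem_closedBall_iff_norm] at hW
        have := norm_le_norm_sub_add W (ContinuousLinearMap.id ℝ E)
        simp only [NNReal.coe_one] at hW
        linarith
      have := hA' τ hτ
      have h0 := norm_nonneg (A τ)
      simp only [NNReal.coe_one]
      nlinarith [norm_nonneg W]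
  obtain ⟨W, hW0, -, hW⟩ := exists_solution_mem_closedBall hPL (Metric.mem_closedBall_self le_rfl)
  exact ⟨W, hW0, hW⟩

/-- Differentiable dependence of the time-one map on the initial value. -/
theorem hasFDerivAt_solution {g : E → E} {g' : E → E →L[ℝ] E} {B : Set E} (hB : IsCompact B)
    (hBc : Convex ℝ B) (hg : ∀ y ∈ B, HasFDerivAt g (g' y) y) (hg' : ContinuousOn g' B)
    (hg1 : ∀ y ∈ B, ‖g' y‖ ≤ 1) {V : Set E} (hV : IsOpen V) {γ : E → ℝ → E}
    (h0 : ∀ x ∈ V, γ x 0 = x) (hγB : ∀ x ∈ V, ∀ τ ∈ Icc (0 : ℝ) 1, γ x τ ∈ B)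
    (hγ : ∀ x ∈ V, ∀ τ ∈ Icc (0 : ℝ) 1, HasDerivWithinAt (γ x) (g (γ x τ)) (Icc 0 1) τ)
    {x : E} (hx : x ∈ V) {W : ℝ → E →L[ℝ] E} (hW0 : W 0 = ContinuousLinearMap.id ℝ E)
    (hW : ∀ τ ∈ Icc (0 : ℝ) 1, HasDerivWithinAt W (g' (γ x τ) ∘L W τ) (Icc 0 1) τ) :
    HasFDerivAt (fun x' => γ x' 1) (W 1) x := by
  have hcont : ∀ x ∈ V, ContinuousOn (γ x) (Icc 0 1) :=
    fun x hx τ hτ => (hγ x hx τ hτ).continuousWithinAt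
  have hWc : ContinuousOn W (Icc 0 1) := fun τ hτ => (hW τ hτ).continuousWithinAt
  have hlip : LipschitzOnWith 1 g B :=
    hBc.lipschitzOnWith_of_nnnorm_hasFDerivWithin_le (fun y hy => (hg y hy).hasFDerivWithinAt)
      fun y hy => by simpa using! hg1 y hy
  have hclose : ∀ x' ∈ V, ∀ τ ∈ Icc (0 : ℝ) 1, ‖γ x' τ - γ x τ‖ ≤ 3 * ‖x' - x‖ := by
    intro x' hx' τ hτ
    have := dist_le_of_approx_trajectories_ODE_of_mem (v := fun _ => g) (K := 1)
      (s := fun _ => B) (f := γ x') (g := γ x) (f' := fun τ => g (γ x' τ))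
      (g' := fun τ => g (γ x τ)) (εf := 0) (εg := 0) (δ := ‖x' - x‖) (a := 0) (b := 1)
      (fun t ht => hlip) (hcont x' hx')
      (fun t ht => hasDerivWithinAt_Ici_of_Icc ht (hγ x' hx' t (Ico_subset_Icc_self ht)))
      (fun t ht => (dist_self _).le) (fun t ht => hγB x' hx' t (Ico_subset_Icc_self ht))
      (hcont x hx)
      (fun t ht => hasDerivWithinAt_Ici_of_Icc ht (hγ x hx t (Ico_subset_Icc_self ht)))
      (fun t ht => (dist_self _).le) (fun t ht => hγB x hx t (Ico_subset_Icc_self ht))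
      (by rw [h0 x' hx', h0 x hx, dist_eq_norm]) τ hτ
    rw [dist_eq_norm, NNReal.coe_one] at this
    have h2 := gronwallBound_zero_one_le (norm_nonneg (x' - x)) (add_zero (0 : ℝ)).ge hτ
    linarith [this]
  rw [hasFDerivAt_iff_isLittleO, Asymptotics.isLittleO_iff]
  intro c hc
  -- The 9 is `3 * 3`: one factor is lost in `hclose`, the other in the final use of Grönwall.
  obtain ⟨η, hη, hunif⟩ := Metric.uniformContinuousOn_iff.1
    (hB.uniformContinuousOn_of_continuous hg') (c / 9) (by positivity)
  have hnear : ∀ᶠ x' in 𝓝 x, x' ∈ V ∧ 3 * ‖x' - x‖ < η := by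
    refine Filter.Eventually.and (hV.mem_nhds hx) ?_
    have : Tendsto (fun x' => 3 * ‖x' - x‖) (𝓝 x) (𝓝 (3 * ‖x - x‖)) :=
      (Continuous.tendsto (by fun_prop) x)
    exact this.eventually (by simpa using! gt_mem_nhds hη)
  filter_upwards [hnear] with x' hx'
  -- The remainder `z = γ x' - γ x - W (x' - x)` satisfies `z' = r + g' (γ x) z`, where `r` is the
  -- first-order Taylor error of `g` between the two curves, of size at most `c / 9 * 3 * ‖x' - x‖`.
  have hz := norm_le_gronwallBound_of_norm_deriv_right_le
    (f := fun τ => γ x' τ - γ x τ - W τ (x' - x))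
    (f' := fun τ => g (γ x' τ) - g (γ x τ) - (g' (γ x τ) ∘L W τ) (x' - x))
    (δ := 0) (K := 1) (ε := c / 3 * ‖x' - x‖) (a := 0) (b := 1)
    (((hcont x' hx'.1).sub (hcont x hx)).sub (hWc.clm_apply continuousOn_const))
    (fun t ht => by
      have ht' := Ico_subset_Icc_self ht
      refine hasDerivWithinAt_Ici_of_Icc ht (((hγ x' hx'.1 t ht').sub (hγ x hx t ht')).sub ?_)
      simpa using! (hW t ht').clm_apply (hasDerivWithinAt_const t (Icc 0 1) (x' - x)))
    (by simp [h0 x' hx'.1, h0 x hx, hW0])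
    (fun t ht => by
      have ht' := Ico_subset_Icc_self ht
      set y := γ x t
      set y' := γ x' t
      have hy : y ∈ B := hγB x hx t ht'
      have hy' : y' ∈ B := hγB x' hx'.1 t ht'
      have hd : ‖y' - y‖ ≤ 3 * ‖x' - x‖ := hclose x' hx'.1 t ht'
      have hmv : ‖g y' - g y - g' y (y' - y)‖ ≤ c / 9 * ‖y' - y‖ := by
        refine (hBc.inter (convex_ball y η)).norm_image_sub_le_of_norm_hasFDerivWithin_le' (f' := g')
          (fun z hz => (hg z hz.1).hasFDerivWithinAt) (fun z hz => ?_)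
          ⟨hy, Metric.mem_ball_self hη⟩ ⟨hy', ?_⟩
        · rw [← dist_eq_norm]
          exact (hunif z hz.1 y hy hz.2).le
        · rw [mem_ball_iff_norm]
          exact hd.trans_lt hx'.2
      have : g y' - g y - (g' y ∘L W t) (x' - x) =
          (g y' - g y - g' y (y' - y)) + g' y (y' - y - W t (x' - x)) := by
        simp [map_sub]
      rw [this]
      refine (norm_add_le _ _).trans ?_
      have h3 := (g' y).le_of_opNorm_le (hg1 y hy) (y' - y - W t (x' - x))
      nlinarith) 1 (by simp)
  have h5 := gronwallBound_zero_one_le (δ := 0) (ε := c / 3 * ‖x' - x‖) (t := 1) le_rfl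
    (by positivity) (by simp)
  refine hz.trans (h5.trans (le_of_eq ?_))
  ring

end ODE

/-! ### Coordinates on the tangent bundle -/

section Coordinates

variable {M : Type*} [TopologicalSpace M] [ChartedSpace R3 M]

/-- The fibre coordinate of a tangent vector in the chart at `p`. -/
def coord (p : M) (v : TangentBundle (𝓡 3) M) : R3 :=
  mfderiv (𝓡 3) 𝓘(ℝ, R3) (chartAt R3 p) v.1 v.2

/-- The tangent vector with given coordinates in the chart at `p`. -/
def ofCoord (p : M) (z : R3 × R3) : TangentBundle (𝓡 3) M :=
  ⟨(chartAt R3 p).symm z.1, mfderiv 𝓘(ℝ, R3) (𝓡 3) (chartAt R3 p).symm z.1 z.2⟩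

theorem chartField_eq_coord (X : ∀ x : M, TangentSpace (𝓡 3) x) (p : M) (y : R3) :
    chartField X p y = coord p ⟨(chartAt R3 p).symm y, X ((chartAt R3 p).symm y)⟩ := rfl

theorem coord_eq_chartField (X : ∀ x : M, TangentSpace (𝓡 3) x) {p x : M}
    (hx : x ∈ (chartAt R3 p).source) : coord p ⟨x, X x⟩ = chartField X p (chartAt R3 p x) := by
  rw [chartField_eq_coord, (chartAt R3 p).left_inv hx]

variable [IsManifold (𝓡 3) ∞ M]

theorem mfderiv_chart_symm_comp {p : M} {y : R3} (hy : y ∈ (chartAt R3 p).target) :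
    (mfderiv (𝓡 3) 𝓘(ℝ, R3) (chartAt R3 p) ((chartAt R3 p).symm y)).comp
      (mfderiv 𝓘(ℝ, R3) (𝓡 3) (chartAt R3 p).symm y) = ContinuousLinearMap.id ℝ R3 :=
  (mdifferentiable_chart (I := 𝓡 3) p).comp_symm_deriv hy

theorem mfderiv_symm_comp_chart {p x : M} (hx : x ∈ (chartAt R3 p).source) :
    (mfderiv 𝓘(ℝ, R3) (𝓡 3) (chartAt R3 p).symm (chartAt R3 p x)).comp
      (mfderiv (𝓡 3) 𝓘(ℝ, R3) (chartAt R3 p) x) =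
        ContinuousLinearMap.id ℝ (TangentSpace (𝓡 3) x) :=
  (mdifferentiable_chart (I := 𝓡 3) p).symm_comp_deriv hx

theorem coord_ofCoord {p : M} {z : R3 × R3} (hz : z.1 ∈ (chartAt R3 p).target) :
    coord p (ofCoord p z) = z.2 :=
  DFunLike.congr_fun (mfderiv_chart_symm_comp hz) z.2

theorem ofCoord_coord {p : M} {v : TangentBundle (𝓡 3) M} (hv : v.1 ∈ (chartAt R3 p).source) :
    ofCoord p (chartAt R3 p v.1, coord p v) = v := by
  obtain ⟨x, v⟩ := v
  have h := DFunLike.congr_fun (mfderiv_symm_comp_chart hv) v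
  have hx : (chartAt R3 p).symm (chartAt R3 p x) = x := (chartAt R3 p).left_inv hv
  unfold ofCoord coord
  refine Bundle.TotalSpace.ext hx ?_
  exact heq_of_eq h

theorem coord_injective {p x : M} (hx : x ∈ (chartAt R3 p).source) {v w : TangentSpace (𝓡 3) x}
    (h : coord p ⟨x, v⟩ = coord p ⟨x, w⟩) : v = w := by
  have h1 := ofCoord_coord (p := p) (v := ⟨x, v⟩) hx
  have h2 := ofCoord_coord (p := p) (v := ⟨x, w⟩) hx
  rw [h] at h1
  have := h1.symm.trans h2
  simpa using! this

theorem continuous_proj : Continuous fun v : TangentBundle (𝓡 3) M => v.1 :=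
  FiberBundle.continuous_proj R3 (TangentSpace (𝓡 3))

theorem continuousOn_coord (p : M) :
    ContinuousOn (coord p) {v : TangentBundle (𝓡 3) M | v.1 ∈ (chartAt R3 p).source} := by
  have h := (contMDiffOn_chart (I := 𝓡 3) (n := 1) (x := p)).continuousOn_tangentMapWithin
    le_rfl (chartAt R3 p).open_source.uniqueMDiffOn
  have h2 := (tangentBundleModelSpaceHomeomorph (𝓡 3)).continuous.comp_continuousOn h
  refine (continuous_snd.comp_continuousOn h2).congr fun v hv => ?_
  unfold coord
  rw [← mfderivWithin_of_isOpen (chartAt R3 p).open_source hv]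
  rfl

theorem continuousOn_ofCoord (p : M) :
    ContinuousOn (ofCoord p) ((chartAt R3 p).target ×ˢ univ) := by
  have h := (contMDiffOn_chart_symm (I := 𝓡 3) (n := 1) (x := p)).continuousOn_tangentMapWithin
    le_rfl (chartAt R3 p).open_target.uniqueMDiffOn
  have h2 := h.comp (tangentBundleModelSpaceHomeomorph (𝓡 3)).symm.continuous.continuousOn
    (s := (chartAt R3 p).target ×ˢ (univ : Set R3)) (fun z hz => hz.1)
  refine h2.congr fun z hz => ?_
  unfold ofCoord
  rw [← mfderivWithin_of_isOpen (chartAt R3 p).open_target hz.1]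
  rfl

/-- Over the chart domain, `coord p` together with the chart is a continuous bijection with
continuous inverse `ofCoord p`, because tangent maps of `C¹` maps are continuous. All later
continuity statements on the tangent bundle are tested in this way. -/
theorem continuousAt_tangentBundle_iff {Y : Type*} [TopologicalSpace Y]
    {f : Y → TangentBundle (𝓡 3) M} {y : Y} {p : M} (hp : (f y).1 ∈ (chartAt R3 p).source) :
    ContinuousAt f y ↔ ContinuousAt (fun z => (f z).1) y ∧ ContinuousAt (fun z => coord p (f z)) y := by
  refine ⟨fun h => ⟨continuous_proj.continuousAt.comp h, ?_⟩, fun ⟨h1, h2⟩ => ?_⟩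
  · refine ContinuousAt.comp (g := coord p) ?_ h
    exact (continuousOn_coord p).continuousAt
      (((chartAt R3 p).open_source.preimage continuous_proj).mem_nhds hp)
  · have h3 : ContinuousAt (fun z => ofCoord p (chartAt R3 p (f z).1, coord p (f z))) y := by
      refine ContinuousAt.comp (g := ofCoord p) ?_ ?_
      · exact (continuousOn_ofCoord p).continuousAt
          (((chartAt R3 p).open_target.prod isOpen_univ).mem_nhds
            ⟨(chartAt R3 p).map_source hp, mem_univ _⟩)
      · exact (ContinuousAt.comp (g := chartAt R3 p) (f := fun z => (f z).1)
          ((chartAt R3 p).continuousAt hp) h1).prodMk h2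
    refine h3.congr ?_
    filter_upwards [h1.eventually ((chartAt R3 p).open_source.mem_nhds hp)] with z hz
    exact ofCoord_coord hz

theorem apply_eq_chartForm (α : ∀ x : M, TangentSpace (𝓡 3) x [⋀^Fin 3]→L[ℝ] ℝ) {p x : M}
    (hx : x ∈ (chartAt R3 p).source) (v : Fin 3 → TangentSpace (𝓡 3) x) :
    α x v = chartForm α p (chartAt R3 p x) fun i => coord p ⟨x, v i⟩ := by
  -- The points `x` and `(chartAt R3 p).symm (chartAt R3 p x)` agree only propositionally. Regarding
  -- both tangent spaces as `R3` lets `key` transport the value by substitution.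
  change α x v = (α ((chartAt R3 p).symm (chartAt R3 p x)) : (Fin 3 → R3) → ℝ) (fun i =>
    (mfderiv 𝓘(ℝ, R3) (𝓡 3) (chartAt R3 p).symm (chartAt R3 p x) : R3 → R3)
      ((mfderiv (𝓡 3) 𝓘(ℝ, R3) (chartAt R3 p) x : R3 → R3) (v i)))
  have key : ∀ (x' : M) (_ : x' = x) (w : Fin 3 → R3),
      (w = fun i => (v i : R3)) → (α x' : (Fin 3 → R3) → ℝ) w = α x v := by
    rintro _ rfl w rfl; rfl
  refine (key _ ((chartAt R3 p).left_inv hx) _ ?_).symm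
  funext i
  exact DFunLike.congr_fun (mfderiv_symm_comp_chart hx) (v i)

theorem continuousAt_form (μ : VolumeForm M) {Y : Type*} [TopologicalSpace Y] {b : Y → M}
    {v : ∀ y, Fin 3 → TangentSpace (𝓡 3) (b y)} {y : Y}
    (hv : ∀ i, ContinuousAt (fun y => (⟨b y, v y i⟩ : TangentBundle (𝓡 3) M)) y) :
    ContinuousAt (fun y => μ.toFun (b y) (v y)) y := by
  set p := b y
  have hp : b y ∈ (chartAt R3 p).source := mem_chart_source R3 p
  have hb : ContinuousAt b y := ((continuousAt_tangentBundle_iff (f := fun y =>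
    (⟨b y, v y 0⟩ : TangentBundle (𝓡 3) M)) hp).1 (hv 0)).1
  have h2 : ContinuousAt (fun z => chartForm μ.toFun p (chartAt R3 p (b z))
      fun i => coord p ⟨b z, v z i⟩) y := by
    have h3 : ContinuousAt (fun z => chartForm μ.toFun p (chartAt R3 p (b z))) y := by
      refine ContinuousAt.comp (g := fun z => chartForm μ.toFun p z) ?_
        (ContinuousAt.comp (g := chartAt R3 p) ((chartAt R3 p).continuousAt hp) hb)
      exact (μ.smooth p).continuousOn.continuousAt
        ((chartAt R3 p).open_target.mem_nhds ((chartAt R3 p).map_source hp))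
    have h4 : ContinuousAt (fun z => fun i => coord p ⟨b z, v z i⟩) y :=
      continuousAt_pi.2 fun i => ((continuousAt_tangentBundle_iff (f := fun y =>
        (⟨b y, v y i⟩ : TangentBundle (𝓡 3) M)) hp).1 (hv i)).2
    exact ContinuousEval.continuous_eval.continuousAt.comp (h3.prodMk h4)
  refine h2.congr ?_
  filter_upwards [hb.eventually ((chartAt R3 p).open_source.mem_nhds hp)] with z hz
  exact (apply_eq_chartForm μ.toFun hz _).symm

/-! ### Vector fields in coordinates -/

theorem contDiffOn_chartField (X : C1VectorField M) (p : M) :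
    ContDiffOn ℝ 1 (chartField X p) (chartAt R3 p).target := by
  have h1 : ContMDiffOn (𝓡 3) 𝓘(ℝ, R3) 1 (fun x => coord p ⟨x, X x⟩) (chartAt R3 p).source := by
    have h := (trivializationAt R3 (TangentSpace (𝓡 3) : M → Type _) p).contMDiffOn_section_baseSet_iff
      (IB := 𝓡 3) (n := 1) (s := fun x => X x) |>.1 X.contMDiff.contMDiffOn
    rw [TangentBundle.trivializationAt_baseSet] at h
    refine h.congr fun x hx => ?_
    have h3 := TangentBundle.continuousLinearMapAt_trivializationAt (I := 𝓡 3) hx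
    have h4 : coord p ⟨x, X x⟩ = mfderiv (𝓡 3) 𝓘(ℝ, R3) (extChartAt (𝓡 3) p) x (X x) := by
      unfold coord; simp only [mfld_simps]; rfl
    refine h4.trans ((DFunLike.congr_fun h3 (X x)).symm.trans ?_)
    exact Bundle.Trivialization.continuousLinearMapAt_apply_of_mem ℝ _ hx (X x)
  have h2 : ContMDiffOn 𝓘(ℝ, R3) 𝓘(ℝ, R3) 1 (chartField X p) (chartAt R3 p).target :=
    h1.comp (contMDiffOn_chart_symm (I := 𝓡 3) (n := 1) (x := p))
      fun y hy => (chartAt R3 p).map_target hy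
  exact contMDiffOn_iff_contDiffOn.1 h2

theorem hasFDerivAt_chartField (X : C1VectorField M) {p : M} {y : R3}
    (hy : y ∈ (chartAt R3 p).target) :
    HasFDerivAt (chartField X p) (fderiv ℝ (chartField X p) y) y :=
  (((contDiffOn_chartField X p).contDiffAt
    ((chartAt R3 p).open_target.mem_nhds hy)).differentiableAt one_ne_zero).hasFDerivAt

/-- This is where the `C¹`-topology enters: it is uniform convergence of the coordinates and their
derivatives on a compact neighbourhood of the point, which makes evaluation jointly continuous in
the field and the point. -/
theorem continuousAt_chartField (p : M) {z : C1VectorField M × R3}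
    (hz : z.2 ∈ (chartAt R3 p).target) :
    ContinuousAt (fun z : C1VectorField M × R3 =>
      (chartField z.1 p z.2, fderiv ℝ (chartField z.1 p) z.2)) z := by
  obtain ⟨X, y⟩ := z
  set S : Set (Set R3) := {K : Set R3 | IsCompact K ∧ K ⊆ (chartAt R3 p).target}
  let F : C1VectorField M → UniformOnFun R3 (R3 × (R3 →L[ℝ] R3)) S := fun X =>
    UniformOnFun.ofFun S (fun y => (chartField X p y, fderiv ℝ (chartField X p) y))
  have hF : Continuous F := by
    refine continuous_iInf_dom (i := p) ?_
    exact continuous_induced_dom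
  obtain ⟨K, hK, hyK, hKt⟩ := exists_compact_subset (chartAt R3 p).open_target hz
  have h1 := UniformOnFun.continuousAt_eval₂ (f := F X) (x := y) (𝔖 := S)
    ⟨K, ⟨hK, hKt⟩, mem_interior_iff_mem_nhds.1 hyK⟩ (by
      have hc := contDiffOn_chartField X p
      have hn := (chartAt R3 p).open_target.mem_nhds hz
      exact (hc.continuousOn.continuousAt hn).prodMk
        ((hc.continuousOn_fderiv_of_isOpen (chartAt R3 p).open_target le_rfl).continuousAt hn))
  exact ContinuousAt.comp (g := fun fx : UniformOnFun R3 (R3 × (R3 →L[ℝ] R3)) S × R3 =>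
    (UniformOnFun.toFun S) fx.1 fx.2) (f := fun z : C1VectorField M × R3 => (F z.1, z.2))
    (x := (X, y)) h1
    (hF.prodMap continuous_id).continuousAt

theorem continuous_eval_field :
    Continuous fun z : C1VectorField M × M => (⟨z.2, z.1 z.2⟩ : TangentBundle (𝓡 3) M) := by
  rw [continuous_iff_continuousAt]
  rintro ⟨X, x⟩
  have hx := mem_chart_source R3 x
  refine (continuousAt_tangentBundle_iff (p := x) hx).2 ⟨continuousAt_snd, ?_⟩
  have h1 : ContinuousAt (fun z : C1VectorField M × M => chartField z.1 x (chartAt R3 x z.2)) (X, x) := by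
    refine ContinuousAt.comp (g := fun z : C1VectorField M × R3 => chartField z.1 x z.2)
      (f := fun z : C1VectorField M × M => (z.1, chartAt R3 x z.2))
      (continuousAt_chartField x (z := (X, chartAt R3 x x)) (mem_chart_target R3 x)).fst ?_
    exact continuousAt_fst.prodMk (ContinuousAt.comp' ((chartAt R3 x).continuousAt hx) continuousAt_snd)
  refine h1.congr ?_
  filter_upwards [continuousAt_snd.eventually ((chartAt R3 x).open_source.mem_nhds hx)] with z hz
  exact (coord_eq_chartField z.1 hz).symm

end Coordinates

/-! ### The flow of a vector field -/

section Flow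

variable {M : Type*} [TopologicalSpace M] [ChartedSpace R3 M]

theorem chart_preimage_ball_mem_nhds (p : M) {R : ℝ} (hR : 0 < R) :
    (chartAt R3 p).source ∩ chartAt R3 p ⁻¹' Metric.ball (chartAt R3 p p) R ∈ 𝓝 p :=
  inter_mem (chart_source_mem_nhds R3 p)
    ((chartAt R3 p).continuousAt (mem_chart_source R3 p) (Metric.ball_mem_nhds _ hR))

variable [IsManifold (𝓡 3) ∞ M]

theorem hasMFDerivAt_chart_symm_comp {X : C1VectorField M} {p : M} {α : ℝ → R3} {t : ℝ}
    (ht : α t ∈ (chartAt R3 p).target) (hα : HasDerivAt α (chartField X p (α t)) t) :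
    HasMFDerivAt 𝓘(ℝ, ℝ) (𝓡 3) ((chartAt R3 p).symm ∘ α) t
      ((1 : ℝ →L[ℝ] ℝ).smulRight (X ((chartAt R3 p).symm (α t)))) := by
  have h1 : HasMFDerivAt 𝓘(ℝ, R3) (𝓡 3) (chartAt R3 p).symm (α t)
      (mfderiv 𝓘(ℝ, R3) (𝓡 3) (chartAt R3 p).symm (α t)) :=
    ((mdifferentiable_chart (I := 𝓡 3) p).mdifferentiableAt_symm ht).hasMFDerivAt
  have h2 := HasMFDerivAt.comp t h1 hα.hasFDerivAt.hasMFDerivAt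
  refine h2.congr_mfderiv ?_
  refine ContinuousLinearMap.ext fun (c : ℝ) => ?_
  have h4 : mfderiv 𝓘(ℝ, R3) (𝓡 3) (chartAt R3 p).symm (α t) (chartField X p (α t)) =
      X ((chartAt R3 p).symm (α t)) := by
    have h3 := mfderiv_symm_comp_chart ((chartAt R3 p).map_target ht)
    rw [(chartAt R3 p).right_inv ht] at h3
    exact DFunLike.congr_fun h3 (X ((chartAt R3 p).symm (α t)))
  have h5 := map_smul (mfderiv 𝓘(ℝ, R3) (𝓡 3) (chartAt R3 p).symm (α t)) c (chartField X p (α t))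
  exact h5.trans (congrArg (fun v => c • v) h4)

theorem hasDerivAt_of_hasFDerivAt_comp_smulRight {E F : Type*} [NormedAddCommGroup E]
    [NormedSpace ℝ E] [NormedAddCommGroup F] [NormedSpace ℝ F] {f : ℝ → F} {t : ℝ} {L : E →L[ℝ] F}
    {v : E} (h : HasFDerivAt f (L.comp ((1 : ℝ →L[ℝ] ℝ).smulRight v)) t) :
    HasDerivAt f (L v) t :=
  h.hasDerivAt.congr_deriv (by simp)

theorem hasDerivAt_chart_comp {X : C1VectorField M} {p : M} {γ : ℝ → M} {t : ℝ}
    (ht : γ t ∈ (chartAt R3 p).source)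
    (hγ : HasMFDerivAt 𝓘(ℝ, ℝ) (𝓡 3) γ t ((1 : ℝ →L[ℝ] ℝ).smulRight (X (γ t)))) :
    HasDerivAt (fun t => chartAt R3 p (γ t)) (chartField X p (chartAt R3 p (γ t))) t := by
  have h1 : HasMFDerivAt (𝓡 3) 𝓘(ℝ, R3) (chartAt R3 p) (γ t)
      (mfderiv (𝓡 3) 𝓘(ℝ, R3) (chartAt R3 p) (γ t)) :=
    ((mdifferentiable_chart (I := 𝓡 3) p).mdifferentiableAt ht).hasMFDerivAt
  rw [← coord_eq_chartField _ ht]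
  exact hasDerivAt_of_hasFDerivAt_comp_smulRight (E := R3) (F := R3)
    (L := (mfderiv (𝓡 3) 𝓘(ℝ, R3) (chartAt R3 p) (γ t) : R3 →L[ℝ] R3)) (v := (X (γ t) : R3))
    (HasMFDerivAt.comp t h1 hγ).hasFDerivAt

/-- One constant serves for all fields near `X₀`. The existence times and Lipschitz bounds derived
from it are then uniform in the field, as the continuity of the invariant requires. -/
theorem exists_local_bound (X₀ : C1VectorField M) (p : M) :
    ∃ R > 0, ∃ C > 0, Metric.closedBall (chartAt R3 p p) R ⊆ (chartAt R3 p).target ∧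
      ∀ᶠ X : C1VectorField M in 𝓝 X₀, ∀ y ∈ Metric.closedBall (chartAt R3 p p) R,
        ‖chartField X p y‖ ≤ C ∧ ‖fderiv ℝ (chartField X p) y‖ ≤ C := by
  set y₀ := chartAt R3 p p
  have h := (continuousAt_chartField p (z := (X₀, y₀)) (mem_chart_target R3 p)).norm
  set c := ‖(chartField X₀ p y₀, fderiv ℝ (chartField X₀ p) y₀)‖
  have h1 : ∀ᶠ z : C1VectorField M × R3 in 𝓝 (X₀, y₀),
      ‖(chartField z.1 p z.2, fderiv ℝ (chartField z.1 p) z.2)‖ < c + 1 :=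
    h.eventually (gt_mem_nhds (lt_add_one _))
  have h2 := h1.and (continuousAt_snd.eventually
    ((chartAt R3 p).open_target.mem_nhds (mem_chart_target R3 p)))
  rw [nhds_prod_eq] at h2
  obtain ⟨P, hP, P', hP', H⟩ := Filter.eventually_prod_iff.1 h2
  obtain ⟨R, hR, hball⟩ := Metric.nhds_basis_closedBall.mem_iff.1 hP'
  refine ⟨R, hR, c + 1, by positivity, fun y hy => (H hP.self_of_nhds (hball hy)).2, ?_⟩
  filter_upwards [hP] with X hX y hy
  have := (H hX (hball hy)).1.le
  exact ⟨(norm_fst_le _).trans this, (norm_snd_le _).trans this⟩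

theorem exists_chart_solution {X : C1VectorField M} {p : M} {R C δ : ℝ} (hR : 0 < R) (hC : 0 < C)
    (hδ : 0 < δ) (hCδ : C * δ ≤ R / 2)
    (hT : Metric.closedBall (chartAt R3 p p) R ⊆ (chartAt R3 p).target)
    (hX : ∀ y ∈ Metric.closedBall (chartAt R3 p p) R,
        ‖chartField X p y‖ ≤ C ∧ ‖fderiv ℝ (chartField X p) y‖ ≤ C)
    {y : R3} (hy : y ∈ Metric.closedBall (chartAt R3 p p) (R / 2)) :
    ∃ α : ℝ → R3, α 0 = y ∧ (∀ t, α t ∈ Metric.closedBall (chartAt R3 p p) R) ∧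
      ∀ t ∈ Ioo (-δ) δ, HasDerivAt α (chartField X p (α t)) t := by
  lift R to NNReal using hR.le
  lift C to NNReal using hC.le
  have hR2 : ((R / 2 : NNReal) : ℝ) = (R : ℝ) / 2 := by simp
  have hPL : IsPicardLindelof (fun _ => chartField X p) (tmin := -δ) (tmax := δ)
      ⟨0, by constructor <;> linarith⟩ (chartAt R3 p p) R (R / 2) C C := by
    refine ⟨fun t _ => ?_, fun y _ => continuousOn_const, fun t _ y hy => (hX y hy).1, ?_⟩
    · refine (convex_closedBall _ _).lipschitzOnWith_of_nnnorm_hasFDerivWithin_le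
        (f' := fderiv ℝ (chartField X p))
        (fun y hy => (hasFDerivAt_chartField X (hT hy)).hasFDerivWithinAt) fun y hy => (hX y hy).2
    · simp only [sub_zero, zero_sub, neg_neg, max_self, hR2]
      linarith
  obtain ⟨α, h0, hα, hd⟩ := exists_solution_mem_closedBall hPL (x := y) (by rwa [hR2])
  exact ⟨α, h0, hα, fun t ht => (hd t (Ioo_subset_Icc_self ht)).hasDerivAt (Icc_mem_nhds ht.1 ht.2)⟩

theorem exists_isMIntegralCurveOn_chart {X : C1VectorField M} {p : M} {R C δ : ℝ} (hR : 0 < R)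
    (hC : 0 < C) (hδ : 0 < δ) (hCδ : C * δ ≤ R / 2)
    (hT : Metric.closedBall (chartAt R3 p p) R ⊆ (chartAt R3 p).target)
    (hX : ∀ y ∈ Metric.closedBall (chartAt R3 p p) R,
        ‖chartField X p y‖ ≤ C ∧ ‖fderiv ℝ (chartField X p) y‖ ≤ C)
    {x : M} (hxs : x ∈ (chartAt R3 p).source)
    (hx : chartAt R3 p x ∈ Metric.closedBall (chartAt R3 p p) (R / 2)) :
    ∃ γ : ℝ → M, γ 0 = x ∧ (∀ t, γ t ∈ (chartAt R3 p).source ∧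
        chartAt R3 p (γ t) ∈ Metric.closedBall (chartAt R3 p p) R) ∧
      IsMIntegralCurveOn γ X (Ioo (-δ) δ) := by
  obtain ⟨α, h0, hα, hd⟩ := exists_chart_solution hR hC hδ hCδ hT hX hx
  refine ⟨(chartAt R3 p).symm ∘ α, ?_, fun t => ⟨(chartAt R3 p).map_target (hT (hα t)), ?_⟩,
    fun t ht => (hasMFDerivAt_chart_symm_comp (hT (hα t)) (hd t ht)).hasMFDerivWithinAt⟩
  · rw [Function.comp_apply, h0, (chartAt R3 p).left_inv hxs]
  · rw [Function.comp_apply, (chartAt R3 p).right_inv (hT (hα t))]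
    exact hα t

/-- The first bound keeps solutions that start in the half ball inside the ball; the second is the
one needed for the linearized equation in `exists_linear_solution`. -/
theorem exists_delta {R C : ℝ} (hR : 0 < R) (hC : 0 < C) :
    ∃ δ > 0, C * δ ≤ R / 2 ∧ C * δ ≤ 1 / 2 := by
  refine ⟨min (R / 2) (1 / 2) / C, by positivity, ?_, ?_⟩ <;> rw [mul_div_cancel₀ _ hC.ne']
  exacts [min_le_left _ _, min_le_right _ _]

variable [T2Space M] [CompactSpace M]

/-- By compactness finitely many charts give a common existence time, and a common existence time at
all points makes integral curves complete. Hence the default branch in the definition of `flow`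
never occurs. -/
theorem exists_isMIntegralCurve (X : C1VectorField M) (x : M) :
    ∃ γ : ℝ → M, γ 0 = x ∧ IsMIntegralCurve γ X := by
  have hloc : ∀ p : M, ∃ V ∈ 𝓝 p, ∃ δ > 0, ∀ x ∈ V, ∃ γ : ℝ → M, γ 0 = x ∧
      IsMIntegralCurveOn γ X (Ioo (-δ) δ) := by
    intro p
    obtain ⟨R, hR, C, hC, hT, hX⟩ := exists_local_bound X p
    obtain ⟨δ, hδ, hCδ, -⟩ := exists_delta hR hC
    refine ⟨_, chart_preimage_ball_mem_nhds p (half_pos hR), δ, hδ, fun x hx => ?_⟩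
    obtain ⟨γ, h0, -, hγ⟩ := exists_isMIntegralCurveOn_chart hR hC hδ hCδ hT hX.self_of_nhds hx.1
      (Metric.ball_subset_closedBall hx.2)
    exact ⟨γ, h0, hγ⟩
  choose V hV δ hδ H using hloc
  obtain ⟨T, hT⟩ := (isCompact_univ (X := M)).elim_nhds_subcover V fun p _ => hV p
  obtain ⟨ε, hε, hεδ⟩ : ∃ ε > 0, ∀ p ∈ T, ε ≤ δ p := by
    rcases T.eq_empty_or_nonempty with rfl | hne
    · exact ⟨1, one_pos, by simp⟩
    · exact ⟨T.inf' hne δ, (Finset.lt_inf'_iff _).2 fun p _ => hδ p, fun p hp => Finset.inf'_le _ hp⟩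
  refine exists_isMIntegralCurve_of_isMIntegralCurveOn X.contMDiff hε (fun x => ?_) x
  obtain ⟨p, hp, hx⟩ := mem_iUnion₂.1 (hT.2 (mem_univ x))
  obtain ⟨γ, h0, hγ⟩ := H p x hx
  exact ⟨γ, h0, hγ.mono (Ioo_subset_Ioo (neg_le_neg (hεδ p hp)) (hεδ p hp))⟩

theorem flow_eq (X : C1VectorField M) (x : M) :
    ∃ γ : ℝ → M, (∀ t, flow X t x = γ t) ∧ γ 0 = x ∧ IsMIntegralCurve γ X := by
  have h := exists_isMIntegralCurve X x
  refine ⟨h.choose, fun t => ?_, h.choose_spec⟩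
  unfold flow
  rw [dif_pos h]

@[simp] theorem flow_zero (X : C1VectorField M) (x : M) : flow X 0 x = x := by
  obtain ⟨γ, h1, h0, -⟩ := flow_eq X x
  rw [h1, h0]

theorem isMIntegralCurve_flow (X : C1VectorField M) (x : M) :
    IsMIntegralCurve (fun t => flow X t x) X := by
  obtain ⟨γ, h1, -, h⟩ := flow_eq X x
  have : (fun t => flow X t x) = γ := funext h1
  rwa [this]

theorem flow_add (X : C1VectorField M) (s t : ℝ) (x : M) :
    flow X (s + t) x = flow X s (flow X t x) := by
  have h1 := (isMIntegralCurve_flow X x).comp_add t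
  have h2 := isMIntegralCurve_flow X (flow X t x)
  have := isMIntegralCurve_Ioo_eq_of_contMDiff_boundaryless (t₀ := 0) X.contMDiff h1 h2 (by simp)
  exact congrFun this s

/-- Integral curves are unique, so for short times the global flow is the curve constructed in the
chart and inherits its confinement. -/
theorem flow_mem_chart {X : C1VectorField M} {p : M} {R C δ : ℝ} (hR : 0 < R) (hC : 0 < C)
    (hδ : 0 < δ) (hCδ : C * δ ≤ R / 2)
    (hT : Metric.closedBall (chartAt R3 p p) R ⊆ (chartAt R3 p).target)
    (hX : ∀ y ∈ Metric.closedBall (chartAt R3 p p) R,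
        ‖chartField X p y‖ ≤ C ∧ ‖fderiv ℝ (chartField X p) y‖ ≤ C)
    {x : M} (hxs : x ∈ (chartAt R3 p).source)
    (hx : chartAt R3 p x ∈ Metric.closedBall (chartAt R3 p p) (R / 2)) {t : ℝ}
    (ht : t ∈ Ioo (-δ) δ) : flow X t x ∈ (chartAt R3 p).source ∧
      chartAt R3 p (flow X t x) ∈ Metric.closedBall (chartAt R3 p p) R := by
  obtain ⟨γ, h0, hγ, hi⟩ := exists_isMIntegralCurveOn_chart hR hC hδ hCδ hT hX hxs hx
  have := isMIntegralCurveOn_Ioo_eqOn_of_contMDiff_boundaryless (t₀ := 0) (a := -δ) (b := δ)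
    ⟨by linarith, hδ⟩ X.contMDiff ((isMIntegralCurve_flow X x).isMIntegralCurveOn _) hi
    (by simp [h0]) ht
  simp only at this
  rw [this]
  exact hγ t

/-- In the chart at `p`, near `X₀` and `p` and for small times, the flow and its derivative are given
by continuous maps `G` and `W`, and are joined to the identity by solutions of the equation of the
flow and of its linearization. -/
theorem exists_local_flow (X₀ : C1VectorField M) (p : M) :
    ∃ U ∈ 𝓝 X₀, ∃ r > 0, ∃ δ > 0, ∃ (G : C1VectorField M × ℝ × R3 → R3)
      (W : C1VectorField M × ℝ × R3 → R3 →L[ℝ] R3),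
      ContinuousOn G (U ×ˢ Ioo (-δ) δ ×ˢ Metric.ball (chartAt R3 p p) r) ∧
      ContinuousOn W (U ×ˢ Ioo (-δ) δ ×ˢ Metric.ball (chartAt R3 p p) r) ∧
      ∀ X ∈ U, ∀ s ∈ Ioo (-δ) δ, ∀ y ∈ Metric.ball (chartAt R3 p p) r,
        y ∈ (chartAt R3 p).target ∧ G (X, s, y) ∈ (chartAt R3 p).target ∧
        flow X s ((chartAt R3 p).symm y) = (chartAt R3 p).symm (G (X, s, y)) ∧
        HasFDerivAt (fun y' => G (X, s, y')) (W (X, s, y)) y ∧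
        ∃ (γ : ℝ → R3) (w : ℝ → R3 →L[ℝ] R3), γ 0 = y ∧ γ 1 = G (X, s, y) ∧
          w 0 = ContinuousLinearMap.id ℝ R3 ∧ w 1 = W (X, s, y) ∧
          ∀ τ ∈ Icc (0 : ℝ) 1, γ τ ∈ (chartAt R3 p).target ∧
            HasDerivWithinAt γ (s • chartField X p (γ τ)) (Icc 0 1) τ ∧
            HasDerivWithinAt w ((s • fderiv ℝ (chartField X p) (γ τ)) ∘L w τ) (Icc 0 1) τ := by
  obtain ⟨R, hR, C, hC, hT, hX⟩ := exists_local_bound X₀ p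
  obtain ⟨δ, hδ, hCδ, hCδ'⟩ := exists_delta hR hC
  set y₀ := chartAt R3 p p
  set B := Metric.closedBall y₀ R
  set U := {X : C1VectorField M | ∀ y ∈ B, ‖chartField X p y‖ ≤ C ∧ ‖fderiv ℝ (chartField X p) y‖ ≤ C}
  set D : Set (C1VectorField M × ℝ × R3) := U ×ˢ Ioo (-δ) δ ×ˢ Metric.ball y₀ (R / 2)
  have hbT : Metric.ball y₀ (R / 2) ⊆ B :=
    (Metric.ball_subset_ball (by linarith)).trans Metric.ball_subset_closedBall
  -- Rescaling time by `s` turns the elapsed time into a parameter. All curves now live on `[0, 1]`,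
  -- follow the field `s • X`, and depend on `q = (X, s, y)`, so a single theorem on dependence on
  -- parameters gives joint continuity.
  let γ : C1VectorField M × ℝ × R3 → ℝ → R3 := fun q τ =>
    chartAt R3 p (flow q.1 (q.2.1 * τ) ((chartAt R3 p).symm q.2.2))
  have hmem : ∀ q ∈ D, ∀ τ ∈ Icc (0 : ℝ) 1, q.2.1 * τ ∈ Ioo (-δ) δ := by
    rintro ⟨X, s, y⟩ ⟨-, hs, -⟩ τ hτ
    have hs' : |s| < δ := abs_lt.2 hs
    refine abs_lt.1 ?_
    rw [abs_mul, abs_of_nonneg hτ.1]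
    nlinarith [abs_nonneg s, hτ.2]
  have hin : ∀ q ∈ D, ∀ τ ∈ Icc (0 : ℝ) 1,
      flow q.1 (q.2.1 * τ) ((chartAt R3 p).symm q.2.2) ∈ (chartAt R3 p).source ∧ γ q τ ∈ B := by
    intro q hq τ hτ
    have hy : q.2.2 ∈ (chartAt R3 p).target := hT (hbT hq.2.2)
    refine flow_mem_chart hR hC hδ hCδ hT hq.1 ((chartAt R3 p).map_target hy) ?_ (hmem q hq τ hτ)
    rw [(chartAt R3 p).right_inv hy]
    exact Metric.ball_subset_closedBall hq.2.2
  have hγd : ∀ q ∈ D, ∀ τ ∈ Icc (0 : ℝ) 1,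
      HasDerivWithinAt (γ q) (q.2.1 • chartField q.1 p (γ q τ)) (Icc 0 1) τ := by
    intro q hq τ hτ
    have h1 := hasDerivAt_chart_comp (hin q hq τ hτ).1
      (isMIntegralCurve_flow q.1 ((chartAt R3 p).symm q.2.2) (q.2.1 * τ))
    have h2 : HasDerivAt (fun τ => q.2.1 * τ) q.2.1 τ := by
      simpa using (hasDerivAt_id τ).const_mul q.2.1
    exact (HasDerivAt.scomp (h := fun τ => q.2.1 * τ) τ h1 h2).hasDerivWithinAt
  have hγ0 : ∀ q ∈ D, γ q 0 = q.2.2 := by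
    intro q hq
    simp only [γ, mul_zero, flow_zero]
    exact (chartAt R3 p).right_inv (hT (hbT hq.2.2))
  have hsC : ∀ q ∈ D, ∀ y ∈ B, ‖q.2.1 • fderiv ℝ (chartField q.1 p) y‖ ≤ 1 / 2 := by
    intro q hq y hy
    rw [norm_smul, Real.norm_eq_abs]
    have h1 : |q.2.1| ≤ δ := (abs_lt.2 hq.2.1).le
    calc |q.2.1| * ‖fderiv ℝ (chartField q.1 p) y‖ ≤ δ * C :=
          mul_le_mul h1 (hq.1 y hy).2 (norm_nonneg _) hδ.le
      _ ≤ 1 / 2 := by linarith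
  have hfd : ∀ (s : ℝ) (X : C1VectorField M), ∀ y ∈ B, HasFDerivAt (fun y => s • chartField X p y)
      (s • fderiv ℝ (chartField X p) y) y :=
    fun s X y hy => (hasFDerivAt_chartField X (hT hy)).const_smul s
  -- continuity of the curves
  have hγc : ContinuousOn (fun z : D × ℝ => γ z.1 z.2) (univ ×ˢ Icc 0 1) := by
    refine continuousOn_solution (v := fun (q : D) _ y => q.1.2.1 • chartField q.1.1 p y) (s := B)
      (γ := fun q => γ q.1) (fun q τ _ => ?_) (fun q τ hτ => hγd q q.2 τ hτ)
      (fun q τ hτ => (hin q q.2 τ hτ).2) ?_ (fun q₁ => ?_)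
    · refine (convex_closedBall _ _).lipschitzOnWith_of_nnnorm_hasFDerivWithin_le
        (fun y hy => (hfd q.1.2.1 q.1.1 y hy).hasFDerivWithinAt) fun y hy => ?_
      exact (hsC q q.2 y hy).trans (by norm_num)
    · exact (continuous_subtype_val.snd.snd).congr fun q => (hγ0 q q.2).symm
    · rintro ⟨q, τ⟩ ⟨-, hτ⟩
      have h1 : ContinuousWithinAt (fun z : D × ℝ => (z.1.1.1, γ q₁ z.2)) (univ ×ˢ Icc 0 1) (q, τ) := by
        refine (continuous_subtype_val.comp continuous_fst).fst.continuousWithinAt.prodMk ?_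
        exact ContinuousWithinAt.comp (g := γ q₁) (f := fun z : D × ℝ => z.2) (x := (q, τ))
          (hγd q₁ q₁.2 τ hτ).continuousWithinAt continuousWithinAt_snd fun z hz => hz.2
      have h2 := ContinuousAt.comp_continuousWithinAt
        (g := fun z : C1VectorField M × R3 => chartField z.1 p z.2)
        (f := fun z : D × ℝ => (z.1.1.1, γ q₁ z.2)) (x := (q, τ))
        (continuousAt_chartField p (z := (q.1.1, γ q₁ τ)) (hT (hin q₁ q₁.2 τ hτ).2)).fst h1
      exact ((continuous_subtype_val.comp continuous_fst).snd.fst.continuousWithinAt).smul h2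
  have hAc : ContinuousOn (fun z : D × ℝ => z.1.1.2.1 • fderiv ℝ (chartField z.1.1.1 p) (γ z.1 z.2))
      (univ ×ˢ Icc 0 1) := by
    rintro ⟨q, τ⟩ hz
    have h1 : ContinuousWithinAt (fun z : D × ℝ => (z.1.1.1, γ z.1 z.2)) (univ ×ˢ Icc 0 1) (q, τ) :=
      (continuous_subtype_val.comp continuous_fst).fst.continuousWithinAt.prodMk (hγc _ hz)
    have h2 := ContinuousAt.comp_continuousWithinAt
      (g := fun z : C1VectorField M × R3 => fderiv ℝ (chartField z.1 p) z.2)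
      (f := fun z : D × ℝ => (z.1.1.1, γ z.1 z.2)) (x := (q, τ))
      (continuousAt_chartField p (z := (q.1.1, γ q τ)) (hT (hin q q.2 τ hz.2).2)).snd h1
    exact ((continuous_subtype_val.comp continuous_fst).snd.fst.continuousWithinAt).smul h2
  have hAn : ∀ q : D, ∀ τ ∈ Icc (0 : ℝ) 1,
      ‖q.1.2.1 • fderiv ℝ (chartField q.1.1 p) (γ q τ)‖ ≤ 1 / 2 :=
    fun q τ hτ => hsC q q.2 _ (hin q q.2 τ hτ).2
  have hWex : ∀ q : D, ∃ W : ℝ → R3 →L[ℝ] R3, W 0 = ContinuousLinearMap.id ℝ R3 ∧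
      ∀ τ ∈ Icc (0 : ℝ) 1, HasDerivWithinAt W
        ((q.1.2.1 • fderiv ℝ (chartField q.1.1 p) (γ q τ)) ∘L W τ) (Icc 0 1) τ := fun q =>
    exists_linear_solution (hAc.comp (f := fun τ => (q, τ)) (by fun_prop) fun τ hτ => ⟨mem_univ _, hτ⟩)
      (hAn q)
  choose w hw0 hw using hWex
  have hwc : ContinuousOn (fun z : D × ℝ => w z.1 z.2) (univ ×ˢ Icc 0 1) := by
    refine continuousOn_solution (v := fun (q : D) τ (W : R3 →L[ℝ] R3) =>
      (q.1.2.1 • fderiv ℝ (chartField q.1.1 p) (γ q τ)) ∘L W) (s := univ)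
      (fun q τ hτ => ?_) hw (fun q τ hτ => mem_univ _) ?_ (fun q₁ => ?_)
    · refine LipschitzWith.lipschitzOnWith (LipschitzWith.of_dist_le_mul fun W W' => ?_)
      rw [dist_eq_norm, dist_eq_norm, ← ContinuousLinearMap.comp_sub]
      refine (ContinuousLinearMap.opNorm_comp_le _ _).trans ?_
      refine mul_le_mul_of_nonneg_right ((hAn q τ hτ).trans (by norm_num)) (norm_nonneg _)
    · simp only [hw0]
      exact continuous_const
    · refine hAc.clm_comp ?_
      rintro ⟨q, τ⟩ ⟨-, hτ⟩
      exact ((hw q₁ τ hτ).continuousWithinAt).comp continuousWithinAt_snd fun z hz => hz.2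
  classical
  -- The value `0` outside `D` is a dummy; only the restriction to `D` is used.
  let W : C1VectorField M × ℝ × R3 → R3 →L[ℝ] R3 := fun q => if h : q ∈ D then w ⟨q, h⟩ 1 else 0
  have h1 : Continuous fun q : D => ((q, (1 : ℝ)) : D × ℝ) := by fun_prop
  have h1' : ∀ q : D, ((q, (1 : ℝ)) : D × ℝ) ∈ (univ : Set D) ×ˢ Icc (0 : ℝ) 1 := by simp
  refine ⟨U, hX, R / 2, half_pos hR, δ, hδ, fun q => γ q 1, W, ?_, ?_, ?_⟩
  · rw [continuousOn_iff_continuous_domRestrict]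
    exact hγc.comp_continuous h1 h1'
  · rw [continuousOn_iff_continuous_domRestrict]
    refine (hwc.comp_continuous h1 h1').congr fun q => ?_
    change w q 1 = W q.1
    simp only [W]
    rw [dif_pos q.2]
  · intro X hXU s hs y hy
    have hq : (X, s, y) ∈ D := ⟨hXU, hs, hy⟩
    have hW : W (X, s, y) = w ⟨_, hq⟩ 1 := dif_pos hq
    have hone : (1 : ℝ) ∈ Icc (0 : ℝ) 1 := by simp
    refine ⟨hT (hbT hy), hT (hin _ hq 1 hone).2, ?_, ?_, γ (X, s, y), w ⟨_, hq⟩, hγ0 _ hq, rfl,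
      hw0 _, hW.symm, fun τ hτ => ⟨hT (hin _ hq τ hτ).2, hγd _ hq τ hτ, hw ⟨_, hq⟩ τ hτ⟩⟩
    · have := (chartAt R3 p).left_inv (hin _ hq 1 hone).1
      simp only [mul_one] at this
      simp only [γ, mul_one]
      exact this.symm
    · rw [hW]
      refine hasFDerivAt_solution (isCompact_closedBall y₀ R) (convex_closedBall y₀ R)
        (fun y hy => hfd s X y hy) ?_ (fun y hy => (hsC _ hq y hy).trans (by norm_num))
        Metric.isOpen_ball (γ := fun y => γ (X, s, y)) (fun y' hy' => hγ0 (X, s, y') ⟨hXU, hs, hy'⟩)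
        (fun y' hy' τ hτ => (hin (X, s, y') ⟨hXU, hs, hy'⟩ τ hτ).2)
        (fun y' hy' τ hτ => hγd (X, s, y') ⟨hXU, hs, hy'⟩ τ hτ) hy (hw0 _) (hw ⟨_, hq⟩)
      intro y hy
      exact ((contDiffOn_chartField X p).continuousOn_fderiv_of_isOpen
        (chartAt R3 p).open_target le_rfl |>.mono hT |>.const_smul s) y hy

end Flow

/-! ### Invariance of the volume form -/

section Cartan

open ContinuousAlternatingMap

theorem alternatizeUncurryFin_two {E : Type*} [NormedAddCommGroup E] [NormedSpace ℝ E]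
    (D : E →L[ℝ] E [⋀^Fin 2]→L[ℝ] ℝ) (a b c : E) :
    alternatizeUncurryFin D ![a, b, c] = D a ![b, c] - D b ![a, c] + D c ![a, b] := by
  have h0 : (0 : Fin 3).removeNth ![a, b, c] = ![b, c] := by ext i; fin_cases i <;> rfl
  have h1 : (1 : Fin 3).removeNth ![a, b, c] = ![a, c] := by ext i; fin_cases i <;> rfl
  have h2 : (2 : Fin 3).removeNth ![a, b, c] = ![a, b] := by ext i; fin_cases i <;> rfl
  rw [alternatizeUncurryFin_apply, Fin.sum_univ_three, h0, h1, h2]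
  simp
  ring

theorem alternatizeUncurryFin_three {E : Type*} [NormedAddCommGroup E] [NormedSpace ℝ E]
    (D : E →L[ℝ] E [⋀^Fin 3]→L[ℝ] ℝ) (a b c d : E) :
    alternatizeUncurryFin D ![a, b, c, d] =
      D a ![b, c, d] - D b ![a, c, d] + D c ![a, b, d] - D d ![a, b, c] := by
  have h0 : (0 : Fin 4).removeNth ![a, b, c, d] = ![b, c, d] := by ext i; fin_cases i <;> rfl
  have h1 : (1 : Fin 4).removeNth ![a, b, c, d] = ![a, c, d] := by ext i; fin_cases i <;> rfl
  have h2 : (2 : Fin 4).removeNth ![a, b, c, d] = ![a, b, d] := by ext i; fin_cases i <;> rfl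
  have h3 : (3 : Fin 4).removeNth ![a, b, c, d] = ![a, b, c] := by ext i; fin_cases i <;> rfl
  rw [alternatizeUncurryFin_apply, Fin.sum_univ_four, h0, h1, h2, h3]
  simp
  ring

theorem form_swap01 {E : Type*} [AddCommGroup E] [Module ℝ E] [TopologicalSpace E]
    (m : E [⋀^Fin 3]→L[ℝ] ℝ) (a b c : E) : m ![b, a, c] = -m ![a, b, c] := by
  have := m.toAlternatingMap.map_swap ![a, b, c] (i := 0) (j := 1) (by decide)
  have h : ![a, b, c] ∘ Equiv.swap 0 1 = ![b, a, c] := by ext i; fin_cases i <;> rfl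
  rw [h] at this
  exact this

theorem form_swap12 {E : Type*} [AddCommGroup E] [Module ℝ E] [TopologicalSpace E]
    (m : E [⋀^Fin 3]→L[ℝ] ℝ) (a b c : E) : m ![a, c, b] = -m ![a, b, c] := by
  have := m.toAlternatingMap.map_swap ![a, b, c] (i := 1) (j := 2) (by decide)
  have h : ![a, b, c] ∘ Equiv.swap 1 2 = ![a, c, b] := by ext i; fin_cases i <;> rfl
  rw [h] at this
  exact this

theorem fderiv_curryLeft_apply {E : Type*} [NormedAddCommGroup E] [NormedSpace ℝ E] {n : ℕ}
    {m : E → E [⋀^Fin (n + 1)]→L[ℝ] ℝ} {f : E → E} {A : E →L[ℝ] E} {y : E}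
    (hm : DifferentiableAt ℝ m y) (hf : HasFDerivAt f A y) (u : E) (v : Fin n → E) :
    fderiv ℝ (fun z => (m z).curryLeft (f z)) y u v =
      m y (Matrix.vecCons (A u) v) + fderiv ℝ m y u (Matrix.vecCons (f y) v) := by
  let L : (E [⋀^Fin (n + 1)]→L[ℝ] ℝ) →L[ℝ] (E →L[ℝ] E [⋀^Fin n]→L[ℝ] ℝ) :=
    (curryLeftLI (𝕜 := ℝ) (E := E) (F := ℝ) (n := n)).toContinuousLinearMap
  have hL0 := ContinuousLinearMap.hasFDerivAt (E := E [⋀^Fin (n + 1)]→L[ℝ] ℝ)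
    (F := E →L[ℝ] E [⋀^Fin n]→L[ℝ] ℝ) L (x := m y)
  have hL : HasFDerivAt (fun z => (m z).curryLeft) (L ∘L fderiv ℝ m y) y := by
    have := HasFDerivAt.comp (F := E [⋀^Fin (n + 1)]→L[ℝ] ℝ) (G := E →L[ℝ] E [⋀^Fin n]→L[ℝ] ℝ) y
      hL0 hm.hasFDerivAt
    exact this
  rw [(hL.clm_apply hf).fderiv]
  rfl

/-- Cartan's formula: the Lie derivative of a 3-form `m` along `f` vanishes if `ι_f m` is closed. -/
theorem lieDerivative_eq_zero {m : R3 → R3 [⋀^Fin 3]→L[ℝ] ℝ} {f : R3 → R3} {A : R3 →L[ℝ] R3}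
    {y : R3} (hm : DifferentiableAt ℝ m y) (hf : HasFDerivAt f A y)
    (h : extDeriv (fun z => (m z).curryLeft (f z)) y = 0) (a b c : R3) :
    fderiv ℝ m y (f y) ![a, b, c] +
      (m y ![A a, b, c] + m y ![a, A b, c] + m y ![a, b, A c]) = 0 := by
  -- A 4-form on a three-dimensional space is zero, so `m` is closed and the Lie derivative reduces
  -- to `d (ι_f m)`. Expanding `dm (f, a, b, c)` and `d (ι_f m) (a, b, c)` and combining the two
  -- gives the claim.
  have h4 : extDeriv m y ![f y, a, b, c] = 0 := by
    refine (extDeriv m y).toAlternatingMap.map_linearDependent _ fun hli => ?_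
    have := hli.fintype_card_le_finrank
    simp at this
  have h3 : extDeriv (fun z => (m z).curryLeft (f z)) y ![a, b, c] = 0 := by rw [h]; rfl
  have e : ∀ u v w : R3, fderiv ℝ (fun z => (m z).curryLeft (f z)) y u ![v, w] =
      m y ![A u, v, w] + fderiv ℝ m y u ![f y, v, w] :=
    fun u v w => fderiv_curryLeft_apply (n := 2) hm hf u ![v, w]
  rw [extDeriv, alternatizeUncurryFin_three] at h4
  rw [extDeriv, alternatizeUncurryFin_two, e, e, e] at h3
  rw [form_swap01 (m y) a (A b) c, form_swap01 (m y) a (A c) b, form_swap12 (m y) a b (A c)] at h3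
  linarith

/-- A volume form is invariant under the linearization of the flow. -/
theorem form_invariant {m : R3 → R3 [⋀^Fin 3]→L[ℝ] ℝ} {f : R3 → R3} {O : Set R3}
    (hm : ∀ y ∈ O, DifferentiableAt ℝ m y) (hf : ∀ y ∈ O, DifferentiableAt ℝ f y)
    (h : ∀ y ∈ O, extDeriv (fun z => (m z).curryLeft (f z)) y = 0) {s : ℝ} {γ : ℝ → R3}
    {w : ℝ → R3 →L[ℝ] R3} (hw0 : w 0 = ContinuousLinearMap.id ℝ R3)
    (hγ : ∀ τ ∈ Icc (0 : ℝ) 1, γ τ ∈ O ∧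
            HasDerivWithinAt γ (s • f (γ τ)) (Icc 0 1) τ ∧
            HasDerivWithinAt w ((s • fderiv ℝ f (γ τ)) ∘L w τ) (Icc 0 1) τ) (a b c : R3) :
    m (γ 1) ![w 1 a, w 1 b, w 1 c] = m (γ 0) ![a, b, c] := by
  -- The derivative is `s` times the Lie derivative of `m` along `f`, evaluated on the transported
  -- vectors, and this vanishes by Cartan's formula.
  have key : ∀ τ ∈ Icc (0 : ℝ) 1, HasDerivWithinAt
      (fun τ => m (γ τ) ![w τ a, w τ b, w τ c]) 0 (Icc 0 1) τ := by
    intro τ hτ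
    obtain ⟨hO, h1, h2⟩ := hγ τ hτ
    have hmγ : HasFDerivWithinAt (fun τ => m (γ τ)) _ (Icc (0 : ℝ) 1) τ :=
      (hm _ hO).hasFDerivAt.comp_hasFDerivWithinAt τ h1.hasFDerivWithinAt
    have hwv : ∀ v : R3, HasDerivWithinAt (fun τ => w τ v) (s • fderiv ℝ f (γ τ) (w τ v))
        (Icc 0 1) τ := fun v => by
      simpa using! h2.clm_apply (hasDerivWithinAt_const τ (Icc 0 1) v)
    have := (hmγ.continuousAlternatingMap_apply (g := fun i τ => ![w τ a, w τ b, w τ c] i)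
      (g' := ![_, _, _]) (fun i => by
        fin_cases i
        · exact (hwv a).hasFDerivWithinAt
        · exact (hwv b).hasFDerivWithinAt
        · exact (hwv c).hasFDerivWithinAt)).hasDerivWithinAt
    refine this.congr_deriv ?_
    have hL := lieDerivative_eq_zero (hm _ hO) (hf _ hO).hasFDerivAt (h _ hO) (w τ a) (w τ b) (w τ c)
    simp only [_root_.add_apply, Fin.sum_univ_three, ContinuousLinearMap.comp_apply]
    have e0 : ∀ x, Function.update ![w τ a, w τ b, w τ c] 0 x = ![x, w τ b, w τ c] := fun x => by
      ext i; fin_cases i <;> rfl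
    have e1 : ∀ x, Function.update ![w τ a, w τ b, w τ c] 1 x = ![w τ a, x, w τ c] := fun x => by
      ext i; fin_cases i <;> rfl
    have e2 : ∀ x, Function.update ![w τ a, w τ b, w τ c] 2 x = ![w τ a, w τ b, x] := fun x => by
      ext i; fin_cases i <;> rfl
    have hs : ∀ (i : Fin 3) (x : R3), (m (γ τ)) (Function.update ![w τ a, w τ b, w τ c] i (s • x)) =
        s * (m (γ τ)) (Function.update ![w τ a, w τ b, w τ c] i x) := fun i x => by
      rw [(m (γ τ)).map_update_smul, smul_eq_mul]
    have : fderiv ℝ m (γ τ) (s • f (γ τ)) ![w τ a, w τ b, w τ c] +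
        (m (γ τ) ![s • fderiv ℝ f (γ τ) (w τ a), w τ b, w τ c] +
        m (γ τ) ![w τ a, s • fderiv ℝ f (γ τ) (w τ b), w τ c] +
        m (γ τ) ![w τ a, w τ b, s • fderiv ℝ f (γ τ) (w τ c)]) = 0 := by
      rw [← e0 (s • _), ← e1 (s • _), ← e2 (s • _), hs, hs, hs, e0, e1, e2, map_smul,
        ContinuousAlternatingMap.smul_apply, smul_eq_mul, ← mul_add, ← mul_add, ← mul_add, hL, mul_zero]
    rw [← e0 (s • _), ← e1 (s • _), ← e2 (s • _)] at this
    -- A derivative in one real variable is the Fréchet derivative applied to `1`, which accounts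
    -- for the factors removed by `one_smul`.
    refine Eq.trans ?_ this
    congr 1
    · exact congrArg (fun v => fderiv ℝ m (γ τ) v ![w τ a, w τ b, w τ c]) (one_smul ℝ (s • f (γ τ)))
    · refine congrArg₂ (· + ·) (congrArg₂ (· + ·) ?_ ?_) ?_
      · exact congrArg (fun v => m (γ τ) (Function.update ![w τ a, w τ b, w τ c] 0 v)) (one_smul ℝ _)
      · exact congrArg (fun v => m (γ τ) (Function.update ![w τ a, w τ b, w τ c] 1 v)) (one_smul ℝ _)
      · exact congrArg (fun v => m (γ τ) (Function.update ![w τ a, w τ b, w τ c] 2 v)) (one_smul ℝ _)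
  have hc := constant_of_derivWithin_zero (f := fun τ => m (γ τ) ![w τ a, w τ b, w τ c])
    (a := 0) (b := 1) (fun τ hτ => (key τ hτ).differentiableWithinAt)
    (fun τ hτ => (key τ (Ico_subset_Icc_self hτ)).derivWithin
      (uniqueDiffOn_Icc one_pos _ (Ico_subset_Icc_self hτ))) 1 (by simp)
  simpa [hw0] using hc

end Cartan

/-! ### The derivative of the flow -/

section FlowDeriv

variable {M : Type*} [TopologicalSpace M] [ChartedSpace R3 M] [IsManifold (𝓡 3) ∞ M]

theorem continuous_zeroSection :
    Continuous fun x : M => (⟨x, 0⟩ : TangentBundle (𝓡 3) M) := by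
  rw [continuous_iff_continuousAt]
  intro x
  refine (continuousAt_tangentBundle_iff (p := x) (mem_chart_source R3 x)).2
    ⟨continuousAt_id, ?_⟩
  have : ∀ z : M, coord x ⟨z, (0 : TangentSpace (𝓡 3) z)⟩ = 0 :=
    fun z => map_zero (mfderiv (𝓡 3) 𝓘(ℝ, R3) (chartAt R3 x) z)
  simp only [this]
  exact continuousAt_const

variable [T2Space M] [CompactSpace M]

theorem isOpen_chart_preimage_ball {N : Type*} [TopologicalSpace N] [ChartedSpace R3 N] (p : N)
    (r : ℝ) :
    IsOpen ((chartAt R3 p).source ∩ chartAt R3 p ⁻¹' Metric.ball (chartAt R3 p p) r) :=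
  (chartAt R3 p).isOpen_inter_preimage Metric.isOpen_ball

/-- In the chart at `p` the flow is `G` with derivative `W`, so its tangent map is `ofCoord` applied
to continuous functions of the coordinates, and `form_invariant` transfers along the chart. -/
theorem exists_local_tangentMap_flow (X₀ : C1VectorField M) (p : M) :
    ∃ U ∈ 𝓝 X₀, ∃ V ∈ 𝓝 p, ∃ δ > 0,
      (∀ X ∈ U, ∀ x ∈ V, ∀ s ∈ Ioo (-δ) δ, MDifferentiableAt (𝓡 3) (𝓡 3) (flow X s) x) ∧
      ContinuousOn (fun z : C1VectorField M × ℝ × TangentBundle (𝓡 3) M =>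
        tangentMap (𝓡 3) (𝓡 3) (flow z.1 z.2.1) z.2.2) (U ×ˢ Ioo (-δ) δ ×ˢ {v | v.1 ∈ V}) ∧
      ∀ X ∈ U, ∀ μ : VolumeForm M, IsVolumePreserving μ X → ∀ x ∈ V, ∀ s ∈ Ioo (-δ) δ,
        ∀ a b c : TangentSpace (𝓡 3) x, μ.toFun (flow X s x)
          ![mfderiv (𝓡 3) (𝓡 3) (flow X s) x a, mfderiv (𝓡 3) (𝓡 3) (flow X s) x b,
            mfderiv (𝓡 3) (𝓡 3) (flow X s) x c] = μ.toFun x ![a, b, c] := by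
  obtain ⟨U, hU, r, hr, δ, hδ, G, W, hG, hW, H⟩ := exists_local_flow X₀ p
  set V := (chartAt R3 p).source ∩ chartAt R3 p ⁻¹' Metric.ball (chartAt R3 p p) r
  have hVo : IsOpen V := isOpen_chart_preimage_ball p r
  have hder : ∀ X ∈ U, ∀ x ∈ V, ∀ s ∈ Ioo (-δ) δ,
      HasMFDerivAt (𝓡 3) (𝓡 3) (flow X s) x
        ((mfderiv 𝓘(ℝ, R3) (𝓡 3) (chartAt R3 p).symm (G (X, s, chartAt R3 p x))).comp
          ((W (X, s, chartAt R3 p x)).comp (mfderiv (𝓡 3) 𝓘(ℝ, R3) (chartAt R3 p) x))) := by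
    intro X hX x hx s hs
    obtain ⟨-, hGt, -, hd, -⟩ := H X hX s hs (chartAt R3 p x) hx.2
    have h1 : HasMFDerivAt (𝓡 3) 𝓘(ℝ, R3) (chartAt R3 p) x
        (mfderiv (𝓡 3) 𝓘(ℝ, R3) (chartAt R3 p) x) :=
      ((mdifferentiable_chart (I := 𝓡 3) p).mdifferentiableAt hx.1).hasMFDerivAt
    have h2 : HasMFDerivAt 𝓘(ℝ, R3) (𝓡 3) (chartAt R3 p).symm (G (X, s, chartAt R3 p x))
        (mfderiv 𝓘(ℝ, R3) (𝓡 3) (chartAt R3 p).symm (G (X, s, chartAt R3 p x))) :=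
      ((mdifferentiable_chart (I := 𝓡 3) p).mdifferentiableAt_symm hGt).hasMFDerivAt
    have h3 := HasMFDerivAt.comp x (f := chartAt R3 p) (g := fun y => G (X, s, y))
      (hd.hasMFDerivAt) h1
    have h4 := HasMFDerivAt.comp x (f := fun x => G (X, s, chartAt R3 p x))
      (g := (chartAt R3 p).symm) h2 h3
    refine h4.congr_of_eventuallyEq ?_
    filter_upwards [hVo.mem_nhds hx] with x' hx'
    have := (H X hX s hs (chartAt R3 p x') hx'.2).2.2.1
    rw [(chartAt R3 p).left_inv hx'.1] at this
    exact this
  have htan : ∀ X ∈ U, ∀ s ∈ Ioo (-δ) δ, ∀ v : TangentBundle (𝓡 3) M, v.1 ∈ V →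
      tangentMap (𝓡 3) (𝓡 3) (flow X s) v =
        ofCoord p (G (X, s, chartAt R3 p v.1), W (X, s, chartAt R3 p v.1) (coord p v)) := by
    intro X hX s hs v hv
    have h5 := (H X hX s hs (chartAt R3 p v.1) hv.2).2.2.1
    rw [(chartAt R3 p).left_inv hv.1] at h5
    refine Bundle.TotalSpace.ext h5 ?_
    have h6 := (hder X hX v.1 hv s hs).mfderiv
    exact heq_of_eq (DFunLike.congr_fun h6 v.2)
  refine ⟨U, hU, V, chart_preimage_ball_mem_nhds p hr, δ, hδ,
    fun X hX x hx s hs => (hder X hX x hx s hs).mdifferentiableAt, ?_, ?_⟩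
  · have hc : ContinuousOn (fun z : C1VectorField M × ℝ × TangentBundle (𝓡 3) M =>
        (z.1, z.2.1, chartAt R3 p z.2.2.1)) (U ×ˢ Ioo (-δ) δ ×ˢ {v | v.1 ∈ V}) := by
      refine continuousOn_fst.prodMk (continuousOn_snd.fst.prodMk ?_)
      exact (chartAt R3 p).continuousOn.comp
        (continuous_proj.comp continuous_snd.snd).continuousOn fun z hz => hz.2.2.1
    have hm : MapsTo (fun z : C1VectorField M × ℝ × TangentBundle (𝓡 3) M =>
        (z.1, z.2.1, chartAt R3 p z.2.2.1)) (U ×ˢ Ioo (-δ) δ ×ˢ {v | v.1 ∈ V})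
        (U ×ˢ Ioo (-δ) δ ×ˢ Metric.ball (chartAt R3 p p) r) :=
      fun z hz => ⟨hz.1, hz.2.1, hz.2.2.2⟩
    have hcoord : ContinuousOn (fun z : C1VectorField M × ℝ × TangentBundle (𝓡 3) M =>
        coord p z.2.2) (U ×ˢ Ioo (-δ) δ ×ˢ {v | v.1 ∈ V}) :=
      (continuousOn_coord p).comp continuous_snd.snd.continuousOn fun z hz => hz.2.2.1
    refine ((continuousOn_ofCoord p).comp ((hG.comp hc hm).prodMk
      ((hW.comp hc hm).clm_apply hcoord)) ?_).congr ?_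
    · intro z hz
      exact ⟨(H z.1 hz.1 z.2.1 hz.2.1 _ hz.2.2.2).2.1, mem_univ _⟩
    · intro z hz
      exact htan z.1 hz.1 z.2.1 hz.2.1 z.2.2 hz.2.2
  · intro X hX μ hμ x hx s hs a b c
    obtain ⟨-, hGt, hfl, -, γ, w, hγ0, hγ1, hw0, hw1, hγ⟩ := H X hX s hs (chartAt R3 p x) hx.2
    rw [(chartAt R3 p).left_inv hx.1] at hfl
    have hcoord : ∀ v : TangentSpace (𝓡 3) x,
        coord p ⟨flow X s x, mfderiv (𝓡 3) (𝓡 3) (flow X s) x v⟩ =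
          W (X, s, chartAt R3 p x) (coord p ⟨x, v⟩) := by
      intro v
      have h7 := htan X hX s hs ⟨x, v⟩ hx
      have h8 := congrArg (coord p) h7
      rw [coord_ofCoord hGt] at h8
      exact h8
    have hflm : flow X s x ∈ (chartAt R3 p).source := by
      rw [hfl]
      exact (chartAt R3 p).map_target hGt
    have hflc : chartAt R3 p (flow X s x) = G (X, s, chartAt R3 p x) := by
      rw [hfl, (chartAt R3 p).right_inv hGt]
    have hinv := form_invariant (m := chartForm μ.toFun p) (f := chartField X p)
      (O := (chartAt R3 p).target)
      (fun y hy => ((μ.smooth p).contDiffAt ((chartAt R3 p).open_target.mem_nhds hy)).differentiableAt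
        (by simp))
      (fun y hy => (hasFDerivAt_chartField X hy).differentiableAt) (hμ p) hw0 hγ
      (coord p ⟨x, a⟩) (coord p ⟨x, b⟩) (coord p ⟨x, c⟩)
    rw [apply_eq_chartForm μ.toFun hflm, apply_eq_chartForm μ.toFun hx.1]
    rw [hγ0, hγ1, hw1] at hinv
    refine Eq.trans ?_ (hinv.trans ?_)
    · rw [hflc, ← hcoord a, ← hcoord b, ← hcoord c]
      refine congrArg _ ?_
      ext i : 1
      fin_cases i <;> rfl
    · refine congrArg _ ?_
      ext i : 1
      fin_cases i <;> rfl

theorem exists_uniform_tangentMap_flow (X₀ : C1VectorField M) :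
    ∃ U ∈ 𝓝 X₀, ∃ δ > 0,
      (∀ X ∈ U, ∀ s ∈ Ioo (-δ) δ, MDifferentiable (𝓡 3) (𝓡 3) (flow X s)) ∧
      ContinuousOn (fun z : C1VectorField M × ℝ × TangentBundle (𝓡 3) M =>
        tangentMap (𝓡 3) (𝓡 3) (flow z.1 z.2.1) z.2.2) (U ×ˢ Ioo (-δ) δ ×ˢ univ) ∧
      ∀ X ∈ U, ∀ μ : VolumeForm M, IsVolumePreserving μ X → ∀ x, ∀ s ∈ Ioo (-δ) δ,
        ∀ a b c : TangentSpace (𝓡 3) x, μ.toFun (flow X s x)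
          ![mfderiv (𝓡 3) (𝓡 3) (flow X s) x a, mfderiv (𝓡 3) (𝓡 3) (flow X s) x b,
            mfderiv (𝓡 3) (𝓡 3) (flow X s) x c] = μ.toFun x ![a, b, c] := by
  choose U hU V hV δ hδ H1 H2 H3 using exists_local_tangentMap_flow X₀
  obtain ⟨T, -, hT⟩ := (isCompact_univ (X := M)).elim_nhds_subcover (fun p => interior (V p))
    fun p _ => interior_mem_nhds.2 (hV p)
  obtain ⟨ε, hε, hεδ⟩ : ∃ ε > 0, ∀ p ∈ T, ε ≤ δ p := by
    rcases T.eq_empty_or_nonempty with rfl | hne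
    · exact ⟨1, one_pos, by simp⟩
    · exact ⟨T.inf' hne δ, (Finset.lt_inf'_iff _).2 fun p _ => hδ p, fun p hp => Finset.inf'_le _ hp⟩
  have hsub : ∀ p ∈ T, Ioo (-ε) ε ⊆ Ioo (-δ p) (δ p) := fun p hp =>
    Ioo_subset_Ioo (neg_le_neg (hεδ p hp)) (hεδ p hp)
  have hcov : ∀ x : M, ∃ p ∈ T, x ∈ interior (V p) := fun x => by
    obtain ⟨p, hp, hx⟩ := mem_iUnion₂.1 (hT (mem_univ x))
    exact ⟨p, hp, hx⟩
  refine ⟨⋂ p ∈ T, U p, (Filter.biInter_finset_mem T).2 fun p _ => hU p, ε, hε, ?_, ?_, ?_⟩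
  · intro X hX s hs x
    obtain ⟨p, hp, hx⟩ := hcov x
    exact H1 p X (mem_iInter₂.1 hX p hp) x (interior_subset hx) s (hsub p hp hs)
  · rintro ⟨X, s, v⟩ ⟨hX, hs, -⟩
    obtain ⟨p, hp, hx⟩ := hcov v.1
    have h := H2 p (X, s, v) ⟨mem_iInter₂.1 hX p hp, hsub p hp hs,
      (interior_subset hx : v.1 ∈ V p)⟩
    refine h.mono_of_mem_nhdsWithin ?_
    rw [nhdsWithin_prod_eq, nhdsWithin_prod_eq, nhdsWithin_univ]
    refine prod_mem_prod (mem_of_superset self_mem_nhdsWithin fun Y hY => mem_iInter₂.1 hY p hp)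
      (prod_mem_prod (mem_of_superset self_mem_nhdsWithin (hsub p hp)) ?_)
    exact mem_of_superset ((isOpen_interior.preimage continuous_proj).mem_nhds hx)
      fun w hw => interior_subset (s := V p) hw
  · intro X hX μ hμ x s hs
    obtain ⟨p, hp, hx⟩ := hcov x
    exact H3 p X (mem_iInter₂.1 hX p hp) μ hμ x (interior_subset hx) s (hsub p hp hs)

theorem flow_eq_comp (X : C1VectorField M) (t : ℝ) : flow X t = flow X (t / 2) ∘ flow X (t / 2) := by
  funext x
  rw [Function.comp_apply, ← flow_add, add_halves]

/-- Since `φ_t = φ_{t/2} ∘ φ_{t/2}`, each statement for times below `2 ^ n * δ` gives it for twice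
that range by the chain rule. The neighbourhood `U` does not shrink, because the doubling uses the
same field. -/
theorem exists_tangentMap_flow (X₀ : C1VectorField M) :
    ∃ U ∈ 𝓝 X₀, ∃ δ > 0, ∀ n : ℕ,
      (∀ X ∈ U, ∀ s ∈ Ioo (-(2 ^ n * δ)) (2 ^ n * δ), MDifferentiable (𝓡 3) (𝓡 3) (flow X s)) ∧
      ContinuousOn (fun z : C1VectorField M × ℝ × TangentBundle (𝓡 3) M =>
        tangentMap (𝓡 3) (𝓡 3) (flow z.1 z.2.1) z.2.2)
        (U ×ˢ Ioo (-(2 ^ n * δ)) (2 ^ n * δ) ×ˢ univ) ∧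
      ∀ X ∈ U, ∀ μ : VolumeForm M, IsVolumePreserving μ X → ∀ x,
        ∀ s ∈ Ioo (-(2 ^ n * δ)) (2 ^ n * δ),
        ∀ a b c : TangentSpace (𝓡 3) x, μ.toFun (flow X s x)
          ![mfderiv (𝓡 3) (𝓡 3) (flow X s) x a, mfderiv (𝓡 3) (𝓡 3) (flow X s) x b,
            mfderiv (𝓡 3) (𝓡 3) (flow X s) x c] = μ.toFun x ![a, b, c] := by
  obtain ⟨U, hU, δ, hδ, H1, H2, H3⟩ := exists_uniform_tangentMap_flow X₀
  refine ⟨U, hU, δ, hδ, fun n => ?_⟩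
  induction n with
  | zero =>
    simp only [pow_zero, one_mul]
    exact ⟨H1, H2, H3⟩
  | succ n ih =>
    obtain ⟨h1, h2, h3⟩ := ih
    have hhalf : ∀ s ∈ Ioo (-(2 ^ (n + 1) * δ)) (2 ^ (n + 1) * δ),
        s / 2 ∈ Ioo (-(2 ^ n * δ)) (2 ^ n * δ) := by
      intro s hs
      rw [pow_succ] at hs
      constructor <;> linarith [hs.1, hs.2]
    have hcomp : ∀ X ∈ U, ∀ s ∈ Ioo (-(2 ^ (n + 1) * δ)) (2 ^ (n + 1) * δ),
        tangentMap (𝓡 3) (𝓡 3) (flow X s) =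
          tangentMap (𝓡 3) (𝓡 3) (flow X (s / 2)) ∘ tangentMap (𝓡 3) (𝓡 3) (flow X (s / 2)) := by
      intro X hX s hs
      have hd := h1 X hX (s / 2) (hhalf s hs)
      rw [← tangentMap_comp hd hd, ← flow_eq_comp]
    refine ⟨fun X hX s hs => ?_, ?_, ?_⟩
    · have hd := h1 X hX (s / 2) (hhalf s hs)
      rw [flow_eq_comp]
      exact hd.comp hd
    · have hc : ContinuousOn (fun z : C1VectorField M × ℝ × TangentBundle (𝓡 3) M =>
          tangentMap (𝓡 3) (𝓡 3) (flow z.1 (z.2.1 / 2)) z.2.2)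
          (U ×ˢ Ioo (-(2 ^ (n + 1) * δ)) (2 ^ (n + 1) * δ) ×ˢ univ) := by
        refine h2.comp (f := fun z : C1VectorField M × ℝ × TangentBundle (𝓡 3) M =>
          (z.1, z.2.1 / 2, z.2.2)) (by fun_prop) fun z hz => ⟨hz.1, hhalf _ hz.2.1, mem_univ _⟩
      refine (h2.comp (f := fun z : C1VectorField M × ℝ × TangentBundle (𝓡 3) M =>
        (z.1, z.2.1 / 2, tangentMap (𝓡 3) (𝓡 3) (flow z.1 (z.2.1 / 2)) z.2.2))
        (continuousOn_fst.prodMk ((by fun_prop : Continuous _).continuousOn.prodMk hc))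
        fun z hz => ⟨hz.1, hhalf _ hz.2.1, mem_univ _⟩).congr fun z hz => ?_
      exact congrFun (hcomp z.1 hz.1 z.2.1 hz.2.1) z.2.2
    · intro X hX μ hμ x s hs a b c
      have hd := h1 X hX (s / 2) (hhalf s hs)
      have hv : ∀ v : TangentSpace (𝓡 3) x, mfderiv (𝓡 3) (𝓡 3) (flow X s) x v =
          mfderiv (𝓡 3) (𝓡 3) (flow X (s / 2)) (flow X (s / 2) x)
            (mfderiv (𝓡 3) (𝓡 3) (flow X (s / 2)) x v) := by
        intro v
        have := mfderiv_comp x (hd (flow X (s / 2) x)) (hd x)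
        rw [← flow_eq_comp] at this
        exact DFunLike.congr_fun this v
      have e1 := h3 X hX μ hμ x (s / 2) (hhalf s hs) a b c
      have e2 := h3 X hX μ hμ (flow X (s / 2) x) (s / 2) (hhalf s hs)
        (mfderiv (𝓡 3) (𝓡 3) (flow X (s / 2)) x a) (mfderiv (𝓡 3) (𝓡 3) (flow X (s / 2)) x b)
        (mfderiv (𝓡 3) (𝓡 3) (flow X (s / 2)) x c)
      rw [← e1, ← e2, hv, hv, hv]
      have e3 : flow X s x = flow X (s / 2) (flow X (s / 2) x) := congrFun (flow_eq_comp X s) x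
      have key : ∀ (y z : M) (_ : y = z) (u v w : R3),
        (μ.toFun y : (Fin 3 → R3) → ℝ) ![u, v, w] = (μ.toFun z : (Fin 3 → R3) → ℝ) ![u, v, w] := by
        rintro y _ rfl u v w; rfl
      exact key _ _ e3 _ _ _

theorem exists_mem_Ioo_two_pow {δ : ℝ} (hδ : 0 < δ) (t : ℝ) :
    ∃ n : ℕ, t ∈ Ioo (-(2 ^ n * δ)) (2 ^ n * δ) := by
  obtain ⟨n, hn⟩ := pow_unbounded_of_one_lt (|t| / δ) (one_lt_two (α := ℝ))
  exact ⟨n, abs_lt.1 ((div_lt_iff₀ hδ).1 hn)⟩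

theorem mdifferentiable_flow (X : C1VectorField M) (t : ℝ) :
    MDifferentiable (𝓡 3) (𝓡 3) (flow X t) := by
  obtain ⟨U, hU, δ, hδ, H⟩ := exists_tangentMap_flow X
  obtain ⟨n, hn⟩ := exists_mem_Ioo_two_pow hδ t
  exact (H n).1 X (mem_of_mem_nhds hU) t hn

theorem continuous_tangentMap_flow :
    Continuous fun z : C1VectorField M × ℝ × TangentBundle (𝓡 3) M =>
      tangentMap (𝓡 3) (𝓡 3) (flow z.1 z.2.1) z.2.2 := by
  rw [continuous_iff_continuousAt]
  rintro ⟨X, t, v⟩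
  obtain ⟨U, hU, δ, hδ, H⟩ := exists_tangentMap_flow X
  obtain ⟨n, hn⟩ := exists_mem_Ioo_two_pow hδ t
  exact (H n).2.1.continuousAt (prod_mem_nhds hU (prod_mem_nhds (isOpen_Ioo.mem_nhds hn) univ_mem))

theorem form_mfderiv_flow {μ : VolumeForm M} {X : C1VectorField M} (hX : IsVolumePreserving μ X)
    (t : ℝ) (x : M) (a b c : TangentSpace (𝓡 3) x) :
    μ.toFun (flow X t x) ![mfderiv (𝓡 3) (𝓡 3) (flow X t) x a,
      mfderiv (𝓡 3) (𝓡 3) (flow X t) x b, mfderiv (𝓡 3) (𝓡 3) (flow X t) x c] =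
        μ.toFun x ![a, b, c] := by
  obtain ⟨U, hU, δ, hδ, H⟩ := exists_tangentMap_flow X
  obtain ⟨n, hn⟩ := exists_mem_Ioo_two_pow hδ t
  exact (H n).2.2 X (mem_of_mem_nhds hU) μ hX x t hn a b c

theorem continuous_flow :
    Continuous fun z : C1VectorField M × ℝ × M => flow z.1 z.2.1 z.2.2 :=
  continuous_proj.comp (continuous_tangentMap_flow.comp
    (continuous_fst.prodMk (continuous_snd.fst.prodMk
      (continuous_zeroSection.comp continuous_snd.snd))))

/-- Differentiate `φ_t ∘ φ_s = φ_{s + t}` in `s` at `0`, in two ways. -/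
theorem mfderiv_flow_apply_field (X : C1VectorField M) (t : ℝ) (x : M) :
    mfderiv (𝓡 3) (𝓡 3) (flow X t) x (X x) = X (flow X t x) := by
  have h0 := isMIntegralCurve_flow X x 0
  have h1 : HasMFDerivAt (𝓡 3) (𝓡 3) (flow X t) (flow X 0 x)
      (mfderiv (𝓡 3) (𝓡 3) (flow X t) (flow X 0 x)) :=
    (mdifferentiable_flow X t (flow X 0 x)).hasMFDerivAt
  have h2 := HasMFDerivAt.comp (0 : ℝ) (f := fun s => flow X s x) h1 h0
  have h3 := ((isMIntegralCurve_flow X x).comp_add t) 0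
  have h4 : (flow X t ∘ fun s => flow X s x) = (fun s => flow X s x) ∘ (· + t) := by
    funext s
    simp only [Function.comp_apply]
    rw [← flow_add, add_comm]
  rw [h4] at h2
  have h5 := DFunLike.congr_fun (hasMFDerivAt_unique h2 h3) (1 : ℝ)
  have h6 : (mfderiv (𝓡 3) (𝓡 3) (flow X t) (flow X 0 x) : R3 → R3) ((1 : ℝ) • (X (flow X 0 x) : R3)) =
    (1 : ℝ) • (X (flow X (0 + t) x) : R3) := h5
  rw [one_smul, one_smul, flow_zero, zero_add] at h6
  exact h6

end FlowDeriv

/-! ### The measure of a volume form -/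

section FormMeasure

/-- Top-degree alternating forms are multiples of the determinant. This identity is what matches the
form with the Jacobian in the change of variables. -/
theorem chartForm_comp_linear (f : R3 [⋀^Fin 3]→L[ℝ] ℝ) (L : R3 →L[ℝ] R3) :
    f (fun i => L (EuclideanSpace.single i 1)) = L.det * f fun i => EuclideanSpace.single i 1 := by
  set b := (EuclideanSpace.basisFun (Fin 3) ℝ).toBasis
  have hb : (fun i : Fin 3 => (EuclideanSpace.single i 1 : R3)) = b := by
    funext i
    simp [b]
  have h := DFunLike.congr_fun (AlternatingMap.eq_smul_basis_det b f.toAlternatingMap)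
    (L ∘ b)
  have h2 := b.det_comp (L : R3 →ₗ[ℝ] R3) b
  rw [b.det_self, mul_one] at h2
  rw [AlternatingMap.smul_apply] at h
  erw [h2] at h
  rw [hb, mul_comm]
  have e : (fun i => L (EuclideanSpace.single i 1)) = L ∘ b := by
    rw [← hb]; rfl
  rw [e]
  exact h

variable {M : Type*} [TopologicalSpace M] [ChartedSpace R3 M] [MeasurableSpace M] [BorelSpace M]

theorem measurableSet_chart_source (p : M) : MeasurableSet (chartAt R3 p).source :=
  (chartAt R3 p).open_source.measurableSet

theorem aemeasurable_chart_symm (p : M) :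
    AEMeasurable (chartAt R3 p).symm (volume.restrict (chartAt R3 p).target) :=
  (chartAt R3 p).continuousOn_symm.aemeasurable (chartAt R3 p).open_target.measurableSet

theorem measurableSet_chart_image {p : M} {A : Set M} (hA : MeasurableSet A)
    (hAp : A ⊆ (chartAt R3 p).source) : MeasurableSet (chartAt R3 p '' A) := by
  classical
  rw [(chartAt R3 p).image_eq_target_inter_inv_preimage hAp]
  have h : Measurable ((chartAt R3 p).target.piecewise (chartAt R3 p).symm fun _ => p) :=
    (chartAt R3 p).continuousOn_symm.measurable_piecewise continuousOn_const
      (chartAt R3 p).open_target.measurableSet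
  convert (chartAt R3 p).open_target.measurableSet.inter (h hA) using 1
  ext y
  refine and_congr_right fun hy => ?_
  rw [mem_preimage, mem_preimage, piecewise_eq_of_mem _ _ _ hy]

theorem chartMeasure_apply (μ : VolumeForm M) {p : M} {A : Set M} (hA : MeasurableSet A)
    (hAp : A ⊆ (chartAt R3 p).source) :
    μ.chartMeasure p A = ∫⁻ y in chartAt R3 p '' A,
      ENNReal.ofReal |chartForm μ.toFun p y fun i => EuclideanSpace.single i 1| := by
  set w : R3 → ℝ≥0∞ := fun y =>
    ENNReal.ofReal |chartForm μ.toFun p y fun i => EuclideanSpace.single i 1|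
  have hs := (aemeasurable_chart_symm p).mono_ac (withDensity_absolutelyContinuous _ w)
  rw [VolumeForm.chartMeasure, Measure.map_apply_of_aemeasurable hs hA]
  rw [withDensity_apply' , Measure.restrict_restrict' (chartAt R3 p).open_target.measurableSet,
    (chartAt R3 p).image_eq_target_inter_inv_preimage hAp, inter_comm]

theorem chartMeasure_compl_source (μ : VolumeForm M) (p : M) :
    μ.chartMeasure p (chartAt R3 p).sourceᶜ = 0 := by
  set w : R3 → ℝ≥0∞ := fun y =>
    ENNReal.ofReal |chartForm μ.toFun p y fun i => EuclideanSpace.single i 1|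
  have hs := (aemeasurable_chart_symm p).mono_ac (withDensity_absolutelyContinuous _ w)
  rw [VolumeForm.chartMeasure,
    Measure.map_apply_of_aemeasurable hs (measurableSet_chart_source p).compl]
  refine withDensity_absolutelyContinuous _ w ?_
  rw [Measure.restrict_apply' (chartAt R3 p).open_target.measurableSet]
  convert measure_empty (μ := (volume : Measure R3))
  rw [eq_empty_iff_forall_notMem]
  exact fun y hy => hy.1 ((chartAt R3 p).map_target hy.2)

variable [IsManifold (𝓡 3) ∞ M]

/-- Change of variables for the measures of a volume form in two charts. -/
theorem chartMeasure_image (μ : VolumeForm M) {Ψ : M → M} (hd : MDifferentiable (𝓡 3) (𝓡 3) Ψ)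
    (hi : Function.Injective Ψ)
    (hf : ∀ x (v : Fin 3 → TangentSpace (𝓡 3) x),
      μ.toFun (Ψ x) (fun i => mfderiv (𝓡 3) (𝓡 3) Ψ x (v i)) = μ.toFun x v)
    {p q : M} {A : Set M} (hA : MeasurableSet A) (hΨA : MeasurableSet (Ψ '' A))
    (hAp : A ⊆ (chartAt R3 p).source) (hAq : Ψ '' A ⊆ (chartAt R3 q).source) :
    μ.chartMeasure q (Ψ '' A) = μ.chartMeasure p A := by
  set g : R3 → R3 := fun y => chartAt R3 q (Ψ ((chartAt R3 p).symm y))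
  set L : R3 → R3 →L[ℝ] R3 := fun y =>
    (mfderiv (𝓡 3) 𝓘(ℝ, R3) (chartAt R3 q) (Ψ ((chartAt R3 p).symm y))).comp
      ((mfderiv (𝓡 3) (𝓡 3) Ψ ((chartAt R3 p).symm y)).comp
        (mfderiv 𝓘(ℝ, R3) (𝓡 3) (chartAt R3 p).symm y))
  have hy : ∀ y ∈ chartAt R3 p '' A, y ∈ (chartAt R3 p).target ∧
      (chartAt R3 p).symm y ∈ A := by
    rintro _ ⟨x, hx, rfl⟩
    refine ⟨(chartAt R3 p).map_source (hAp hx), ?_⟩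
    rwa [(chartAt R3 p).left_inv (hAp hx)]
  have hg : ∀ y ∈ chartAt R3 p '' A, HasFDerivAt g (L y) y := by
    intro y hyA
    obtain ⟨h1, h2⟩ := hy y hyA
    have a1 : HasMFDerivAt 𝓘(ℝ, R3) (𝓡 3) (chartAt R3 p).symm y
        (mfderiv 𝓘(ℝ, R3) (𝓡 3) (chartAt R3 p).symm y) :=
      ((mdifferentiable_chart (I := 𝓡 3) p).mdifferentiableAt_symm h1).hasMFDerivAt
    have a2 := (hd ((chartAt R3 p).symm y)).hasMFDerivAt
    have a3 : HasMFDerivAt (𝓡 3) 𝓘(ℝ, R3) (chartAt R3 q) (Ψ ((chartAt R3 p).symm y))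
        (mfderiv (𝓡 3) 𝓘(ℝ, R3) (chartAt R3 q) (Ψ ((chartAt R3 p).symm y))) :=
      ((mdifferentiable_chart (I := 𝓡 3) q).mdifferentiableAt
        (hAq (mem_image_of_mem Ψ h2))).hasMFDerivAt
    exact hasMFDerivAt_iff_hasFDerivAt.1 (a3.comp y (a2.comp y a1))
  have himg : chartAt R3 q '' (Ψ '' A) = g '' (chartAt R3 p '' A) := by
    rw [image_image, image_image]
    refine image_congr fun x hx => ?_
    change _ = chartAt R3 q (Ψ ((chartAt R3 p).symm (chartAt R3 p x)))
    rw [(chartAt R3 p).left_inv (hAp hx)]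
  have hinj : InjOn g (chartAt R3 p '' A) := by
    intro y h1 z h2 h
    obtain ⟨hy1, hy2⟩ := hy y h1
    obtain ⟨hz1, hz2⟩ := hy z h2
    exact (chartAt R3 p).symm.injOn hy1 hz1 (hi ((chartAt R3 q).injOn
      (hAq (mem_image_of_mem Ψ hy2)) (hAq (mem_image_of_mem Ψ hz2)) h))
  have hAm := measurableSet_chart_image hA hAp
  rw [chartMeasure_apply μ hΨA hAq, chartMeasure_apply μ hA hAp, himg,
    lintegral_image_eq_lintegral_abs_det_fderiv_mul volume hAm
      (fun y hyA => (hg y hyA).hasFDerivWithinAt) hinj]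
  refine setLIntegral_congr_fun hAm fun y hyA => ?_
  obtain ⟨-, h2⟩ := hy y hyA
  have key := apply_eq_chartForm μ.toFun (hAq (mem_image_of_mem Ψ h2)) fun i =>
    (mfderiv (𝓡 3) (𝓡 3) Ψ ((chartAt R3 p).symm y) : R3 → R3)
      ((mfderiv 𝓘(ℝ, R3) (𝓡 3) (chartAt R3 p).symm y : R3 → R3) (EuclideanSpace.single i 1))
  have key2 := hf ((chartAt R3 p).symm y) fun i =>
    (mfderiv 𝓘(ℝ, R3) (𝓡 3) (chartAt R3 p).symm y : R3 → R3) (EuclideanSpace.single i 1)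
  have key3 := chartForm_comp_linear (chartForm μ.toFun q (g y)) (L y)
  -- Since `Ψ` preserves the form, the densities in the two charts differ exactly by the determinant
  -- of the coordinate expression of `Ψ`, so the Jacobian factor is absorbed.
  have key4 : chartForm μ.toFun p y (fun i => EuclideanSpace.single i 1) =
      (L y).det * chartForm μ.toFun q (g y) fun i => EuclideanSpace.single i 1 :=
    (key2.symm.trans key).trans key3
  change ENNReal.ofReal |(L y).det| * ENNReal.ofReal |_| = ENNReal.ofReal |_|
  rw [key4, abs_mul, ENNReal.ofReal_mul (abs_nonneg _)]

theorem chartMeasure_eq (μ : VolumeForm M) {p q : M} {A : Set M} (hA : MeasurableSet A)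
    (hAp : A ⊆ (chartAt R3 p).source) (hAq : A ⊆ (chartAt R3 q).source) :
    μ.chartMeasure q A = μ.chartMeasure p A := by
  have h := chartMeasure_image μ (Ψ := id) mdifferentiable_id Function.injective_id
    (fun x v => by simp only [mfderiv_id]; rfl) (p := p) (q := q) hA
    (by rwa [image_id]) hAp (by rwa [image_id])
  rwa [image_id] at h

/-- The supremum is bounded above by an explicit measure: `μ.chartMeasure p`, plus the largest
measure `⊤` off the chart at `p`. This dominates every chart measure because any two of them agree
on overlaps, and its second part does not see `A`. -/
theorem measure_apply_of_subset_source (μ : VolumeForm M) {p : M} {A : Set M}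
    (hA : MeasurableSet A) (hAp : A ⊆ (chartAt R3 p).source) :
    μ.measure A = μ.chartMeasure p A := by
  refine le_antisymm ?_ (le_iSup μ.chartMeasure p A)
  have hle : μ.measure ≤ μ.chartMeasure p +
      (⊤ : Measure M).restrict (chartAt R3 p).sourceᶜ := by
    refine iSup_le fun q => Measure.le_iff.2 fun B hB => ?_
    rw [Measure.add_apply, Measure.restrict_apply hB]
    have hp := measurableSet_chart_source p
    have hq := measurableSet_chart_source q
    rw [← measure_inter_add_sdiff B hp]
    refine add_le_add ?_ ?_
    · rw [← measure_inter_add_sdiff (B ∩ _) hq,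
        chartMeasure_eq μ ((hB.inter hp).inter hq) (fun x hx => hx.1.2) fun x hx => hx.2,
        measure_mono_null (fun x hx => hx.2) (chartMeasure_compl_source μ q), add_zero]
      exact measure_mono fun x hx => hx.1.1
    · exact le_top (a := μ.chartMeasure q) _
  calc μ.measure A ≤ _ := hle A
    _ = μ.chartMeasure p A := by
      rw [Measure.add_apply, Measure.restrict_apply hA, (disjoint_compl_right_iff_subset.2 hAp).inter_eq,
        measure_empty, add_zero]

variable [CompactSpace M]

theorem isFiniteMeasure_measure (μ : VolumeForm M) : IsFiniteMeasure μ.measure := by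
  refine ⟨isCompact_univ.measure_lt_top_of_nhdsWithin fun p _ => ?_⟩
  rw [nhdsWithin_univ]
  obtain ⟨r, hr, hsub⟩ := Metric.nhds_basis_closedBall.mem_iff.1
    ((chartAt R3 p).open_target.mem_nhds (mem_chart_target R3 p))
  have hc : ContinuousOn (fun y => |chartForm μ.toFun p y fun i => EuclideanSpace.single i 1|)
      (Metric.closedBall (chartAt R3 p p) r) := by
    refine ContinuousOn.abs fun y hy => ?_
    have h := ((μ.smooth p).continuousOn y (hsub hy)).mono hsub
    exact ((ContinuousAlternatingMap.apply ℝ R3 ℝ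
      fun i : Fin 3 => (EuclideanSpace.single i 1 : R3)).continuous.continuousAt).comp_continuousWithinAt h
  obtain ⟨C, hC⟩ := (isCompact_closedBall _ _).bddAbove_image hc
  refine ⟨_, chart_preimage_ball_mem_nhds p hr, ?_⟩
  set A := (chartAt R3 p).source ∩ chartAt R3 p ⁻¹' Metric.ball (chartAt R3 p p) r
  have hA : MeasurableSet A := (isOpen_chart_preimage_ball p r).measurableSet
  rw [measure_apply_of_subset_source μ hA inter_subset_left,
    chartMeasure_apply μ hA inter_subset_left]
  have himg : chartAt R3 p '' A ⊆ Metric.ball (chartAt R3 p p) r := by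
    rintro _ ⟨x, hx, rfl⟩
    exact hx.2
  have hAm := measurableSet_chart_image hA (p := p) inter_subset_left
  calc _ ≤ ∫⁻ y in chartAt R3 p '' A, ENNReal.ofReal C :=
        setLIntegral_mono' hAm fun y hy => ENNReal.ofReal_le_ofReal
          (hC (mem_image_of_mem _ (Metric.ball_subset_closedBall (himg hy))))
    _ < ⊤ := by
      rw [setLIntegral_const]
      exact ENNReal.mul_lt_top ENNReal.ofReal_lt_top
        ((measure_mono himg).trans_lt measure_ball_lt_top)

/-- A diffeomorphism that preserves a volume form preserves its measure. -/
theorem measurePreserving_of_form (μ : VolumeForm M) (Ψ : M ≃ₜ M)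
    (hd : MDifferentiable (𝓡 3) (𝓡 3) Ψ)
    (hf : ∀ x (v : Fin 3 → TangentSpace (𝓡 3) x),
      μ.toFun (Ψ x) (fun i => mfderiv (𝓡 3) (𝓡 3) Ψ x (v i)) = μ.toFun x v) :
    MeasurePreserving Ψ μ.measure μ.measure := by
  have hm : Measurable Ψ := Ψ.continuous.measurable
  refine ⟨hm, ?_⟩
  obtain ⟨t, -, ht⟩ := isCompact_univ.elim_nhds_subcover (fun p : M => (chartAt R3 p).source)
    fun p _ => chart_source_mem_nhds R3 p
  have hcov : ∀ x : M, ∃ p ∈ t, x ∈ (chartAt R3 p).source := fun x => by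
    simpa using ht (mem_univ x)
  -- It suffices to compare the measures on finitely many sets, each of which lies in one chart
  -- domain and has its preimage under `Ψ` in another.
  refine Measure.ext_of_iUnion_eq_univ (ι := t × t)
    (s := fun i => Ψ.symm ⁻¹' (chartAt R3 i.1.1).source ∩ (chartAt R3 i.2.1).source) ?_ ?_
  · refine eq_univ_of_forall fun y => mem_iUnion.2 ?_
    obtain ⟨p, hp, hxp⟩ := hcov (Ψ.symm y)
    obtain ⟨q, hq, hxq⟩ := hcov y
    exact ⟨(⟨p, hp⟩, ⟨q, hq⟩), hxp, hxq⟩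
  · rintro ⟨⟨p, -⟩, ⟨q, -⟩⟩
    refine Measure.ext fun B hB => ?_
    set S := Ψ.symm ⁻¹' (chartAt R3 p).source ∩ (chartAt R3 q).source
    have hS : IsOpen S :=
      ((chartAt R3 p).open_source.preimage Ψ.symm.continuous).inter (chartAt R3 q).open_source
    have hBS := hB.inter hS.measurableSet
    have himg : Ψ '' (Ψ ⁻¹' (B ∩ S)) = B ∩ S := Ψ.surjective.image_preimage _
    have hp : Ψ ⁻¹' (B ∩ S) ⊆ (chartAt R3 p).source := by
      intro x hx
      have := hx.2.1
      rwa [mem_preimage, Ψ.symm_apply_apply] at this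
    rw [Measure.restrict_apply hB, Measure.restrict_apply hB, Measure.map_apply hm hBS,
      measure_apply_of_subset_source μ (hm hBS) hp,
      measure_apply_of_subset_source μ hBS (p := q) fun x hx => hx.2.2]
    have h := chartMeasure_image μ hd Ψ.injective hf (p := p) (q := q) (hm hBS)
      (himg.symm ▸ hBS) hp (himg.symm ▸ fun x hx => hx.2.2)
    rw [← h, himg]

/-- The time `t` map of a vector field, as a homeomorphism. -/
def flowHomeomorph [T2Space M] (X : C1VectorField M) (t : ℝ) : M ≃ₜ M where
  toFun := flow X t
  invFun := flow X (-t)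
  left_inv x := by rw [← flow_add, neg_add_cancel, flow_zero]
  right_inv x := by rw [← flow_add, add_neg_cancel, flow_zero]
  continuous_toFun := (mdifferentiable_flow X t).continuous
  continuous_invFun := (mdifferentiable_flow X (-t)).continuous

theorem measurePreserving_flow [T2Space M] (μ : VolumeForm M) {X : C1VectorField M}
    (hX : IsVolumePreserving μ X) (t : ℝ) :
    MeasurePreserving (flow X t) μ.measure μ.measure := by
  refine measurePreserving_of_form μ (flowHomeomorph X t) (mdifferentiable_flow X t)
    fun x v => ?_
  have h := form_mfderiv_flow hX t x (v 0) (v 1) (v 2)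
  have e1 : (fun i => mfderiv (𝓡 3) (𝓡 3) (flow X t) x (v i)) =
      ![mfderiv (𝓡 3) (𝓡 3) (flow X t) x (v 0), mfderiv (𝓡 3) (𝓡 3) (flow X t) x (v 1),
        mfderiv (𝓡 3) (𝓡 3) (flow X t) x (v 2)] := by
    funext i; fin_cases i <;> rfl
  have e2 : v = ![v 0, v 1, v 2] := by
    funext i; fin_cases i <;> rfl
  exact (congrArg (μ.toFun (flow X t x)) e1).trans (h.trans (congrArg (μ.toFun x) e2.symm))

end FormMeasure

/-! ### The universal cover of `SL(2, ℝ)` -/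

section Cover

open Real

theorem unitVec_add_int (θ : ℝ) (n : ℤ) : unitVec (θ + n) = unitVec θ := by
  have h : 2 * π * (θ + n) = 2 * π * θ + n * (2 * π) := by ring
  rw [unitVec, unitVec, h, cos_add_int_mul_two_pi, sin_add_int_mul_two_pi]

theorem eq_add_int_of_unitVec_eq {a b : ℝ} (h : unitVec a = unitVec b) : ∃ n : ℤ, a = b + n := by
  have h0 : cos (2 * π * a) = cos (2 * π * b) := congrFun h 0
  have h1 : sin (2 * π * a) = sin (2 * π * b) := congrFun h 1
  obtain ⟨k, hk⟩ := Real.Angle.angle_eq_iff_two_pi_dvd_sub.1 (Real.Angle.cos_sin_inj h0 h1)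
  refine ⟨k, ?_⟩
  have hp := pi_pos
  have : 2 * π * (a - b - k) = 0 := by linear_combination hk
  have := (mul_eq_zero.1 this).resolve_left (by positivity)
  linarith

theorem unitVec_sq (θ : ℝ) : unitVec θ 0 ^ 2 + unitVec θ 1 ^ 2 = 1 :=
  cos_sq_add_sin_sq _

theorem eq_of_smul_unitVec_eq {r s a b : ℝ} (hr : 0 < r) (hs : 0 < s)
    (h : r • unitVec a = s • unitVec b) : unitVec a = unitVec b := by
  have h0 : r * unitVec a 0 = s * unitVec b 0 := congrFun h 0
  have h1 : r * unitVec a 1 = s * unitVec b 1 := congrFun h 1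
  have h2 : r ^ 2 = s ^ 2 := by
    linear_combination (r * unitVec a 0 + s * unitVec b 0) * h0 +
      (r * unitVec a 1 + s * unitVec b 1) * h1 - r ^ 2 * unitVec_sq a + s ^ 2 * unitVec_sq b
  have h3 : r = s := (sq_eq_sq₀ hr.le hs.le).1 h2
  rw [h3] at h
  exact smul_right_injective _ hs.ne' h

theorem mulVec_unitVec_apply (A : Matrix (Fin 2) (Fin 2) ℝ) (θ : ℝ) (i : Fin 2) :
    A.mulVec (unitVec θ) i = A i 0 * cos (2 * π * θ) + A i 1 * sin (2 * π * θ) := by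
  simp [Matrix.mulVec, dotProduct, Fin.sum_univ_two, unitVec]

theorem mulVec_injective_of_SL (A : Matrix.SpecialLinearGroup (Fin 2) ℝ) :
    Function.Injective A.1.mulVec :=
  Matrix.mulVec_injective_iff_isUnit.2 ((Matrix.isUnit_iff_isUnit_det _).2
    (by rw [A.2]; exact isUnit_one))

/-- The squared length of the image of a unit vector. -/
def stretch (A : Matrix.SpecialLinearGroup (Fin 2) ℝ) (θ : ℝ) : ℝ :=
  (A.1.mulVec (unitVec θ) 0) ^ 2 + (A.1.mulVec (unitVec θ) 1) ^ 2

theorem stretch_pos (A : Matrix.SpecialLinearGroup (Fin 2) ℝ) (θ : ℝ) : 0 < stretch A θ := by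
  refine (by unfold stretch; positivity : 0 ≤ stretch A θ).lt_of_ne fun h => ?_
  have h0 : A.1.mulVec (unitVec θ) 0 = 0 := by unfold stretch at h; nlinarith
  have h1 : A.1.mulVec (unitVec θ) 1 = 0 := by unfold stretch at h; nlinarith
  have h2 : A.1.mulVec (unitVec θ) = A.1.mulVec 0 := by
    rw [Matrix.mulVec_zero]
    funext i
    fin_cases i
    exacts [h0, h1]
  have h3 := mulVec_injective_of_SL A h2
  have h4 := unitVec_sq θ
  rw [h3] at h4
  norm_num at h4

theorem continuous_unitVec : Continuous unitVec := by
  refine continuous_pi fun i => ?_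
  fin_cases i
  exacts [by simp only [unitVec]; exact continuous_cos.comp (continuous_const.mul continuous_id),
    by simp only [unitVec]; exact continuous_sin.comp (continuous_const.mul continuous_id)]

theorem continuous_mulVec_unitVec :
    Continuous fun z : Matrix.SpecialLinearGroup (Fin 2) ℝ × ℝ => z.1.1.mulVec (unitVec z.2) :=
  (continuous_subtype_val.comp continuous_fst).matrix_mulVec
    (continuous_unitVec.comp continuous_snd)

theorem continuous_stretch :
    Continuous fun z : Matrix.SpecialLinearGroup (Fin 2) ℝ × ℝ => stretch z.1 z.2 := by
  have h := continuous_mulVec_unitVec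
  exact (((continuous_apply 0).comp h).pow 2).add (((continuous_apply 1).comp h).pow 2)

/-- The lift of the action of `A` on directions that takes the value `y` at `0`. -/
def angleLift (A : Matrix.SpecialLinearGroup (Fin 2) ℝ) (y θ : ℝ) : ℝ :=
  y + ∫ s in (0 : ℝ)..θ, (stretch A s)⁻¹

theorem continuous_inv_stretch (A : Matrix.SpecialLinearGroup (Fin 2) ℝ) :
    Continuous fun s => (stretch A s)⁻¹ :=
  (continuous_stretch.comp (Continuous.prodMk_right A)).inv₀ fun s => (stretch_pos A s).ne'

theorem hasDerivAt_angleLift (A : Matrix.SpecialLinearGroup (Fin 2) ℝ) (y θ : ℝ) :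
    HasDerivAt (angleLift A y) (stretch A θ)⁻¹ θ :=
  ((continuous_inv_stretch A).integral_hasStrictDerivAt 0 θ).hasDerivAt.const_add y

theorem strictMono_angleLift (A : Matrix.SpecialLinearGroup (Fin 2) ℝ) (y : ℝ) :
    StrictMono (angleLift A y) :=
  strictMono_of_hasDerivAt_pos (hasDerivAt_angleLift A y) fun θ => inv_pos.2 (stretch_pos A θ)

/-- Because `det A = 1`, the angle of `A u(θ)`, in full turns, has derivative `1 / |A u(θ)|²`, which
is the integrand of `angleLift`. So the cosine `W` of the angle between `A u(θ)` and `unitVec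
(angleLift A y θ)` has derivative zero. It is 1 at `0`, hence everywhere, and the two directions
agree. -/
theorem mulVec_eq_smul_angleLift {A : Matrix.SpecialLinearGroup (Fin 2) ℝ} {y : ℝ}
    (hy : ∃ r : ℝ, 0 < r ∧ A.1.mulVec (unitVec 0) = r • unitVec y) (θ : ℝ) :
    A.1.mulVec (unitVec θ) = √(stretch A θ) • unitVec (angleLift A y θ) := by
  have hdet : A.1 0 0 * A.1 1 1 - A.1 0 1 * A.1 1 0 = 1 := by
    rw [← Matrix.det_fin_two]; exact A.2
  have hv : ∀ i t, HasDerivAt (fun t => A.1.mulVec (unitVec t) i)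
      (2 * π * (A.1 i 1 * cos (2 * π * t) - A.1 i 0 * sin (2 * π * t))) t := by
    intro i t
    simp only [mulVec_unitVec_apply]
    have hl : HasDerivAt (fun t : ℝ => 2 * π * t) (2 * π) t := by
      simpa using (hasDerivAt_id t).const_mul (2 * π)
    refine ((hl.cos.const_mul (A.1 i 0)).add (hl.sin.const_mul (A.1 i 1))).congr_deriv ?_
    ring
  set F := angleLift A y
  have hc : ∀ t, HasDerivAt (fun t => cos (2 * π * F t))
      (-sin (2 * π * F t) * (2 * π * (stretch A t)⁻¹)) t := fun t =>
    ((hasDerivAt_angleLift A y t).const_mul (2 * π)).cos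
  have hs : ∀ t, HasDerivAt (fun t => sin (2 * π * F t))
      (cos (2 * π * F t) * (2 * π * (stretch A t)⁻¹)) t := fun t =>
    ((hasDerivAt_angleLift A y t).const_mul (2 * π)).sin
  set W : ℝ → ℝ := fun t => (A.1.mulVec (unitVec t) 0 * cos (2 * π * F t) +
    A.1.mulVec (unitVec t) 1 * sin (2 * π * F t)) / √(stretch A t)
  have hW : ∀ t, HasDerivAt W 0 t := by
    intro t
    have hst := stretch_pos A t
    have hS : HasDerivAt (stretch A) _ t := ((hv 0 t).pow 2).add ((hv 1 t).pow 2)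
    have h := (((hv 0 t).mul (hc t)).add ((hv 1 t).mul (hs t))).div (hS.sqrt hst.ne')
      (sqrt_ne_zero'.2 hst)
    refine h.congr_deriv ?_
    have hsq := sq_sqrt hst.le
    set q := √(stretch A t)
    have hq : q ≠ 0 := sqrt_ne_zero'.2 hst
    have hqs : stretch A t = q ^ 2 := hsq.symm
    have e0 : A.1.mulVec (unitVec t) 0 ^ 2 + A.1.mulVec (unitVec t) 1 ^ 2 = q ^ 2 := hsq.symm
    have e1 : A.1.mulVec (unitVec t) 0 * (A.1 1 1 * cos (2 * π * t) - A.1 1 0 * sin (2 * π * t)) -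
        A.1.mulVec (unitVec t) 1 * (A.1 0 1 * cos (2 * π * t) - A.1 0 0 * sin (2 * π * t)) = 1 := by
      rw [mulVec_unitVec_apply, mulVec_unitVec_apply]
      linear_combination hdet * (cos (2 * π * t) ^ 2 + sin (2 * π * t) ^ 2) +
        cos_sq_add_sin_sq (2 * π * t)
    simp only [hqs]
    set v0 := A.1.mulVec (unitVec t) 0
    set v1 := A.1.mulVec (unitVec t) 1
    set d0 := A.1 0 1 * cos (2 * π * t) - A.1 0 0 * sin (2 * π * t)
    set d1 := A.1 1 1 * cos (2 * π * t) - A.1 1 0 * sin (2 * π * t)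
    set c := cos (2 * π * F t)
    set s := sin (2 * π * F t)
    rw [div_eq_zero_iff]
    left
    field_simp
    change π * (2 * (d0 * c * q ^ 2 + -(v0 * s) + (s * q ^ 2 * d1 + c * v1)) -
      (v0 * c + v1 * s) * ((2 : ℕ) : ℝ) * (d0 * v0 ^ (2 - 1) + d1 * v1 ^ (2 - 1))) = q * 0
    norm_num only
    linear_combination -2 * π * (d0 * c + s * d1) * e0 - 2 * π * (c * v1 - v0 * s) * e1
  have hconst : W θ = W 0 := is_const_of_deriv_eq_zero (fun t => (hW t).differentiableAt)
    (fun t => (hW t).deriv) θ 0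
  have hW0 : W 0 = 1 := by
    obtain ⟨r, hr, h⟩ := hy
    have hF : F 0 = y := by simp [F, angleLift]
    have h0 : A.1.mulVec (unitVec 0) 0 = r * cos (2 * π * y) := congrFun h 0
    have h1 : A.1.mulVec (unitVec 0) 1 = r * sin (2 * π * y) := congrFun h 1
    have hst : stretch A 0 = r ^ 2 := by
      rw [stretch, h0, h1]
      linear_combination r ^ 2 * cos_sq_add_sin_sq (2 * π * y)
    simp only [W, h0, h1, hF, hst, sqrt_sq hr.le]
    field_simp
    linear_combination cos_sq_add_sin_sq (2 * π * y)
  have hst := stretch_pos A θ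
  have hQ := hconst.trans hW0
  rw [div_eq_one_iff_eq (sqrt_ne_zero'.2 hst)] at hQ
  have hsq := sq_sqrt hst.le
  have e0 : A.1.mulVec (unitVec θ) 0 ^ 2 + A.1.mulVec (unitVec θ) 1 ^ 2 = √(stretch A θ) ^ 2 :=
    hsq.symm
  have hcs := cos_sq_add_sin_sq (2 * π * F θ)
  set q := √(stretch A θ)
  set v0 := A.1.mulVec (unitVec θ) 0 with hv0
  set v1 := A.1.mulVec (unitVec θ) 1 with hv1
  set c := cos (2 * π * F θ) with hcd
  set s := sin (2 * π * F θ) with hsd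
  -- The squared length of `v` is the sum of the squares of its scalar product and its cross product
  -- with the unit vector `(c, s)`. The scalar product is already the full length.
  have hP : (v0 * s - v1 * c) ^ 2 = 0 := by
    linear_combination (v0 ^ 2 + v1 ^ 2) * hcs - (v0 * c + v1 * s + q) * hQ + e0
  have hP' : v0 * s - v1 * c = 0 := pow_eq_zero_iff two_ne_zero |>.1 hP
  funext i
  fin_cases i
  · change v0 = q * c
    linear_combination c * hQ + s * hP' - v0 * hcs
  · change v1 = q * s
    linear_combination s * hQ - c * hP' - v1 * hcs

theorem eq_add_int_of_mulVec {A : Matrix.SpecialLinearGroup (Fin 2) ℝ} {f : ℝ → ℝ} {θ θ' : ℝ}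
    (hf : ∀ θ : ℝ, ∃ r : ℝ, 0 < r ∧ A.1.mulVec (unitVec θ) = r • unitVec (f θ))
    (h : unitVec (f θ) = unitVec (f θ')) : ∃ n : ℤ, θ = θ' + n := by
  obtain ⟨r, hr, h1⟩ := hf θ
  obtain ⟨s, hs, h2⟩ := hf θ'
  refine eq_add_int_of_unitVec_eq (eq_of_smul_unitVec_eq hs hr (mulVec_injective_of_SL A ?_))
  rw [Matrix.mulVec_smul, Matrix.mulVec_smul, h1, h2, h, smul_smul, smul_smul, mul_comm]

theorem unitVec_eq_of_mulVec {A : Matrix.SpecialLinearGroup (Fin 2) ℝ} {f g : ℝ → ℝ} {θ θ' : ℝ}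
    (hf : ∀ θ : ℝ, ∃ r : ℝ, 0 < r ∧ A.1.mulVec (unitVec θ) = r • unitVec (f θ))
    (hg : ∀ θ : ℝ, ∃ r : ℝ, 0 < r ∧ A.1.mulVec (unitVec θ) = r • unitVec (g θ))
    (h : unitVec θ = unitVec θ') : unitVec (f θ) = unitVec (g θ') := by
  obtain ⟨r, hr, h1⟩ := hf θ
  obtain ⟨s, hs, h2⟩ := hg θ'
  exact eq_of_smul_unitVec_eq hr hs (h1.symm.trans (h ▸ h2))

/-- The increment over one turn is a positive integer `n`. If `n ≥ 2`, the intermediate value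
theorem gives a point strictly between `θ` and `θ + 1` with the same image direction as `θ`,
contrary to injectivity of the action on directions. -/
theorem angleLift_add_one {A : Matrix.SpecialLinearGroup (Fin 2) ℝ} {y : ℝ}
    (hy : ∃ r : ℝ, 0 < r ∧ A.1.mulVec (unitVec 0) = r • unitVec y) (θ : ℝ) :
    angleLift A y (θ + 1) = angleLift A y θ + 1 := by
  have hf : ∀ θ : ℝ, ∃ r : ℝ, 0 < r ∧ A.1.mulVec (unitVec θ) = r • unitVec (angleLift A y θ) :=
    fun θ => ⟨_, sqrt_pos.2 (stretch_pos A θ), mulVec_eq_smul_angleLift hy θ⟩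
  have hm := strictMono_angleLift A y
  have hu : ∀ t, unitVec (t + 1) = unitVec t := fun t => by exact_mod_cast unitVec_add_int t 1
  obtain ⟨n, hn⟩ := eq_add_int_of_unitVec_eq (unitVec_eq_of_mulVec hf hf (hu θ))
  have h1 : angleLift A y θ < angleLift A y (θ + 1) := hm (by linarith)
  have hn0 : (0 : ℝ) < n := by linarith
  have hn1 : (1 : ℤ) ≤ n := by exact_mod_cast hn0
  rcases hn1.eq_or_lt with h | h
  · rw [hn, ← h, Int.cast_one]
  · exfalso
    have h2 : (1 : ℝ) < n := by exact_mod_cast h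
    have hcont : ContinuousOn (angleLift A y) (Icc θ (θ + 1)) := fun t _ =>
      (hasDerivAt_angleLift A y t).continuousAt.continuousWithinAt
    obtain ⟨t, ht, hte⟩ := intermediate_value_Icc (by linarith : θ ≤ θ + 1) hcont
      (show angleLift A y θ + 1 ∈ _ from ⟨by linarith, by linarith⟩)
    obtain ⟨k, hk⟩ := eq_add_int_of_mulVec hf (θ := t) (θ' := θ) (by rw [hte, hu])
    have ht0 : θ < t := hm.lt_iff_lt.1 (by linarith)
    have ht1 : t < θ + 1 := hm.lt_iff_lt.1 (by linarith)
    have k0 : (0 : ℝ) < k := by linarith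
    have k1 : (k : ℝ) < 1 := by linarith
    have k0' : 0 < k := by exact_mod_cast k0
    have k1' : k < 1 := by exact_mod_cast k1
    omega

/-- The element of the universal cover with given matrix and given angle of the first column. -/
def coverOf (A : Matrix.SpecialLinearGroup (Fin 2) ℝ) (y : ℝ)
    (hy : ∃ r : ℝ, 0 < r ∧ A.1.mulVec (unitVec 0) = r • unitVec y) : SL2Cover :=
  ⟨(A, ⟨⟨angleLift A y, (strictMono_angleLift A y).monotone⟩, angleLift_add_one hy⟩),
    fun θ => ⟨_, sqrt_pos.2 (stretch_pos A θ), mulVec_eq_smul_angleLift hy θ⟩⟩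

/-- Two lifts of the same action that agree at `0` differ by an integer at each `t` in `[0, 1)`.
Monotonicity and degree one restrict it to `0` or `1`, and strict monotonicity of `angleLift`
excludes `1`. Lifts in `SL2Cover` are not assumed continuous; this formula shows that they are. -/
theorem angle_eq_angleLift (g : SL2Cover) (θ : ℝ) : g.1.2 θ = angleLift g.1.1 (g.1.2 0) θ := by
  set A := g.1.1
  have hg : ∀ θ : ℝ, ∃ r : ℝ, 0 < r ∧ A.1.mulVec (unitVec θ) = r • unitVec (g.1.2 θ) := g.2
  set h := coverOf A (g.1.2 0) (hg 0)
  have hh : ∀ θ : ℝ, ∃ r : ℝ, 0 < r ∧ A.1.mulVec (unitVec θ) = r • unitVec (h.1.2 θ) := h.2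
  have hh0 : h.1.2 0 = g.1.2 0 := by simp [h, coverOf, angleLift]
  have hmono : StrictMono h.1.2 := strictMono_angleLift A (g.1.2 0)
  change g.1.2 θ = h.1.2 θ
  suffices H : ∀ t ∈ Ico (0 : ℝ) 1, g.1.2 t = h.1.2 t by
    have e := H (Int.fract θ) ⟨Int.fract_nonneg θ, Int.fract_lt_one θ⟩
    have e1 := g.1.2.map_fract_sub_fract_eq θ
    have e2 := h.1.2.map_fract_sub_fract_eq θ
    linarith
  intro t ht
  obtain ⟨n, hn⟩ := eq_add_int_of_unitVec_eq (unitVec_eq_of_mulVec hg hh (rfl : unitVec t = _))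
  have hg1 : g.1.2 1 = g.1.2 0 + 1 := by simpa using g.1.2.map_add_one 0
  have hh1 : h.1.2 1 = h.1.2 0 + 1 := by simpa using h.1.2.map_add_one 0
  have a1 := g.1.2.monotone ht.1
  have a2 := g.1.2.monotone ht.2.le
  have a3 := hmono.monotone ht.1
  have a4 := hmono ht.2
  have n1 : (-1 : ℝ) < n := by linarith
  have n2 : (n : ℝ) ≤ 1 := by linarith
  have n1' : -1 < n := by exact_mod_cast n1
  have n2' : n ≤ 1 := by exact_mod_cast n2
  rcases n2'.eq_or_lt with h' | h'
  · exfalso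
    rw [h', Int.cast_one] at hn
    have : h.1.2 t = h.1.2 0 := by linarith
    have ht0 := hmono.injective this
    rw [ht0] at hn
    linarith
  · have : n = 0 := by omega
    rw [hn, this, Int.cast_zero, add_zero]

theorem SL2Cover_ext {g h : SL2Cover} (h1 : g.1.1 = h.1.1) (h2 : g.1.2 0 = h.1.2 0) : g = h := by
  refine Subtype.ext (Prod.ext h1 (CircleDeg1Lift.ext fun θ => ?_))
  rw [angle_eq_angleLift g, angle_eq_angleLift h, h1, h2]

/-- The map to the matrix and the angle of its first column. -/
theorem continuous_cover_iff {Y : Type*} [TopologicalSpace Y] {f : Y → SL2Cover} :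
    Continuous f ↔ Continuous (fun y => (f y).1.1) ∧ Continuous fun y => (f y).1.2 0 := by
  rw [continuous_induced_rng, continuous_prodMk.symm]
  rfl

theorem continuous_cover_fst : Continuous fun g : SL2Cover => g.1.1 :=
  (continuous_cover_iff.1 continuous_id).1

theorem continuous_angle_zero : Continuous fun g : SL2Cover => g.1.2 0 :=
  (continuous_cover_iff.1 continuous_id).2

/-- Products require the angle at points other than `0`, since `(g * h) 0 = g (h 0)`; the topology
only controls the angle at `0`, and the integral formula supplies the rest. -/
theorem continuous_angle : Continuous fun z : SL2Cover × ℝ => z.1.1.2 z.2 := by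
  have h : Continuous fun z : Matrix.SpecialLinearGroup (Fin 2) ℝ × ℝ =>
      ∫ s in (0 : ℝ)..z.2, (stretch z.1 s)⁻¹ :=
    intervalIntegral.continuous_parametric_primitive_of_continuous
      (f := fun A s => (stretch A s)⁻¹)
      (continuous_stretch.inv₀ fun z => (stretch_pos z.1 z.2).ne')
  have e : (fun z : SL2Cover × ℝ => z.1.1.2 z.2) = fun z =>
      z.1.1.2 0 + ∫ s in (0 : ℝ)..z.2, (stretch z.1.1.1 s)⁻¹ :=
    funext fun z => angle_eq_angleLift z.1 z.2
  rw [e]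
  exact (continuous_angle_zero.comp continuous_fst).add
    (h.comp ((continuous_cover_fst.comp continuous_fst).prodMk continuous_snd))

instance : ContinuousMul SL2Cover where
  continuous_mul := by
    refine continuous_cover_iff.2 ⟨?_, ?_⟩
    · exact (continuous_cover_fst.comp continuous_fst).mul (continuous_cover_fst.comp continuous_snd)
    · exact continuous_angle.comp (continuous_fst.prodMk (continuous_angle_zero.comp continuous_snd))

/-- The `n`-th iterate of a lift displaces `0` by `n` times the translation number up to an error of
1. Dividing by `n` gives convergence that is uniform on the whole group. -/
theorem continuous_rotationNumber : Continuous rotationNumber := by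
  have h : TendstoUniformly (fun (n : ℕ) (g : SL2Cover) => (g ^ (n + 1)).1.2 0 / (n + 1 : ℝ))
      rotationNumber atTop := by
    rw [Metric.tendstoUniformly_iff]
    intro ε hε
    have h1 := tendsto_one_div_add_atTop_nhds_zero_nat (𝕜 := ℝ)
    filter_upwards [h1.eventually (gt_mem_nhds hε)] with n hn g
    have hp : (0 : ℝ) < n + 1 := by positivity
    have h2 := g.1.2.dist_pow_map_zero_mul_translationNumber_le (n + 1)
    refine lt_of_le_of_lt ?_ hn
    rw [Real.dist_eq] at h2 ⊢
    have e : rotationNumber g - (g ^ (n + 1)).1.2 0 / (n + 1 : ℝ) =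
        -(((g.1.2 ^ (n + 1)) 0 - ((n + 1 : ℕ) : ℝ) * g.1.2.translationNumber) / (n + 1)) := by
      have : (g ^ (n + 1)).1.2 = g.1.2 ^ (n + 1) := rfl
      rw [this, rotationNumber]
      push_cast
      field_simp
      ring
    rw [e, abs_neg, abs_div, abs_of_pos hp]
    gcongr
  refine h.continuous (Eventually.of_forall fun n => ?_).frequently
  exact (continuous_angle_zero.comp (continuous_pow (n + 1))).div_const _

theorem abs_rotationNumber_sub_angle_le (g : SL2Cover) : |rotationNumber g - g.1.2 0| ≤ 1 := by
  rw [abs_sub_comm]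
  exact g.1.2.dist_map_zero_translationNumber_le

/-- The angle at `0` is thus itself a quasimorphism, and a continuous one. It stands in for all
rotation quasimorphisms, and its defect 1 is the constant `D` of the ergodic argument. -/
theorem abs_angle_mul_sub_le (g h : SL2Cover) :
    |(g * h).1.2 0 - g.1.2 0 - h.1.2 0| ≤ 1 := by
  have := g.1.2.dist_map_map_zero_lt h.1.2
  rw [dist_comm, Real.dist_eq] at this
  rw [sub_sub]
  exact this.le

theorem isRotationQuasimorphism_rotationNumber : IsRotationQuasimorphism rotationNumber where
  continuous := continuous_rotationNumber
  quasimorphism := by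
    -- Three comparisons with the angle, each costing 1, plus the defect 1 of the angle.
    refine ⟨4, fun g h => ?_⟩
    have h1 := abs_le.1 (abs_rotationNumber_sub_angle_le g)
    have h2 := abs_le.1 (abs_rotationNumber_sub_angle_le h)
    have h3 := abs_le.1 (abs_rotationNumber_sub_angle_le (g * h))
    have h4 := abs_le.1 (abs_angle_mul_sub_le g h)
    rw [abs_le]
    constructor <;> linarith
  equivalent := ⟨0, fun g => by simp⟩

theorem IsRotationQuasimorphism.exists_abs_sub_angle_le {ρ : SL2Cover → ℝ}
    (hρ : IsRotationQuasimorphism ρ) : ∃ C, ∀ g : SL2Cover, |ρ g - g.1.2 0| ≤ C := by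
  obtain ⟨C, hC⟩ := hρ.equivalent
  exact ⟨C + 1, fun g => (abs_sub_le _ (rotationNumber g) _).trans
    (add_le_add (hC g) (abs_rotationNumber_sub_angle_le g))⟩

theorem circle_exp_angle_eq {g h : SL2Cover} (e : g.1.1 = h.1.1) :
    Circle.exp (2 * π * g.1.2 0) = Circle.exp (2 * π * h.1.2 0) := by
  have hg : ∀ θ : ℝ, ∃ r : ℝ, 0 < r ∧ g.1.1.1.mulVec (unitVec θ) = r • unitVec (g.1.2 θ) := g.2
  have hh : ∀ θ : ℝ, ∃ r : ℝ, 0 < r ∧ h.1.1.1.mulVec (unitVec θ) = r • unitVec (h.1.2 θ) := h.2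
  rw [← e] at hh
  obtain ⟨n, hn⟩ := eq_add_int_of_unitVec_eq (unitVec_eq_of_mulVec hg hh (rfl : unitVec 0 = _))
  exact Circle.exp_eq_exp.2 ⟨n, by rw [hn]; ring⟩

/-- Uniqueness of lifts. -/
theorem cover_eq_of_fst_eq {Y : Type*} [TopologicalSpace Y] [PreconnectedSpace Y]
    {f g : Y → SL2Cover} (hf : Continuous f) (hg : Continuous g) (h : ∀ y, (f y).1.1 = (g y).1.1)
    {y₀ : Y} (h0 : f y₀ = g y₀) : f = g := by
  -- Over the same matrix the angles differ by integers, so after multiplication by `2 * π` both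
  -- angle functions lift one map to the circle.
  have key := Circle.isCoveringMap_exp.eq_of_comp_eq
    (g₁ := fun y => 2 * π * (f y).1.2 0) (g₂ := fun y => 2 * π * (g y).1.2 0)
    (continuous_const.mul (continuous_angle_zero.comp hf))
    (continuous_const.mul (continuous_angle_zero.comp hg))
    (funext fun y => circle_exp_angle_eq (h y)) y₀ (by simp only [h0])
  funext y
  have := congrFun key y
  exact SL2Cover_ext (h y) (mul_left_cancel₀ (by positivity : 2 * π ≠ 0) this)

/-- The complex number with real part and imaginary part the entries of the first column. -/
def firstColumn (A : Matrix.SpecialLinearGroup (Fin 2) ℝ) : ℂ := ⟨A.1 0 0, A.1 1 0⟩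

theorem firstColumn_ne_zero (A : Matrix.SpecialLinearGroup (Fin 2) ℝ) : firstColumn A ≠ 0 := by
  intro h
  have h0 : A.1 0 0 = 0 := congrArg Complex.re h
  have h1 : A.1 1 0 = 0 := congrArg Complex.im h
  have := A.2
  rw [Matrix.det_fin_two, h0, h1] at this
  norm_num at this

theorem continuous_firstColumn : Continuous firstColumn := by
  have h : ∀ i j, Continuous fun A : Matrix.SpecialLinearGroup (Fin 2) ℝ => A.1 i j := fun i j =>
    (continuous_apply_apply i j).comp continuous_subtype_val
  have e : firstColumn = fun A => (A.1 0 0 : ℂ) + A.1 1 0 * Complex.I := by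
    funext A
    exact (Complex.mk_eq_add_mul_I _ _)
  rw [e]
  exact (Complex.continuous_ofReal.comp (h 0 0)).add
    ((Complex.continuous_ofReal.comp (h 1 0)).mul continuous_const)

/-- The direction of the first column. -/
def firstDirection (A : Matrix.SpecialLinearGroup (Fin 2) ℝ) : Circle :=
  ⟨firstColumn A / ‖firstColumn A‖, by
    change _ ∈ Metric.sphere (0 : ℂ) 1
    rw [mem_sphere_zero_iff_norm, norm_div, Complex.norm_real, norm_norm,
      div_self (norm_ne_zero_iff.2 (firstColumn_ne_zero A))]⟩

theorem continuous_firstDirection : Continuous firstDirection := by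
  refine Continuous.subtype_mk (continuous_firstColumn.div
    (Complex.continuous_ofReal.comp continuous_firstColumn.norm) fun A => ?_) _
  exact Complex.ofReal_ne_zero.2 (norm_ne_zero_iff.2 (firstColumn_ne_zero A))

theorem exists_smul_of_circle_exp {A : Matrix.SpecialLinearGroup (Fin 2) ℝ} {y : ℝ}
    (h : Circle.exp y = firstDirection A) :
    ∃ r : ℝ, 0 < r ∧ A.1.mulVec (unitVec 0) = r • unitVec (y / (2 * π)) := by
  have hn : 0 < ‖firstColumn A‖ := norm_pos_iff.2 (firstColumn_ne_zero A)
  have h1 : Complex.exp (y * Complex.I) = firstColumn A / ‖firstColumn A‖ := by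
    rw [← Circle.coe_exp, h]; rfl
  have h2 : firstColumn A = ‖firstColumn A‖ * Complex.exp (y * Complex.I) := by
    rw [h1, mul_div_cancel₀]
    exact_mod_cast hn.ne'
  refine ⟨_, hn, ?_⟩
  have e : 2 * π * (y / (2 * π)) = y := mul_div_cancel₀ _ (by positivity)
  have hre := congrArg Complex.re h2
  have him := congrArg Complex.im h2
  rw [Complex.re_ofReal_mul, Complex.exp_ofReal_mul_I_re] at hre
  rw [Complex.im_ofReal_mul, Complex.exp_ofReal_mul_I_im] at him
  funext i
  fin_cases i
  · have : A.1 0 0 = ‖firstColumn A‖ * cos y := hre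
    simpa [unitVec, e] using this
  · have : A.1 1 0 = ‖firstColumn A‖ * sin y := him
    simpa [unitVec, e] using this

/-- Existence of lifts of maps of `Y` that lift on the level of directions. -/
theorem exists_cover_of_angle {Y : Type*} [TopologicalSpace Y]
    {A : Y → Matrix.SpecialLinearGroup (Fin 2) ℝ} (hA : Continuous A) {a : Y → ℝ}
    (ha : Continuous a) (h : ∀ y, Circle.exp (a y) = firstDirection (A y)) :
    ∃ f : Y → SL2Cover, Continuous f ∧ (∀ y, (f y).1.1 = A y) ∧
      ∀ y, (f y).1.2 0 = a y / (2 * π) := by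
  have h0 : ∀ y, (coverOf (A y) _ (exists_smul_of_circle_exp (h y))).1.2 0 = a y / (2 * π) := by
    intro y
    simp [coverOf, angleLift]
  refine ⟨fun y => coverOf (A y) _ (exists_smul_of_circle_exp (h y)),
    continuous_cover_iff.2 ⟨hA, ?_⟩, fun y => rfl, h0⟩
  simp only [h0]
  exact ha.div_const _

/-- A continuous family of paths in `SL(2, ℝ)` that start at the identity lifts to the universal
cover. -/
theorem exists_cover_lift {Y : Type*} [TopologicalSpace Y]
    {A : ℝ × Y → Matrix.SpecialLinearGroup (Fin 2) ℝ} (hA : Continuous A)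
    (h0 : ∀ y, A (0, y) = 1) :
    ∃ f : ℝ × Y → SL2Cover, Continuous f ∧ (∀ y, f (0, y) = 1) ∧ ∀ z, (f z).1.1 = A z := by
  have h1 : firstDirection 1 = 1 := by
    refine Subtype.ext ?_
    have : firstColumn 1 = 1 := by simp [firstColumn, Complex.ext_iff]
    change firstColumn 1 / ‖firstColumn 1‖ = 1
    simp [this]
  -- Shrinking time to `0` contracts the family of directions to a constant map, so homotopy lifting
  -- applies without any condition on `Y`.
  let H : C(unitInterval × (ℝ × Y), Circle) :=
    ⟨fun z => firstDirection (A ((z.1 : ℝ) * z.2.1, z.2.2)),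
      continuous_firstDirection.comp (hA.comp (by fun_prop))⟩
  have hH0 : ∀ z : ℝ × Y, H (0, z) = Circle.exp ((0 : C(ℝ × Y, ℝ)) z) := by
    intro z
    change firstDirection (A (((0 : unitInterval) : ℝ) * z.1, z.2)) = Circle.exp 0
    rw [Set.Icc.coe_zero, zero_mul, h0, h1, Circle.exp_zero]
  let G := Circle.isCoveringMap_exp.liftHomotopy H 0 hH0
  have hG : ∀ z, Circle.exp (G (1, z)) = firstDirection (A z) := by
    intro z
    have := congrFun (Circle.isCoveringMap_exp.liftHomotopy_lifts H 0 hH0) (1, z)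
    refine this.trans ?_
    change firstDirection (A (((1 : unitInterval) : ℝ) * z.1, z.2)) = _
    rw [Set.Icc.coe_one, one_mul]
  obtain ⟨f, hf, hf1, hf2⟩ := exists_cover_of_angle hA
    (G.continuous.comp (Continuous.prodMk_right 1)) hG
  refine ⟨f, hf, fun y => SL2Cover_ext ((hf1 _).trans (h0 y)) ?_, hf1⟩
  rw [hf2]
  have : G (1, (0, y)) = 0 := by
    -- At time `0` the homotopy is constant in `s`, so its lift is constant and keeps its initial
    -- value `0`. This gives the identity of the cover, and not another element over the identity
    -- matrix.
    have hc := Circle.isCoveringMap_exp.const_of_comp (g := fun s : unitInterval => G (s, (0, y)))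
      (G.continuous.comp (Continuous.prodMk_left _)) (fun s s' => by
        have e := congrFun (Circle.isCoveringMap_exp.liftHomotopy_lifts H 0 hH0)
        refine (e (s, (0, y))).trans (Eq.trans ?_ (e (s', (0, y))).symm)
        change firstDirection (A (_ * 0, y)) = firstDirection (A (_ * 0, y))
        rw [mul_zero, mul_zero]) 1 0
    exact hc.trans (Circle.isCoveringMap_exp.liftHomotopy_zero H 0 hH0 (0, y))
  rw [Function.comp_apply, this, zero_div]
  rfl

end Cover

/-! ### Quasi-additive cocycles over a measure preserving flow -/

section Ergodic

variable {M : Type*} {φ : ℝ → M → M} {a : ℝ → M → ℝ} {D : ℝ}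

/-- Each step of length `N` costs one defect `D`, and the errors add up. -/
theorem abs_sub_birkhoff_le (h0 : a 0 = 0)
    (hD : ∀ S T x, |a (S + T) x - a S (φ T x) - a T x| ≤ D) (N : ℝ) (n : ℕ) (x : M) :
    |a (n * N) x - ∑ k ∈ Finset.range n, a N (φ (k * N) x)| ≤ n * D := by
  induction n with
  | zero => simp [h0]
  | succ n ih =>
    have h := abs_le.1 (hD N (n * N) x)
    have h' := abs_le.1 ih
    have e : ((n + 1 : ℕ) : ℝ) * N = N + n * N := by push_cast; ring
    rw [Finset.sum_range_succ, e, abs_le]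
    push_cast
    constructor <;> linarith

/-- Write `T = n N + r` with `0 ≤ r < N`. The `n` defects contribute `n D / T ≤ D / N`, splitting
off the remainder `r` contributes `(D + B) / T`, and replacing the denominator `n N` by `T` costs `B
/ T`. -/
theorem abs_div_sub_birkhoff_le (h0 : a 0 = 0)
    (hD : ∀ S T x, |a (S + T) x - a S (φ T x) - a T x| ≤ D) {N T B : ℝ} (hN : 0 < N)
    (hT : N ≤ T) (hB : ∀ r ∈ Icc 0 N, ∀ x, |a r x| ≤ B) (x : M) :
    |1 / T * a T x - 1 / N * ((⌊T / N⌋₊ : ℝ)⁻¹ *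
      ∑ k ∈ Finset.range ⌊T / N⌋₊, a N (φ (k * N) x))| ≤ (D + 2 * B) / T + D / N := by
  have hT0 : 0 < T := hN.trans_le hT
  have hD0 : 0 ≤ D := (abs_nonneg _).trans (hD 0 0 x)
  have hB0 : 0 ≤ B := (abs_nonneg _).trans (hB 0 ⟨le_rfl, hN.le⟩ x)
  set n := ⌊T / N⌋₊
  have hn1 : (1 : ℝ) ≤ n := by
    exact_mod_cast (Nat.one_le_floor_iff (T / N)).2 ((one_le_div hN).2 hT)
  have hn0 : (0 : ℝ) < n := by linarith
  have hnT : n * N ≤ T := (le_div_iff₀ hN).1 (Nat.floor_le (by positivity))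
  have hnT' : T < (n + 1) * N := (div_lt_iff₀ hN).1 (Nat.lt_floor_add_one _)
  have h1 := abs_le.1 (abs_sub_birkhoff_le h0 hD N n x)
  have h2 := abs_le.1 (hD (T - n * N) (n * N) x)
  rw [sub_add_cancel] at h2
  have h3 := abs_le.1 (hB (T - n * N) ⟨by linarith, by linarith⟩ (φ (n * N) x))
  set S := ∑ k ∈ Finset.range n, a N (φ (k * N) x)
  have hS : |S| ≤ n * B := by
    refine (Finset.abs_sum_le_sum_abs _ _).trans ((Finset.sum_le_card_nsmul _ _ B fun k _ =>
      hB N ⟨hN.le, le_rfl⟩ _).trans ?_)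
    simp
  have h4 : |a T x - S| ≤ D + B + n * D := by
    rw [abs_le]
    constructor <;> linarith
  have e : 1 / T * a T x - 1 / N * ((n : ℝ)⁻¹ * S) =
      (a T x - S) / T + -(S * ((T - n * N) / (T * (n * N)))) := by
    field_simp
    ring
  have h5 : |(a T x - S) / T| ≤ (D + B) / T + D / N := by
    rw [abs_div, abs_of_pos hT0, div_le_iff₀ hT0, add_mul, div_mul_cancel₀ _ hT0.ne']
    refine h4.trans (add_le_add_right ?_ _)
    rw [div_mul_eq_mul_div, le_div_iff₀ hN]
    nlinarith
  have h6 : |-(S * ((T - n * N) / (T * (n * N))))| ≤ B / T := by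
    have hq : 0 ≤ (T - n * N) / (T * (n * N)) := div_nonneg (by linarith) (by positivity)
    rw [abs_neg, abs_mul, abs_of_nonneg hq]
    calc |S| * ((T - n * N) / (T * (n * N))) ≤ n * B * (N / (T * (n * N))) := by
          refine mul_le_mul hS ?_ hq (by positivity)
          gcongr
          linarith
      _ = B / T := by field_simp
  calc _ ≤ |(a T x - S) / T| + |-(S * ((T - n * N) / (T * (n * N))))| := by
        rw [e]; exact abs_add_le _ _
    _ ≤ (D + B) / T + D / N + B / T := add_le_add h5 h6
    _ = _ := by ring

theorem tendsto_integral_of_density [MeasurableSpace M] {m : Measure M} {b : ℝ → M → ℝ}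
    (hb : ∀ T, Integrable (b T) m) {R : M → ℝ}
    (h : Tendsto (fun T : ℝ => eLpNorm (fun x => 1 / T * b T x - R x) 1 m) atTop (𝓝 0))
    (hR : Integrable R m) :
    Tendsto (fun T : ℝ => 1 / T * ∫ x, b T x ∂m) atTop (𝓝 (∫ x, R x ∂m)) := by
  have := tendsto_integral_of_L1' R hR.1 (F := fun T : ℝ => fun x => 1 / T * b T x)
    (Eventually.of_forall fun T => (hb T).const_mul _) h
  simpa only [integral_const_mul] using this

variable [TopologicalSpace M] [CompactSpace M] [MeasurableSpace M] [BorelSpace M] {m : Measure M} [IsFiniteMeasure m]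

/-- The mean ergodic theorem for the iterates of a continuous measure preserving map. -/
theorem exists_tendsto_birkhoff (hφc : ∀ t, Continuous (φ t))
    (hφ : ∀ t, MeasurePreserving (φ t) m m) (hφ0 : ∀ x, φ 0 x = x)
    (hadd : ∀ s t x, φ (s + t) x = φ s (φ t x)) (N : ℝ) (f : C(M, ℝ)) :
    ∃ P : Lp ℝ 2 m, Tendsto (fun n : ℕ => ContinuousMap.toLp 2 m ℝ ((n : ℝ)⁻¹ •
      ∑ k ∈ Finset.range n, f.comp ⟨φ (k * N), hφc _⟩)) atTop (𝓝 P) := by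
  -- Composition with the time `N` map is an isometry of `L²`, to which von Neumann's theorem
  -- applies.
  set U : Lp ℝ 2 m →L[ℝ] Lp ℝ 2 m :=
    (Lp.compMeasurePreservingₗᵢ ℝ (φ N) (hφ N)).toContinuousLinearMap
  have hU : ∀ g : C(M, ℝ), U (ContinuousMap.toLp 2 m ℝ g) =
      ContinuousMap.toLp 2 m ℝ (g.comp ⟨φ N, hφc N⟩) := by
    intro g
    refine Lp.ext ?_
    have h1 := Lp.coeFn_compMeasurePreserving (ContinuousMap.toLp 2 m ℝ g) (hφ N)
    have h2 := (hφ N).quasiMeasurePreserving.ae_eq_comp (ContinuousMap.coeFn_toLp (p := 2) (𝕜 := ℝ) m g)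
    exact (h1.trans h2).trans (ContinuousMap.coeFn_toLp m
      (g.comp ⟨φ N, hφc N⟩)).symm
  have hUk : ∀ k : ℕ, U^[k] (ContinuousMap.toLp 2 m ℝ f) =
      ContinuousMap.toLp 2 m ℝ (f.comp ⟨φ (k * N), hφc _⟩) := by
    intro k
    induction k with
    | zero =>
      rw [Function.iterate_zero, id]
      congr 1
      ext x
      simp [hφ0]
    | succ k ih =>
      rw [Function.iterate_succ_apply', ih, hU]
      congr 1
      ext x
      simp only [ContinuousMap.comp_apply, ContinuousMap.coe_mk]
      rw [← hadd]
      push_cast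
      ring_nf
  have h := U.tendsto_birkhoffAverage_orthogonalProjection
    (LinearIsometry.norm_toContinuousLinearMap_le _) (ContinuousMap.toLp 2 m ℝ f)
  refine ⟨_, h.congr fun n => ?_⟩
  simp only [birkhoffAverage, birkhoffSum, id, hUk, map_smul, map_sum]

/-- For fixed `N` the Birkhoff averages of `a N / N` converge in `L²` to some `Q`, so `a T / T`
eventually stays within a multiple of `D / N` of `Q`, up to an arbitrarily small error. As `N` is
arbitrary, `a T / T` is Cauchy, and the limits `Q` need not be compared with each other. -/
theorem exists_tendsto_quasiadditive (hφc : ∀ t, Continuous (φ t))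
    (hφ : ∀ t, MeasurePreserving (φ t) m m) (hφ0 : ∀ x, φ 0 x = x)
    (hadd : ∀ s t x, φ (s + t) x = φ s (φ t x)) {a : ℝ → C(M, ℝ)} (ha : Continuous a)
    (h0 : a 0 = 0) (hD : ∀ S T x, |a (S + T) x - a S (φ T x) - a T x| ≤ D) :
    ∃ R : Lp ℝ 2 m, Tendsto (fun T : ℝ => ContinuousMap.toLp 2 m ℝ ((1 / T) • a T)) atTop
      (𝓝 R) := by
  set ι : C(M, ℝ) →L[ℝ] Lp ℝ 2 m := ContinuousMap.toLp 2 m ℝ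
  rcases isEmpty_or_nonempty M with hM | ⟨⟨x₀⟩⟩
  · refine ⟨0, tendsto_const_nhds.congr fun T => ?_⟩
    rw [Subsingleton.elim ((1 / T) • a T) 0, map_zero]
  have hD0 : 0 ≤ D := (abs_nonneg _).trans (hD 0 0 x₀)
  have key : ∀ N : ℝ, 0 < N → ∃ Q : Lp ℝ 2 m, ∀ ε > 0, ∀ᶠ T in atTop,
      ‖ι ((1 / T) • a T) - Q‖ ≤ ‖ι‖ * (D / N) + ε := by
    intro N hN
    obtain ⟨P, hP⟩ := exists_tendsto_birkhoff hφc hφ hφ0 hadd N (a N)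
    obtain ⟨B, hB⟩ := (isCompact_Icc (a := (0 : ℝ)) (b := N)).bddAbove_image
      (f := fun r => ‖a r‖) ha.norm.continuousOn
    have hB' : ∀ r ∈ Icc 0 N, ∀ x, |a r x| ≤ B := fun r hr x =>
      ((a r).norm_coe_le_norm x).trans (hB (mem_image_of_mem _ hr))
    refine ⟨(1 / N) • P, fun ε hε => ?_⟩
    have hfl : Tendsto (fun T : ℝ => ⌊T / N⌋₊) atTop atTop :=
      tendsto_nat_floor_atTop.comp (tendsto_id.atTop_div_const hN)
    have h1 := ((hP.comp hfl).const_smul (1 / N)).dist tendsto_const_nhds (b := (1 / N) • P)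
    rw [dist_self] at h1
    have h2 : Tendsto (fun T : ℝ => ‖ι‖ * ((D + 2 * B) / T)) atTop (𝓝 0) := by
      simpa using (tendsto_const_nhds.div_atTop tendsto_id).const_mul ‖ι‖
    have h3 := h1.add h2
    rw [add_zero] at h3
    filter_upwards [h3.eventually (gt_mem_nhds hε), eventually_ge_atTop N] with T hT hTN
    rw [dist_eq_norm, Function.comp_apply, ← map_smul] at hT
    set g : C(M, ℝ) := (1 / N) • ((⌊T / N⌋₊ : ℝ)⁻¹ •
      ∑ k ∈ Finset.range ⌊T / N⌋₊, (a N).comp ⟨φ (k * N), hφc _⟩)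
    have hT0 : 0 < T := hN.trans_le hTN
    have hBn : 0 ≤ B := (abs_nonneg _).trans (hB' 0 ⟨le_rfl, hN.le⟩ x₀)
    have h4 : ‖(1 / T) • a T - g‖ ≤ (D + 2 * B) / T + D / N := by
      rw [ContinuousMap.norm_le _ (by positivity)]
      intro x
      have := abs_div_sub_birkhoff_le (a := fun t => a t) (by rw [h0]; rfl) hD hN hTN hB' x
      simpa [g, ContinuousMap.coe_sum] using this
    have h5 : ‖ι ((1 / T) • a T) - ι g‖ ≤ ‖ι‖ * ((D + 2 * B) / T + D / N) := by
      rw [← map_sub]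
      exact (ι.le_opNorm _).trans (mul_le_mul_of_nonneg_left h4 (norm_nonneg _))
    calc _ ≤ ‖ι ((1 / T) • a T) - ι g‖ + ‖ι g - (1 / N) • P‖ := norm_sub_le_norm_sub_add_norm_sub _ _ _
      _ ≤ _ := by
        rw [mul_add] at h5
        linarith
  refine cauchy_map_iff_exists_tendsto.1 (Metric.cauchy_iff.2 ⟨inferInstance, fun ε hε => ?_⟩)
  have hN : ∃ N : ℝ, 0 < N ∧ ‖ι‖ * (D / N) < ε / 8 := by
    have h : Tendsto (fun N : ℝ => ‖ι‖ * (D / N)) atTop (𝓝 0) := by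
      simpa using (tendsto_const_nhds.div_atTop tendsto_id).const_mul ‖ι‖
    obtain ⟨N, h1, h2⟩ := ((eventually_gt_atTop 0).and
      (h.eventually (gt_mem_nhds (by positivity : 0 < ε / 8)))).exists
    exact ⟨N, h1, h2⟩
  obtain ⟨N, hN0, hNε⟩ := hN
  obtain ⟨Q, hQ⟩ := key N hN0
  refine ⟨_, image_mem_map (hQ (ε / 8) (by positivity)), ?_⟩
  rintro _ ⟨T, hT, rfl⟩ _ ⟨T', hT', rfl⟩
  have hT : ‖ι ((1 / T) • a T) - Q‖ ≤ ‖ι‖ * (D / N) + ε / 8 := hT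
  have hT' : ‖ι ((1 / T') • a T') - Q‖ ≤ ‖ι‖ * (D / N) + ε / 8 := hT'
  rw [← dist_eq_norm] at hT hT'
  have := dist_triangle_right (ι ((1 / T) • a T)) (ι ((1 / T') • a T')) Q
  linarith

theorem exists_density (hφc : ∀ t, Continuous (φ t))
    (hφ : ∀ t, MeasurePreserving (φ t) m m) (hφ0 : ∀ x, φ 0 x = x)
    (hadd : ∀ s t x, φ (s + t) x = φ s (φ t x)) {a : ℝ → C(M, ℝ)} (ha : Continuous a)
    (h0 : a 0 = 0) (hD : ∀ S T x, |a (S + T) x - a S (φ T x) - a T x| ≤ D) :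
    ∃ R : M → ℝ, Integrable R m ∧
      Tendsto (fun T : ℝ => eLpNorm (fun x => 1 / T * a T x - R x) 1 m) atTop (𝓝 0) := by
  obtain ⟨R, hR⟩ := exists_tendsto_quasiadditive hφc hφ hφ0 hadd ha h0 hD
  have hRm : MemLp R 2 m := Lp.memLp R
  refine ⟨R, hRm.integrable one_le_two, ?_⟩
  have h1 := (Lp.tendsto_Lp_iff_tendsto_eLpNorm' _ R).1 hR
  have h2 : Tendsto (fun T : ℝ => eLpNorm (fun x => 1 / T * a T x - R x) 2 m *
      m univ ^ (1 / (1 : ℝ≥0∞).toReal - 1 / (2 : ℝ≥0∞).toReal)) atTop (𝓝 0) := by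
    have h3 : Tendsto (fun T : ℝ => eLpNorm (fun x => 1 / T * a T x - R x) 2 m) atTop (𝓝 0) := by
      refine h1.congr fun T => eLpNorm_congr_ae ?_
      filter_upwards [ContinuousMap.coeFn_toLp (p := 2) (𝕜 := ℝ) m ((1 / T) • a T)] with x hx
      rw [Pi.sub_apply, hx]
      rfl
    have := ENNReal.Tendsto.mul_const h3 (b := m univ ^ (1 / (1 : ℝ≥0∞).toReal - 1 / (2 : ℝ≥0∞).toReal))
      (Or.inr (ENNReal.rpow_ne_top_of_nonneg (by norm_num) (measure_ne_top m univ)))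
    rwa [zero_mul] at this
  refine tendsto_of_tendsto_of_tendsto_of_le_of_le tendsto_const_nhds h2 (fun _ => zero_le)
    fun T => eLpNorm_le_eLpNorm_mul_rpow_measure_univ one_le_two ?_
  exact ((a T).continuous.aestronglyMeasurable.const_mul _).sub hRm.1

/-- Invariance of the measure gives all Birkhoff terms the same integral, so `∫ a (n T)` is `n ∫ a
T` up to `n D` times the mass. Divide by `n T` and let `n` tend to infinity. The rate depends only
on `D` and the mass, and this uniformity is what yields continuity of the invariant. -/
theorem abs_integral_sub_le (hφ : ∀ t, MeasurePreserving (φ t) m m) {a : ℝ → C(M, ℝ)}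
    (h0 : a 0 = 0) (hD : ∀ S T x, |a (S + T) x - a S (φ T x) - a T x| ≤ D) {r : ℝ}
    (hr : Tendsto (fun T : ℝ => 1 / T * ∫ x, a T x ∂m) atTop (𝓝 r)) {T : ℝ} (hT : 0 < T) :
    |1 / T * ∫ x, a T x ∂m - r| ≤ D * m.real univ / T := by
  have hint : ∀ t, Integrable (a t) m := fun t =>
    memLp_one_iff_integrable.1 (ContinuousMap.memLp m ℝ (a t))
  have key : ∀ n : ℕ, |∫ x, a (n * T) x ∂m - n * ∫ x, a T x ∂m| ≤ n * D * m.real univ := by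
    intro n
    have h1 : ∀ k : ℕ, Integrable (fun x => a T (φ (k * T) x)) m := fun k =>
      (hφ (k * T)).integrable_comp_of_integrable (hint T)
    have h2 : ∀ k : ℕ, ∫ x, a T (φ (k * T) x) ∂m = ∫ x, a T x ∂m := fun k => by
      have h := integral_map (hφ (k * T)).measurable.aemeasurable (μ := m)
        (f := a T) (a T).continuous.aestronglyMeasurable
      rw [(hφ (k * T)).map_eq] at h
      exact h.symm
    have h3 : ∫ x, a (n * T) x ∂m - n * ∫ x, a T x ∂m =
        ∫ x, (a (n * T) x - ∑ k ∈ Finset.range n, a T (φ (k * T) x)) ∂m := by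
      rw [integral_sub (hint _) (integrable_finsetSum _ fun k _ => h1 k),
        integral_finsetSum _ fun k _ => h1 k]
      simp [h2]
    rw [h3, ← Real.norm_eq_abs]
    exact norm_integral_le_of_norm_le_const (Eventually.of_forall fun x =>
      abs_sub_birkhoff_le (a := fun t => a t) (by rw [h0]; rfl) hD T n x)
  have hseq : Tendsto (fun n : ℕ => ((n + 1 : ℕ) : ℝ) * T) atTop atTop :=
    ((tendsto_natCast_atTop_atTop (R := ℝ)).comp (tendsto_add_atTop_nat 1)).atTop_mul_const hT
  have h1 := ((hr.comp hseq).const_sub (1 / T * ∫ x, a T x ∂m)).abs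
  refine le_of_tendsto h1 (Eventually.of_forall fun n => ?_)
  have hn : (0 : ℝ) < (n + 1 : ℕ) := by positivity
  have e : 1 / T * ∫ x, a T x ∂m - 1 / (((n + 1 : ℕ) : ℝ) * T) * ∫ x, a ((n + 1 : ℕ) * T) x ∂m =
      -((∫ x, a ((n + 1 : ℕ) * T) x ∂m - (n + 1 : ℕ) * ∫ x, a T x ∂m) / ((n + 1 : ℕ) * T)) := by
    field_simp
    ring
  change |1 / T * ∫ x, a T x ∂m - 1 / (((n + 1 : ℕ) : ℝ) * T) * ∫ x, a ((n + 1 : ℕ) * T) x ∂m| ≤ _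
  rw [e, abs_neg, abs_div, abs_of_pos (mul_pos hn hT), div_le_div_iff₀ (mul_pos hn hT) hT]
  have := mul_le_mul_of_nonneg_right (key (n + 1)) hT.le
  linarith

end Ergodic

/-! ### Consequences of the vanishing of Čech cohomology -/

section CechVanishing

/-- The angle of `z`, on the branch that is continuous near `c`. -/
def angleNear (c z : Circle) : ℝ := Complex.arg (z / c : Circle) + Complex.arg c

theorem exp_angleNear (c z : Circle) : Circle.exp (angleNear c z) = z := by
  rw [angleNear, Circle.exp_add, Circle.exp_arg, Circle.exp_arg, div_mul_cancel]

theorem continuousAt_angleNear {Y : Type*} [TopologicalSpace Y] {f : Y → Circle} {y : Y}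
    (hf : ContinuousAt f y) {c : Circle} (h : ((f y / c : Circle) : ℂ) ∈ Complex.slitPlane) :
    ContinuousAt (fun y => angleNear c (f y)) y := by
  have h1 : ContinuousAt (fun y => ((f y / c : Circle) : ℂ)) y :=
    ContinuousAt.comp (g := fun z : Circle => (z : ℂ)) continuous_subtype_val.continuousAt
      (hf.div_const c)
  exact (ContinuousAt.comp (g := Complex.arg) (f := fun y => ((f y / c : Circle) : ℂ))
    (Complex.continuousAt_arg h) h1).add continuousAt_const

theorem round_div_two_pi {x y : ℝ} (h : Circle.exp x = Circle.exp y) :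
    ((round ((x - y) / (2 * Real.pi)) : ℤ) : ℝ) * (2 * Real.pi) = x - y := by
  obtain ⟨n, hn⟩ := Circle.exp_eq_exp.1 h
  have : (x - y) / (2 * Real.pi) = n := by
    rw [hn]
    field_simp
    ring
  rw [this, round_intCast, hn]
  ring

/-- The values are already integers; rounding merely produces them in `ℤ`, where continuity means
local constancy. -/
theorem continuousOn_round {Y : Type*} [TopologicalSpace Y] {f : Y → ℝ} {s : Set Y}
    (hf : ContinuousOn f s) (h : ∀ y ∈ s, ∃ n : ℤ, f y = n) :
    ContinuousOn (fun y => round (f y)) s := by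
  have e : EqOn f (fun y => ((round (f y) : ℤ) : ℝ)) s := by
    intro y hy
    obtain ⟨n, hn⟩ := h y hy
    simp only [hn, round_intCast]
  exact Int.isClosedEmbedding_coe_real.isInducing.continuousOn_iff.2 (hf.congr e.symm)

theorem cechDifferential_one {M ι : Type u} (c : (Fin 1 → ι) → M → ℤ) (s : Fin 2 → ι) (x : M) :
    cechDifferential c s x = c ![s 1] x - c ![s 0] x := by
  have e0 : s ∘ (0 : Fin 2).succAbove = ![s 1] := by funext i; fin_cases i; rfl
  have e1 : s ∘ (1 : Fin 2).succAbove = ![s 0] := by funext i; fin_cases i; rfl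
  refine (Fin.sum_univ_two _).trans ?_
  rw [e0, e1]
  simp only [Fin.val_zero, Fin.val_one]
  ring

theorem cechDifferential_two {M ι : Type u} (c : (Fin 2 → ι) → M → ℤ) (s : Fin 3 → ι) (x : M) :
    cechDifferential c s x = c ![s 1, s 2] x - c ![s 0, s 2] x + c ![s 0, s 1] x := by
  have e0 : s ∘ (0 : Fin 3).succAbove = ![s 1, s 2] := by funext i; fin_cases i <;> rfl
  have e1 : s ∘ (1 : Fin 3).succAbove = ![s 0, s 2] := by funext i; fin_cases i <;> rfl
  have e2 : s ∘ (2 : Fin 3).succAbove = ![s 0, s 1] := by funext i; fin_cases i <;> rfl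
  refine (Fin.sum_univ_three _).trans ?_
  rw [e0, e1, e2]
  simp only [Fin.val_zero, Fin.val_one, Fin.val_two]
  ring

theorem cechDifferential_three {M ι : Type u} (c : (Fin 3 → ι) → M → ℤ) (s : Fin 4 → ι) (x : M) :
    cechDifferential c s x = c ![s 1, s 2, s 3] x - c ![s 0, s 2, s 3] x +
      c ![s 0, s 1, s 3] x - c ![s 0, s 1, s 2] x := by
  have e0 : s ∘ (0 : Fin 4).succAbove = ![s 1, s 2, s 3] := by funext i; fin_cases i <;> rfl
  have e1 : s ∘ (1 : Fin 4).succAbove = ![s 0, s 2, s 3] := by funext i; fin_cases i <;> rfl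
  have e2 : s ∘ (2 : Fin 4).succAbove = ![s 0, s 1, s 3] := by funext i; fin_cases i <;> rfl
  have e3 : s ∘ (3 : Fin 4).succAbove = ![s 0, s 1, s 2] := by funext i; fin_cases i <;> rfl
  refine (Fin.sum_univ_four _).trans ?_
  rw [e0, e1, e2, e3]
  simp only [Fin.val_zero, Fin.val_one, Fin.val_two]
  norm_num
  ring

variable {M : Type u} [TopologicalSpace M]

/-- If `H¹(M; ℤ) = 0`, then each continuous map from `M` to the circle lifts to `ℝ`. -/
theorem exists_lift_circle (H : CechCohomologyVanishes M 1) {f : M → Circle} (hf : Continuous f) :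
    ∃ F : M → ℝ, Continuous F ∧ ∀ x, Circle.exp (F x) = f x := by
  set U : M → Set M := fun a => {x | ((f x / f a : Circle) : ℂ) ∈ Complex.slitPlane}
  set L : M → M → ℝ := fun a x => angleNear (f a) (f x)
  have hUo : ∀ a, IsOpen (U a) := fun a => Complex.isOpen_slitPlane.preimage
    (continuous_subtype_val.comp (hf.div_const (f a)))
  have hU : IsOpenCover U := by
    refine ⟨hUo, eq_univ_of_forall fun x => mem_iUnion.2 ⟨x, ?_⟩⟩
    change ((f x / f x : Circle) : ℂ) ∈ Complex.slitPlane
    rw [div_self']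
    exact Complex.one_mem_slitPlane
  have hL : ∀ a, ∀ x ∈ U a, ContinuousAt (L a) x := fun a x hx =>
    continuousAt_angleNear hf.continuousAt hx
  have hLe : ∀ a b x, Circle.exp (L a x) = Circle.exp (L b x) := fun a b x =>
    (exp_angleNear _ _).trans (exp_angleNear _ _).symm
  -- The local logarithms `L a` of `f` differ by integer multiples of `2π`, and these integers form
  -- a Čech 1-cocycle.
  set c : (Fin 2 → M) → M → ℤ := fun s x => round ((L (s 1) x - L (s 0) x) / (2 * Real.pi))
  have hc : ∀ s x, (c s x : ℝ) * (2 * Real.pi) = L (s 1) x - L (s 0) x := fun s x =>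
    round_div_two_pi (hLe _ _ x)
  have hp : (2 * Real.pi : ℝ) ≠ 0 := by positivity
  obtain ⟨κ, V, r, hV, hVU, b, hb, hcb⟩ := H M U hU c
    (by
      intro s
      refine continuousOn_round (fun x hx => ?_) fun x _ => ⟨c s x, ?_⟩
      · rw [mem_iInter] at hx
        exact (((hL _ x (hx 1)).sub (hL _ x (hx 0))).div_const _).continuousWithinAt
      · rw [← hc s x, mul_div_cancel_right₀ _ hp])
    (by
      intro s x _
      have : ((cechDifferential c s x : ℤ) : ℝ) * (2 * Real.pi) = 0 := by
        rw [cechDifferential_two]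
        push_cast
        rw [add_mul, sub_mul, hc, hc, hc]
        simp only [Matrix.cons_val_zero, Matrix.cons_val_one]
        ring
      exact_mod_cast (mul_eq_zero.1 this).resolve_right hp)
  -- Subtracting the 0-cochain that bounds the cocycle makes the local logarithms agree on overlaps,
  -- so they glue.
  set G : κ → M → ℝ := fun a x => L (r a) x - 2 * Real.pi * b ![a] x
  have hG : ∀ a a' x, x ∈ V a → x ∈ V a' → G a x = G a' x := by
    intro a a' x ha ha'
    have h := hcb ![a, a'] x (by
      rw [mem_iInter]
      intro i
      fin_cases i
      exacts [ha, ha'])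
    have h2 := hc (r ∘ ![a, a']) x
    rw [h, cechDifferential_one] at h2
    simp only [Function.comp_apply, Matrix.cons_val_zero, Matrix.cons_val_one] at h2
    push_cast at h2
    simp only [G]
    linarith
  have hcov : ∀ x, ∃ a, x ∈ V a := fun x => mem_iUnion.1 (hV.2 ▸ mem_univ x)
  choose α hα using hcov
  refine ⟨fun x => G (α x) x, continuous_iff_continuousAt.2 fun x => ?_, fun x => ?_⟩
  · have hn := (hV.1 (α x)).mem_nhds (hα x)
    have hb' : ContinuousAt (b ![α x]) x := by
      have := hb ![α x]
      refine this.continuousAt (mem_of_superset hn fun y hy => mem_iInter.2 fun i => ?_)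
      rwa [Fin.fin_one_eq_zero i]
    have hG' : ContinuousAt (G (α x)) x :=
      (hL _ x (hVU _ (hα x))).sub (continuousAt_const.mul
        (continuous_of_discreteTopology.continuousAt.comp hb' :
          ContinuousAt (fun y => ((b ![α x] y : ℤ) : ℝ)) x))
    refine hG'.congr ?_
    filter_upwards [hn] with y hy
    exact hG _ _ y hy (hα y)
  · rw [Circle.exp_eq_exp.2 ⟨-b ![α x] x, ?_⟩, exp_angleNear (f (r (α x))) (f x)]
    simp only [G, L]
    push_cast
    ring

variable [CompactSpace M] [T2Space M]

/-- A refinement on whose overlaps a circle valued cochain lifts to `ℝ`. -/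
theorem exists_refinement_lift {ι : Type*} [Finite ι] {U : ι → Set M} (hU : ∀ i, IsOpen (U i))
    (hUc : ⋃ i, U i = univ) {g : ι → ι → M → Circle}
    (hg : ∀ i j, ContinuousOn (g i j) (U i ∩ U j)) :
    ∃ (W : M → Set M) (r : M → ι) (h : M → M → M → ℝ), IsOpenCover W ∧ (∀ a, W a ⊆ U (r a)) ∧
      (∀ a b, ContinuousOn (h a b) (W a ∩ W b)) ∧
      ∀ a b x, Circle.exp (h a b x) = g (r a) (r b) x := by
  obtain ⟨v, hv, hvo, hvU⟩ := exists_iUnion_eq_closure_subset hU (fun _ => toFinite _) hUc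
  have hr : ∀ a : M, ∃ i, a ∈ v i := fun a => mem_iUnion.1 (hv ▸ mem_univ a)
  choose r hr using hr
  -- The set `W a` is a neighbourhood of `a` on which every relevant transition function stays close
  -- to its value at `a`. It avoids each `v i` whose closure does not contain `a`, so that only
  -- functions continuous at `a` are relevant. Finiteness of the cover allows all these conditions
  -- at once.
  have hW : ∀ a, ∃ W : Set M, a ∈ W ∧ IsOpen W ∧ W ⊆ v (r a) ∧
      (∀ i, a ∉ closure (v i) → ∀ y ∈ W, y ∉ v i) ∧
      ∀ i j, a ∈ closure (v i) → a ∈ closure (v j) → ∀ y ∈ W,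
        ((g i j y / g i j a : Circle) : ℂ) ∈ Complex.slitPlane := by
    intro a
    have h1 : ∀ᶠ y in 𝓝 a, ∀ i, a ∉ closure (v i) → y ∉ v i :=
      eventually_all.2 fun i => eventually_imp_distrib_left.2 fun h =>
        mem_of_superset (isClosed_closure.isOpen_compl.mem_nhds h)
          fun y hy hy' => hy (subset_closure hy')
    have h2 : ∀ᶠ y in 𝓝 a, ∀ i j, a ∈ closure (v i) → a ∈ closure (v j) →
        ((g i j y / g i j a : Circle) : ℂ) ∈ Complex.slitPlane := by
      refine eventually_all.2 fun i => eventually_all.2 fun j => eventually_imp_distrib_left.2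
        fun hi => eventually_imp_distrib_left.2 fun hj => ?_
      have hc : ContinuousAt (g i j) a := (hg i j).continuousAt
        (((hU i).inter (hU j)).mem_nhds ⟨hvU i hi, hvU j hj⟩)
      have hc' : ContinuousAt (fun y => ((g i j y / g i j a : Circle) : ℂ)) a :=
        ContinuousAt.comp (g := fun z : Circle => (z : ℂ)) continuous_subtype_val.continuousAt
          (hc.div_const _)
      refine hc'.eventually_mem (Complex.isOpen_slitPlane.mem_nhds ?_)
      rw [div_self']
      exact Complex.one_mem_slitPlane
    obtain ⟨W, hW, hWo, haW⟩ := eventually_nhds_iff.1 ((h1.and h2).and ((hvo (r a)).mem_nhds (hr a)))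
    exact ⟨W, haW, hWo, fun y hy => (hW y hy).2, fun i hi y hy => (hW y hy).1.1 i hi,
      fun i j hi hj y hy => (hW y hy).1.2 i j hi hj⟩
  choose W haW hWo hWv hW1 hW2 using hW
  refine ⟨W, r, fun a b x => angleNear (g (r a) (r b) a) (g (r a) (r b) x),
    ⟨hWo, eq_univ_of_forall fun x => mem_iUnion.2 ⟨x, haW x⟩⟩,
    fun a => (hWv a).trans (subset_closure.trans (hvU _)), fun a b x hx => ?_,
    fun a b x => exp_angleNear _ _⟩
  -- If `W a` meets `W b`, it meets `v (r b)`, which the choice of `W a` permits only when `a` lies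
  -- in the closure. So the transition function is controlled around `a`, and one branch of the
  -- angle is continuous on the whole overlap.
  have hb : a ∈ closure (v (r b)) := by
    by_contra h
    exact hW1 a (r b) h x hx.1 (hWv b hx.2)
  have hxU : x ∈ U (r a) ∩ U (r b) :=
    ⟨hvU _ (subset_closure (hWv a hx.1)), hvU _ (subset_closure (hWv b hx.2))⟩
  exact (continuousAt_angleNear ((hg _ _).continuousAt (((hU _).inter (hU _)).mem_nhds hxU))
    (hW2 a _ _ (subset_closure (hr a)) hb x hx.1)).continuousWithinAt

/-- If `H²(M; ℤ) = 0`, then each cocycle with values in the circle is a coboundary on a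
refinement. -/
theorem exists_coboundary (H : CechCohomologyVanishes M 2) {ι : Type*} [Finite ι] {U : ι → Set M}
    (hU : ∀ i, IsOpen (U i)) (hUc : ⋃ i, U i = univ) {g : ι → ι → M → Circle}
    (hg : ∀ i j, ContinuousOn (g i j) (U i ∩ U j))
    (hgc : ∀ i j k, ∀ x ∈ U i ∩ U j ∩ U k, g i j x * g j k x = g i k x) :
    ∃ (κ : Type u) (V : κ → Set M) (r : κ → ι) (ζ : κ → M → Circle), IsOpenCover V ∧
      (∀ a, V a ⊆ U (r a)) ∧ (∀ a, ContinuousOn (ζ a) (V a)) ∧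
      ∀ a b, ∀ x ∈ V a ∩ V b, g (r a) (r b) x = ζ a x / ζ b x := by
  obtain ⟨W, q, h, hW, hWU, hh, hhg⟩ := exists_refinement_lift hU hUc hg
  have hp : (2 * Real.pi : ℝ) ≠ 0 := by positivity
  -- This is the connecting map from circle-valued 1-cocycles to integer 2-cocycles: the real lifts
  -- `h` satisfy the cocycle condition only up to multiples of `2π`.
  set c : (Fin 3 → M) → M → ℤ := fun s x =>
    round ((h (s 0) (s 1) x + h (s 1) (s 2) x - h (s 0) (s 2) x) / (2 * Real.pi))
  have hc : ∀ s, ∀ x ∈ ⋂ i, W (s i), (c s x : ℝ) * (2 * Real.pi) =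
      h (s 0) (s 1) x + h (s 1) (s 2) x - h (s 0) (s 2) x := by
    intro s x hx
    rw [mem_iInter] at hx
    refine round_div_two_pi ?_
    rw [Circle.exp_add, hhg, hhg, hhg]
    exact hgc _ _ _ x ⟨⟨hWU _ (hx 0), hWU _ (hx 1)⟩, hWU _ (hx 2)⟩
  obtain ⟨κ, V, r, hV, hVW, b, hb, hcb⟩ := H M W hW c
    (by
      intro s
      refine continuousOn_round ?_ fun x hx => ⟨c s x, ?_⟩
      · have hs : ∀ i j, ContinuousOn (h (s i) (s j)) (⋂ i, W (s i)) := fun i j =>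
          (hh (s i) (s j)).mono fun x hx => ⟨mem_iInter.1 hx i, mem_iInter.1 hx j⟩
        exact (((hs 0 1).add (hs 1 2)).sub (hs 0 2)).div_const _
      · rw [← hc s x hx, mul_div_cancel_right₀ _ hp])
    (by
      intro s x hx
      have hx' : ∀ i j k, x ∈ ⋂ l, W ((![s i, s j, s k] : Fin 3 → M) l) := by
        intro i j k
        rw [mem_iInter] at hx ⊢
        intro l
        fin_cases l
        exacts [hx i, hx j, hx k]
      have : ((cechDifferential c s x : ℤ) : ℝ) * (2 * Real.pi) = 0 := by
        rw [cechDifferential_three]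
        push_cast
        rw [sub_mul, add_mul, sub_mul, hc _ x (hx' _ _ _), hc _ x (hx' _ _ _), hc _ x (hx' _ _ _),
          hc _ x (hx' _ _ _)]
        simp only [Matrix.cons_val_zero, Matrix.cons_val_one, Matrix.cons_val]
        ring
      exact_mod_cast (mul_eq_zero.1 this).resolve_right hp)
  -- After correction by the integer cochain `b`, the lifts form a genuine real cocycle, with the
  -- same exponentials.
  set h' : κ → κ → M → ℝ := fun α β x => h (r α) (r β) x - 2 * Real.pi * b ![α, β] x
  have hh' : ∀ α β, ∀ x ∈ V α ∩ V β, ContinuousAt (h' α β) x := by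
    intro α β x hx
    have hn : V α ∩ V β ∈ 𝓝 x := ((hV.1 α).inter (hV.1 β)).mem_nhds hx
    have hb' : ContinuousAt (b ![α, β]) x := by
      refine (hb ![α, β]).continuousAt (mem_of_superset hn fun y hy => mem_iInter.2 fun i => ?_)
      fin_cases i
      exacts [hy.1, hy.2]
    refine ContinuousAt.sub ?_ (continuousAt_const.mul
        (continuous_of_discreteTopology.continuousAt.comp hb' :
          ContinuousAt (fun y => ((b ![α, β] y : ℤ) : ℝ)) x))
    exact (hh _ _).continuousAt (mem_of_superset hn fun y hy => ⟨hVW _ hy.1, hVW _ hy.2⟩)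
  have hcoc : ∀ α β γ, ∀ x, x ∈ V α → x ∈ V β → x ∈ V γ →
      h' α β x + h' β γ x = h' α γ x := by
    intro α β γ x h1 h2 h3
    have hx : x ∈ ⋂ i, V ((![α, β, γ] : Fin 3 → κ) i) := by
      rw [mem_iInter]
      intro i
      fin_cases i
      exacts [h1, h2, h3]
    have e := hc (r ∘ ![α, β, γ]) x (mem_iInter.2 fun i => hVW _ (mem_iInter.1 hx i))
    rw [hcb _ x hx, cechDifferential_two] at e
    simp only [Function.comp_apply, Matrix.cons_val_zero, Matrix.cons_val_one, Matrix.cons_val] at e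
    push_cast at e
    simp only [h']
    linarith
  obtain ⟨t, ht⟩ := isCompact_univ.elim_finite_subcover V hV.1 hV.2.ge
  obtain ⟨p, hp'⟩ := PartitionOfUnity.exists_isSubordinate isClosed_univ (fun a : t => V a)
    (fun a => hV.1 a) (fun x hx => by simpa using ht hx)
  -- A real cocycle is a coboundary by averaging over a partition of unity: the cocycle condition
  -- gives `f α - f β = h' α β`, since the weights sum to 1.
  set f : κ → M → ℝ := fun α x => ∑ γ : t, p γ x * h' α γ x
  refine ⟨κ, V, fun a => q (r a), fun α x => Circle.exp (f α x), hV,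
    fun a => (hVW a).trans (hWU _), fun α x hx => ?_, fun α β x hx => ?_⟩
  · refine ContinuousAt.continuousWithinAt (Circle.exp.continuous.continuousAt.comp ?_)
    refine tendsto_finsetSum _ fun γ _ => ?_
    by_cases hγ : x ∈ V γ
    · exact (p γ).continuous.continuousAt.mul (hh' α γ x ⟨hx, hγ⟩)
    · have hz : ∀ᶠ y in 𝓝 x, p γ y = 0 :=
        notMem_tsupport_iff_eventuallyEq.1 fun h => hγ (hp' γ h)
      have e : (fun y => p γ y * h' α γ y) =ᶠ[𝓝 x] fun _ => 0 :=
        hz.mono fun y hy => by simp only [hy, zero_mul]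
      exact ContinuousAt.congr continuousAt_const e.symm
  · have h1 : ∑ γ : t, p γ x = 1 := by
      rw [← finsum_eq_sum_of_fintype]
      exact p.sum_eq_one (mem_univ x)
    have h2 : f α x - f β x = h' α β x := by
      rw [← Finset.sum_sub_distrib]
      calc _ = ∑ γ : t, p γ x * h' α β x := by
            refine Finset.sum_congr rfl fun γ _ => ?_
            by_cases hγ : x ∈ V γ
            · rw [← hcoc α β γ x hx.1 hx.2 hγ]
              ring
            · have : p γ x = 0 := by
                by_contra h
                exact hγ (hp' γ (subset_tsupport _ h))
              rw [this]
              ring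
        _ = _ := by rw [← Finset.sum_mul, h1, one_mul]
    rw [← Circle.exp_sub, h2, ← hhg]
    exact Circle.exp_eq_exp.2 ⟨b ![α, β] x, by simp only [h']; ring⟩

end CechVanishing

/-! ### Linear algebra of a 3-form, a vector and a metric on the quotient -/

section NormalAlgebra

/-- Four vectors in `R3` are linearly dependent, with coefficients given by Cramer's rule. The
algebra of the normal space below comes largely from applying the projection `P`, an inner product
or the form to this one relation. -/
theorem form_cramer (f : R3 [⋀^Fin 3]→L[ℝ] ℝ) (a b c d : R3) :
    f ![b, c, d] • a - f ![a, c, d] • b + f ![a, b, d] • c - f ![a, b, c] • d = 0 := by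
  set B := (EuclideanSpace.basisFun (Fin 3) ℝ).toBasis
  have hB : ∀ u v w : R3, f ![u, v, w] = f B *
      (u 0 * v 1 * w 2 - u 0 * w 1 * v 2 - v 0 * u 1 * w 2 + v 0 * w 1 * u 2 + w 0 * u 1 * v 2 -
        w 0 * v 1 * u 2) := by
    intro u v w
    have h := DFunLike.congr_fun (AlternatingMap.eq_smul_basis_det B f.toAlternatingMap) ![u, v, w]
    rw [AlternatingMap.smul_apply, Module.Basis.det_apply, Matrix.det_fin_three] at h
    refine h.trans ?_
    simp only [Module.Basis.toMatrix_apply, B, OrthonormalBasis.coe_toBasis_repr_apply,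
      EuclideanSpace.basisFun_repr, Matrix.cons_val_zero, Matrix.cons_val_one, Matrix.cons_val,
      smul_eq_mul]
    rfl
  rw [hB, hB, hB, hB]
  ext i
  fin_cases i <;> simp <;> ring

theorem form_self_left (f : R3 [⋀^Fin 3]→L[ℝ] ℝ) (a b : R3) : f ![a, a, b] = 0 :=
  f.map_eq_zero_of_eq _ (i := 0) (j := 1) rfl (by decide)

theorem form_self_right (f : R3 [⋀^Fin 3]→L[ℝ] ℝ) (a b : R3) : f ![a, b, b] = 0 :=
  f.map_eq_zero_of_eq _ (i := 1) (j := 2) rfl (by decide)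

theorem form_add_right (f : R3 [⋀^Fin 3]→L[ℝ] ℝ) (a b c d : R3) :
    f ![a, b, c + d] = f ![a, b, c] + f ![a, b, d] := by
  have e : ∀ z : R3, Function.update ![a, b, 0] 2 z = ![a, b, z] := fun z => by
    funext i; fin_cases i <;> rfl
  have h := f.map_update_add ![a, b, 0] 2 c d
  rwa [e, e, e] at h

theorem form_smul_right (f : R3 [⋀^Fin 3]→L[ℝ] ℝ) (a b c : R3) (r : ℝ) :
    f ![a, b, r • c] = r * f ![a, b, c] := by
  have e : ∀ z : R3, Function.update ![a, b, 0] 2 z = ![a, b, z] := fun z => by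
    funext i; fin_cases i <;> rfl
  have h := f.map_update_smul ![a, b, 0] 2 r c
  rwa [e, e] at h

theorem exists_form_ne_zero {f : R3 [⋀^Fin 3]→L[ℝ] ℝ} {X : R3} (hf : f ≠ 0) (hX : X ≠ 0) :
    ∃ v w, f ![X, v, w] ≠ 0 := by
  by_contra! h
  refine hf (ContinuousAlternatingMap.ext fun v => ?_)
  have e : v = ![v 0, v 1, v 2] := by funext i; fin_cases i <;> rfl
  have h1 := form_cramer f X (v 0) (v 1) (v 2)
  rw [h, h, h, zero_smul, zero_smul, zero_smul, sub_zero, add_zero, sub_zero] at h1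
  rw [e]
  exact (smul_eq_zero.1 h1).resolve_right hX

theorem eq_smul_of_form_eq_zero {f : R3 [⋀^Fin 3]→L[ℝ] ℝ} {X v : R3} (hf : f ≠ 0) (hX : X ≠ 0)
    (h : ∀ w, f ![X, v, w] = 0) : ∃ c : ℝ, v = c • X := by
  obtain ⟨b, c, hbc⟩ := exists_form_ne_zero hf hX
  have h1 := form_cramer f X v b c
  rw [h, h, zero_smul, zero_smul, add_zero, sub_zero, sub_eq_zero] at h1
  exact ⟨(f ![X, b, c])⁻¹ * f ![v, b, c], by rw [mul_smul, h1, inv_smul_smul₀ hbc]⟩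

theorem form_smul_left_eq_zero (f : R3 [⋀^Fin 3]→L[ℝ] ℝ) (X w : R3) (c : ℝ) :
    f ![X, c • X, w] = 0 := by
  rw [form_swap12, form_smul_right, form_swap12, form_self_left, neg_zero, mul_zero, neg_zero]

variable {V : Type*} [NormedAddCommGroup V] [InnerProductSpace ℝ V]
  {f : R3 [⋀^Fin 3]→L[ℝ] ℝ} {X : R3} {P : R3 →ₗ[ℝ] V}

theorem form_smul_map (hP : P X = 0) (a b c : R3) :
    f ![X, a, b] • P c = f ![X, a, c] • P b - f ![X, b, c] • P a := by
  have h := congrArg P (form_cramer f X a b c)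
  simp only [map_sub, map_add, map_smul, hP, smul_zero, map_zero] at h
  rw [← sub_eq_zero]
  rw [← neg_eq_zero, ← h]
  abel

/-- The quotient of the area of the metric on the normal space by the area form. -/
theorem exists_conformal_factor (hf : f ≠ 0) (hX : X ≠ 0)
    (hP : ∀ v, P v = 0 ↔ ∃ c : ℝ, v = c • X) :
    ∃ k > 0, ∀ a b, k ^ 2 * f ![X, a, b] ^ 2 =
      inner ℝ (P a) (P a) * inner ℝ (P b) (P b) - inner ℝ (P a) (P b) ^ 2 := by
  obtain ⟨u, w, huw⟩ := exists_form_ne_zero hf hX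
  have hPX : P X = 0 := (hP X).2 ⟨1, (one_smul ℝ X).symm⟩
  have hω : ∀ (v : R3) (c : ℝ), f ![X, v, c • X] = 0 := by
    intro v c
    rw [form_smul_right, form_swap12, form_self_left, neg_zero, mul_zero]
  set G := inner ℝ (P u) (P u) * inner ℝ (P w) (P w) - inner ℝ (P u) (P w) ^ 2
  have hu : 0 < inner ℝ (P u) (P u) := by
    refine real_inner_self_pos.2 fun h => huw ?_
    obtain ⟨c, hc⟩ := (hP u).1 h
    rw [form_swap12, hc, hω, neg_zero]
  -- The vector `v` is the Gram–Schmidt correction of `w` against `u`; its squared length is a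
  -- positive multiple of the Gram determinant `G`, and nondegeneracy of the form makes its
  -- projection nonzero.
  have hG : 0 < G := by
    set v := inner ℝ (P u) (P u) • w - inner ℝ (P u) (P w) • u
    have hv : P v ≠ 0 := by
      intro h
      obtain ⟨c, hc⟩ := (hP v).1 h
      have h1 := hω u c
      rw [← hc] at h1
      have h2 : f ![X, u, v] = inner ℝ (P u) (P u) * f ![X, u, w] := by
        have : v = inner ℝ (P u) (P u) • w + (-inner ℝ (P u) (P w)) • u := by
          rw [neg_smul, ← sub_eq_add_neg]
        rw [this, form_add_right, form_smul_right, form_smul_right, form_self_right, mul_zero,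
          add_zero]
      rw [h1] at h2
      exact huw ((mul_eq_zero.1 h2.symm).resolve_left hu.ne')
    have h1 : inner ℝ (P v) (P v) = inner ℝ (P u) (P u) * G := by
      simp only [v, map_sub, map_smul, inner_sub_left, inner_sub_right, real_inner_smul_left,
        real_inner_smul_right, real_inner_comm (P u) (P w), G]
      ring
    exact (mul_pos_iff_of_pos_left hu).1 (h1 ▸ real_inner_self_pos.2 hv)
  have hω0 : 0 < f ![X, u, w] ^ 2 := by positivity
  refine ⟨√(G / f ![X, u, w] ^ 2), Real.sqrt_pos.2 (div_pos hG hω0), fun a b => ?_⟩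
  rw [Real.sq_sqrt (div_pos hG hω0).le, div_mul_eq_mul_div, div_eq_iff hω0.ne']
  -- Modulo `X` every vector is a combination of `u` and `w`. The Gram determinant and the squared
  -- area form of a pair both scale by the squared determinant of its coefficients, so their ratio
  -- is the one found on `u`, `w`.
  have hx : ∀ c d, f ![X, u, w] ^ 2 * inner ℝ (P c) (P d) =
      f ![X, u, c] * f ![X, u, d] * inner ℝ (P w) (P w) -
      f ![X, u, c] * f ![X, w, d] * inner ℝ (P u) (P w) -
      f ![X, w, c] * f ![X, u, d] * inner ℝ (P u) (P w) +
      f ![X, w, c] * f ![X, w, d] * inner ℝ (P u) (P u) := by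
    intro c d
    have h1 := form_smul_map (f := f) hPX u w c
    have h2 := form_smul_map (f := f) hPX u w d
    have h3 : inner ℝ (f ![X, u, w] • P c) (f ![X, u, w] • P d) =
      f ![X, u, w] ^ 2 * inner ℝ (P c) (P d) := by
      rw [real_inner_smul_left, real_inner_smul_right]
      ring
    rw [← h3, h1, h2]
    simp only [inner_sub_left, inner_sub_right, real_inner_smul_left, real_inner_smul_right,
      real_inner_comm (P u) (P w)]
    ring
  have hab : f ![X, u, w] * f ![X, a, b] =
      f ![X, u, a] * f ![X, w, b] - f ![X, w, a] * f ![X, u, b] := by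
    have h := congrArg (fun z => f ![X, b, z]) (form_cramer f X u w a)
    have e : f ![u, w, a] • X - f ![X, w, a] • u + f ![X, u, a] • w - f ![X, u, w] • a =
        f ![u, w, a] • X + (-f ![X, w, a]) • u + f ![X, u, a] • w + (-f ![X, u, w]) • a := by
      rw [neg_smul, neg_smul, ← sub_eq_add_neg, ← sub_eq_add_neg]
    have h0 := hω b 0
    rw [zero_smul] at h0
    simp only [e, h0, form_add_right, form_smul_right] at h
    rw [form_swap12 f X X b, form_self_left, form_swap12 f X u b, form_swap12 f X w b,
      form_swap12 f X a b] at h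
    linear_combination h
  have haa := hx a a
  have hbb := hx b b
  have hab' := hx a b
  refine mul_left_cancel₀ hω0.ne' ?_
  set R := f ![X, u, a] * f ![X, w, b] - f ![X, w, a] * f ![X, u, b]
  linear_combination G * (f ![X, u, w] * f ![X, a, b] + R) * hab -
    f ![X, u, w] ^ 2 * inner ℝ (P b) (P b) * haa -
    (f ![X, u, a] * f ![X, u, a] * inner ℝ (P w) (P w) -
      f ![X, u, a] * f ![X, w, a] * inner ℝ (P u) (P w) -
      f ![X, w, a] * f ![X, u, a] * inner ℝ (P u) (P w) +
      f ![X, w, a] * f ![X, w, a] * inner ℝ (P u) (P u)) * hbb +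
    (f ![X, u, w] ^ 2 * inner ℝ (P a) (P b) +
      (f ![X, u, a] * f ![X, u, b] * inner ℝ (P w) (P w) -
      f ![X, u, a] * f ![X, w, b] * inner ℝ (P u) (P w) -
      f ![X, w, a] * f ![X, u, b] * inner ℝ (P u) (P w) +
      f ![X, w, a] * f ![X, w, b] * inner ℝ (P u) (P u))) * hab'

theorem conformal_factor_eq {k : ℝ} (hk0 : 0 < k) {a b : R3} (hk : k ^ 2 * f ![X, a, b] ^ 2 =
      inner ℝ (P a) (P a) * inner ℝ (P b) (P b) - inner ℝ (P a) (P b) ^ 2)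
    (h : f ![X, a, b] ≠ 0) :
    √((inner ℝ (P a) (P a) * inner ℝ (P b) (P b) - inner ℝ (P a) (P b) ^ 2) /
      f ![X, a, b] ^ 2) = k := by
  rw [← hk, mul_div_cancel_right₀ _ (pow_ne_zero 2 h), Real.sqrt_sq hk0.le]

/-- The hermitian form on the normal space. -/
def hermitian (f : R3 [⋀^Fin 3]→L[ℝ] ℝ) (X : R3) (P : R3 →ₗ[ℝ] V) (k : ℝ) (v w : R3) : ℂ :=
  ⟨inner ℝ (P v) (P w), k * f ![X, v, w]⟩

/-- On a complex line, `h(u, v) h(v, w) = h(u, w) |v|²`; this expresses that the metric and `k`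
times the area form make the normal space a hermitian line. The real part is the polarization of
`hk`, the imaginary part is Cramer's relation. -/
theorem hermitian_mul (hPX : P X = 0) {k : ℝ} (hk : ∀ a b, k ^ 2 * f ![X, a, b] ^ 2 =
      inner ℝ (P a) (P a) * inner ℝ (P b) (P b) - inner ℝ (P a) (P b) ^ 2) (u v w : R3) :
    hermitian f X P k u v * hermitian f X P k v w =
      hermitian f X P k u w * (inner ℝ (P v) (P v) : ℝ) := by
  have h1 := hk v u
  have h2 := hk v w
  have h3 := hk v (u + w)
  rw [form_add_right, map_add, inner_add_left, inner_add_right, inner_add_right, inner_add_right,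
    real_inner_comm (P u) (P w)] at h3
  have h4 := congrArg (fun z => inner ℝ (P v) z) (form_smul_map (f := f) hPX u w v)
  simp only [inner_sub_right, inner_smul_right] at h4
  rw [form_swap12 f X v w] at h4
  rw [form_swap12 f X u v] at h1 h3
  apply Complex.ext
  · simp only [hermitian, Complex.mul_re, Complex.ofReal_re, Complex.ofReal_im,
      real_inner_comm (P v) (P u)] at *
    linear_combination (h3 - h1 - h2) / 2
  · simp only [hermitian, Complex.mul_im, Complex.ofReal_re, Complex.ofReal_im,
      real_inner_comm (P v) (P u)] at *
    linear_combination (-k) * h4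

theorem hermitian_swap (k : ℝ) (v w : R3) :
    hermitian f X P k w v = (starRingEnd ℂ) (hermitian f X P k v w) := by
  apply Complex.ext
  · simp [hermitian, real_inner_comm]
  · simp [hermitian, form_swap12 f X v w]

/-- The unit complex number that changes the normal coordinates from `e'` to `e`. -/
def normalTransition (f : R3 [⋀^Fin 3]→L[ℝ] ℝ) (X : R3) (P : R3 →ₗ[ℝ] V) (k : ℝ) (e e' : R3) : ℂ :=
  hermitian f X P k e e' / ((‖P e‖ * ‖P e'‖ : ℝ) : ℂ)

/-- The coordinates on the normal space for which `e` has the direction of the real axis. -/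
def normalCoord (f : R3 [⋀^Fin 3]→L[ℝ] ℝ) (X : R3) (P : R3 →ₗ[ℝ] V) (k : ℝ) (e v : R3) : ℂ :=
  hermitian f X P k e v / ((‖P e‖ * √k : ℝ) : ℂ)

theorem normalCoord_add (k : ℝ) (e v w : R3) : normalCoord f X P k e (v + w) =
    normalCoord f X P k e v + normalCoord f X P k e w := by
  rw [normalCoord, normalCoord, normalCoord, ← add_div]
  congr 1
  apply Complex.ext
  · simp [hermitian, inner_add_right]
  · simp [hermitian, form_add_right, mul_add]

theorem normalCoord_smul (k : ℝ) (e v : R3) (c : ℝ) : normalCoord f X P k e (c • v) =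
    c * normalCoord f X P k e v := by
  rw [normalCoord, normalCoord, ← mul_div_assoc]
  congr 1
  apply Complex.ext
  · simp [hermitian, inner_smul_right]
  · simp [hermitian, form_smul_right, mul_left_comm]

/-- Unit-length coordinates would give the metric area, which is `k` times the area form. The
divisor `√k` in `normalCoord` removes this factor. -/
theorem normalCoord_area (hPX : P X = 0) {k : ℝ} (hk : 0 < k) {e : R3} (he : P e ≠ 0) (v w : R3) :
    (normalCoord f X P k e v).re * (normalCoord f X P k e w).im -
      (normalCoord f X P k e v).im * (normalCoord f X P k e w).re = f ![X, v, w] := by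
  have h := congrArg (fun z => inner ℝ (P e) z) (form_smul_map (f := f) hPX v w e)
  simp only [inner_sub_right, inner_smul_right] at h
  rw [form_swap12 f X e v, form_swap12 f X e w, real_inner_self_eq_norm_sq] at h
  have hn : ‖P e‖ ≠ 0 := norm_ne_zero_iff.2 he
  have hs : √k ≠ 0 := (Real.sqrt_pos.2 hk).ne'
  have hs2 := Real.sq_sqrt hk.le
  simp only [normalCoord, Complex.div_ofReal_re, Complex.div_ofReal_im, hermitian]
  field_simp
  rw [hs2]
  linear_combination (-k) * h

theorem normalTransition_mul_normalCoord (hPX : P X = 0) {k : ℝ}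
    (hk : ∀ a b, k ^ 2 * f ![X, a, b] ^ 2 =
      inner ℝ (P a) (P a) * inner ℝ (P b) (P b) - inner ℝ (P a) (P b) ^ 2)
    {e e' : R3} (he' : P e' ≠ 0) (v : R3) :
    normalTransition f X P k e e' * normalCoord f X P k e' v = normalCoord f X P k e v := by
  have h := hermitian_mul hPX hk e e' v
  have hn : (‖P e'‖ : ℂ) ≠ 0 := by exact_mod_cast norm_ne_zero_iff.2 he'
  rw [normalTransition, normalCoord, normalCoord, div_mul_div_comm, h, real_inner_self_eq_norm_sq]
  push_cast
  rw [show (‖P e‖ : ℂ) * ‖P e'‖ * (‖P e'‖ * (√k : ℂ)) = ‖P e‖ * (√k : ℂ) * ‖P e'‖ ^ 2 by ring,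
    mul_div_mul_right _ _ (pow_ne_zero 2 hn)]

theorem normalTransition_mul (hPX : P X = 0) {k : ℝ}
    (hk : ∀ a b, k ^ 2 * f ![X, a, b] ^ 2 =
      inner ℝ (P a) (P a) * inner ℝ (P b) (P b) - inner ℝ (P a) (P b) ^ 2)
    {e e' e'' : R3} (he' : P e' ≠ 0) :
    normalTransition f X P k e e' * normalTransition f X P k e' e'' =
      normalTransition f X P k e e'' := by
  have h := hermitian_mul hPX hk e e' e''
  have hn : (‖P e'‖ : ℂ) ≠ 0 := by exact_mod_cast norm_ne_zero_iff.2 he'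
  rw [normalTransition, normalTransition, normalTransition, div_mul_div_comm, h,
    real_inner_self_eq_norm_sq]
  push_cast
  rw [show (‖P e‖ : ℂ) * ‖P e'‖ * (‖P e'‖ * ‖P e''‖) = ‖P e‖ * ‖P e''‖ * ‖P e'‖ ^ 2 by ring,
    mul_div_mul_right _ _ (pow_ne_zero 2 hn)]

theorem norm_normalTransition (hPX : P X = 0) {k : ℝ}
    (hk : ∀ a b, k ^ 2 * f ![X, a, b] ^ 2 =
      inner ℝ (P a) (P a) * inner ℝ (P b) (P b) - inner ℝ (P a) (P b) ^ 2)
    {e e' : R3} (he : P e ≠ 0) (he' : P e' ≠ 0) : ‖normalTransition f X P k e e'‖ = 1 := by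
  have h := hermitian_mul hPX hk e e' e
  rw [hermitian_swap k e e', Complex.mul_conj] at h
  have h0 : hermitian f X P k e e = ((‖P e‖ ^ 2 : ℝ) : ℂ) := by
    apply Complex.ext
    · change inner ℝ (P e) (P e) = _
      rw [Complex.ofReal_re, real_inner_self_eq_norm_sq]
    · rw [Complex.ofReal_im]
      change k * f ![X, e, e] = 0
      rw [form_self_right, mul_zero]
  rw [h0, real_inner_self_eq_norm_sq, ← Complex.ofReal_mul, Complex.ofReal_inj,
    Complex.normSq_eq_norm_sq, ← mul_pow] at h
  have hn : 0 < ‖P e‖ * ‖P e'‖ := mul_pos (norm_pos_iff.2 he) (norm_pos_iff.2 he')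
  rw [normalTransition, norm_div, Complex.norm_real, Real.norm_of_nonneg hn.le,
    (pow_left_inj₀ (norm_nonneg _) hn.le two_ne_zero).1 h, div_self hn.ne']

/-- The transition function, as a point of the circle. -/
def circleTransition (f : R3 [⋀^Fin 3]→L[ℝ] ℝ) (X : R3) (P : R3 →ₗ[ℝ] V) (k : ℝ) (e e' : R3) :
    Circle :=
  Circle.exp (Complex.arg (normalTransition f X P k e e'))

theorem coe_circleTransition (hPX : P X = 0) {k : ℝ}
    (hk : ∀ a b, k ^ 2 * f ![X, a, b] ^ 2 =
      inner ℝ (P a) (P a) * inner ℝ (P b) (P b) - inner ℝ (P a) (P b) ^ 2)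
    {e e' : R3} (he : P e ≠ 0) (he' : P e' ≠ 0) :
    (circleTransition f X P k e e' : ℂ) = normalTransition f X P k e e' := by
  have h := norm_normalTransition hPX hk he he'
  have h1 := Complex.norm_mul_exp_arg_mul_I (normalTransition f X P k e e')
  rw [h, Complex.ofReal_one, one_mul] at h1
  rw [circleTransition, Circle.coe_exp, h1]

/-- The component of `D v` orthogonal to `D X`. -/
def normalProj (D : R3 →ₗ[ℝ] V) (X : R3) : R3 →ₗ[ℝ] V where
  toFun v := D v - (inner ℝ (D X) (D v) / inner ℝ (D X) (D X)) • D X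
  map_add' v w := by
    simp only [map_add, inner_add_right, add_div, add_smul]
    abel
  map_smul' c v := by
    simp only [map_smul, inner_smul_right, smul_sub, smul_smul, mul_div_assoc, RingHom.id_apply]

theorem normalProj_eq_zero_iff {D : R3 →ₗ[ℝ] V} (hD : Function.Injective D) (hX : X ≠ 0) (v : R3) :
    normalProj D X v = 0 ↔ ∃ c : ℝ, v = c • X := by
  have hDX : inner ℝ (D X) (D X) ≠ 0 := by
    rw [inner_self_ne_zero, Ne, ← map_zero D, hD.eq_iff]
    exact hX
  constructor
  · intro h
    refine ⟨inner ℝ (D X) (D v) / inner ℝ (D X) (D X), hD ?_⟩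
    rw [map_smul]
    exact sub_eq_zero.1 h
  · rintro ⟨c, rfl⟩
    change D (c • X) - _ • D X = 0
    rw [map_smul, inner_smul_right, mul_div_cancel_right₀ _ hDX, sub_self]

end NormalAlgebra

/-! ### Existence of normal trivializations -/

section Trivialization

variable {M : Type u} [TopologicalSpace M] [ChartedSpace R3 M]

/-- The vector field near `p` with constant coordinates `c` in the chart at `p`. -/
def constField (p : M) (c : R3) (x : M) : TangentSpace (𝓡 3) x :=
  Function.invFun (mfderiv (𝓡 3) 𝓘(ℝ, R3) (chartAt R3 p) x : R3 → R3) c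

variable [IsManifold (𝓡 3) ∞ M]

theorem coord_constField {p x : M} (hx : x ∈ (chartAt R3 p).source) (c : R3) :
    coord p ⟨x, constField p c x⟩ = c :=
  Function.rightInverse_invFun ((mdifferentiable_chart (I := 𝓡 3) p).mfderiv_surjective hx) c

theorem constField_coord {p x : M} (hx : x ∈ (chartAt R3 p).source) (v : TangentSpace (𝓡 3) x) :
    constField p (coord p ⟨x, v⟩) x = v :=
  coord_injective hx (coord_constField hx _)

theorem continuousAt_constField {Y : Type*} [TopologicalSpace Y] {b : Y → M} {y : Y}
    (hb : ContinuousAt b y) {p : M} (hp : b y ∈ (chartAt R3 p).source) (c : R3) :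
    ContinuousAt (fun z => (⟨b z, constField p c (b z)⟩ : TangentBundle (𝓡 3) M)) y := by
  refine (continuousAt_tangentBundle_iff (p := p) hp).2 ⟨hb, ?_⟩
  refine ContinuousAt.congr (f := fun _ => c) continuousAt_const ?_
  filter_upwards [hb.eventually_mem ((chartAt R3 p).open_source.mem_nhds hp)] with z hz
  exact (coord_constField hz c).symm

/-- A Whitney embedding provides a continuous metric on the tangent bundle. The normal space is then
modelled as the part of the image of the tangent space orthogonal to the image of the field. -/
theorem exists_immersion (M : Type u) [TopologicalSpace M] [ChartedSpace R3 M]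
    [IsManifold (𝓡 3) ∞ M] [T2Space M] [CompactSpace M] :
    ∃ (n : ℕ) (D : ∀ x : M, TangentSpace (𝓡 3) x →ₗ[ℝ] EuclideanSpace ℝ (Fin n)),
      (∀ x, Function.Injective (D x)) ∧
      Continuous fun v : TangentBundle (𝓡 3) M => D v.1 v.2 := by
  obtain ⟨n, e, he, -, hinj⟩ := exists_embedding_euclidean_of_compact (I := 𝓡 3) (M := M)
  refine ⟨n, fun x => (mfderiv (𝓡 3) 𝓘(ℝ, EuclideanSpace ℝ (Fin n)) e x).toLinearMap, hinj, ?_⟩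
  have h := he.continuous_tangentMap (by simp)
  exact continuous_snd.comp ((tangentBundleModelSpaceHomeomorph
    𝓘(ℝ, EuclideanSpace ℝ (Fin n))).continuous.comp h)

variable {n : ℕ} {D : ∀ x : M, TangentSpace (𝓡 3) x →ₗ[ℝ] EuclideanSpace ℝ (Fin n)}

theorem continuous_normalProj (hD : ∀ x, Function.Injective (D x))
    (hDc : Continuous fun v : TangentBundle (𝓡 3) M => D v.1 v.2) {X : C1VectorField M}
    (hX : ∀ x, X x ≠ 0) :
    Continuous fun v : TangentBundle (𝓡 3) M => normalProj (D v.1) (X v.1) v.2 := by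
  have h1 : Continuous fun v : TangentBundle (𝓡 3) M => D v.1 (X v.1) :=
    hDc.comp (continuous_eval_field.comp (continuous_const.prodMk continuous_proj))
  have h2 : ∀ v : TangentBundle (𝓡 3) M, inner ℝ (D v.1 (X v.1)) (D v.1 (X v.1)) ≠ 0 := by
    intro v
    rw [inner_self_ne_zero]
    exact fun h => hX v.1 (hD v.1 (h.trans (map_zero (D v.1)).symm))
  exact hDc.sub (((h1.inner hDc).div (h1.inner h1) h2).smul h1)

theorem surjective_of_area {μ : VolumeForm M} {X : C1VectorField M} (hX : ∀ x, X x ≠ 0) {x : M}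
    {τ : TangentSpace (𝓡 3) x →ₗ[ℝ] (Fin 2 → ℝ)}
    (h : ∀ v w : TangentSpace (𝓡 3) x,
      τ v 0 * τ w 1 - τ v 1 * τ w 0 = μ.toFun x ![X x, v, w]) : Function.Surjective τ := by
  obtain ⟨v, w, hvw⟩ : ∃ v w : TangentSpace (𝓡 3) x, μ.toFun x ![X x, v, w] ≠ 0 :=
    exists_form_ne_zero (f := μ.toFun x) (X := X x) (μ.ne_zero x) (hX x)
  rw [← h] at hvw
  intro z
  set d := τ v 0 * τ w 1 - τ v 1 * τ w 0
  refine ⟨((z 0 * τ w 1 - z 1 * τ w 0) / d) • v + ((τ v 0 * z 1 - τ v 1 * z 0) / d) • w, ?_⟩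
  rw [map_add, map_smul, map_smul]
  funext i
  fin_cases i
  · simp only [Fin.zero_eta, Pi.add_apply, Pi.smul_apply, smul_eq_mul]
    field_simp
    ring
  · simp only [Fin.mk_one, Pi.add_apply, Pi.smul_apply, smul_eq_mul]
    field_simp
    ring

/-- The area condition already determines the other properties: contraction of a nonzero 3-form with
`X` is nondegenerate modulo `X`, which forces surjectivity and fixes the kernel. -/
theorem isNormalTrivialization_of_area {μ : VolumeForm M} {X : C1VectorField M}
    (hX : ∀ x, X x ≠ 0) {τ : ∀ x : M, TangentSpace (𝓡 3) x →ₗ[ℝ] (Fin 2 → ℝ)}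
    (hc : Continuous fun v : TangentBundle (𝓡 3) M => τ v.1 v.2)
    (h : ∀ x (v w : TangentSpace (𝓡 3) x),
      τ x v 0 * τ x w 1 - τ x v 1 * τ x w 0 = μ.toFun x ![X x, v, w]) :
    IsNormalTrivialization μ X τ := by
  have hs : ∀ x, Function.Surjective (τ x) := fun x => surjective_of_area hX (h x)
  refine ⟨hc, hs, fun x => ?_, h⟩
  have key : ∀ v : TangentSpace (𝓡 3) x, τ x v = 0 ↔ ∀ w : TangentSpace (𝓡 3) x,
      μ.toFun x ![X x, v, w] = 0 := by
    intro v
    constructor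
    · intro hv w
      rw [← h, hv]
      simp
    · intro hv
      obtain ⟨a, ha⟩ := hs x ![1, 0]
      obtain ⟨b, hb⟩ := hs x ![0, 1]
      have h1 := (h x v a).trans (hv a)
      have h2 := (h x v b).trans (hv b)
      rw [ha] at h1
      rw [hb] at h2
      funext i
      fin_cases i
      · simpa using h2
      · simpa using h1
  ext v
  rw [LinearMap.mem_ker, key, Submodule.mem_span_singleton]
  constructor
  · intro hv
    obtain ⟨c, hc⟩ := eq_smul_of_form_eq_zero (f := μ.toFun x) (X := X x) (v := v) (μ.ne_zero x)
      (hX x) hv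
    exact ⟨c, hc.symm⟩
  · rintro ⟨c, rfl⟩ w
    exact form_smul_left_eq_zero (μ.toFun x) (X x) w c

theorem continuousAt_complex_mk {Y : Type*} [TopologicalSpace Y] {a b : Y → ℝ} {y : Y}
    (ha : ContinuousAt a y) (hb : ContinuousAt b y) :
    ContinuousAt (fun z => (⟨a z, b z⟩ : ℂ)) y :=
  ContinuousAt.comp (g := Complex.equivRealProdCLM.symm) (f := fun z => (a z, b z))
    Complex.equivRealProdCLM.symm.continuous.continuousAt (ha.prodMk hb)

theorem continuousAt_normalProj (hD : ∀ x, Function.Injective (D x))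
    (hDc : Continuous fun v : TangentBundle (𝓡 3) M => D v.1 v.2) {X : C1VectorField M}
    (hX : ∀ x, X x ≠ 0) {Y : Type*} [TopologicalSpace Y] {b : Y → M}
    {u : ∀ y, TangentSpace (𝓡 3) (b y)} {y : Y}
    (h : ContinuousAt (fun y => (⟨b y, u y⟩ : TangentBundle (𝓡 3) M)) y) :
    ContinuousAt (fun y => normalProj (D (b y)) (X (b y)) (u y)) y :=
  ContinuousAt.comp (g := fun v : TangentBundle (𝓡 3) M => normalProj (D v.1) (X v.1) v.2)
    (continuous_normalProj hD hDc hX).continuousAt h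

theorem continuousAt_areaForm (μ : VolumeForm M) (X : C1VectorField M) {Y : Type*}
    [TopologicalSpace Y] {b : Y → M} {u v : ∀ y, TangentSpace (𝓡 3) (b y)} {y : Y}
    (hu : ContinuousAt (fun y => (⟨b y, u y⟩ : TangentBundle (𝓡 3) M)) y)
    (hv : ContinuousAt (fun y => (⟨b y, v y⟩ : TangentBundle (𝓡 3) M)) y) :
    ContinuousAt (fun y => μ.toFun (b y) ![X (b y), u y, v y]) y := by
  refine continuousAt_form μ fun i => ?_
  fin_cases i
  · exact ContinuousAt.comp (g := fun z : M => (⟨z, X z⟩ : TangentBundle (𝓡 3) M))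
      (continuous_eval_field.comp (Continuous.prodMk_right X)).continuousAt
      (continuous_proj.continuousAt.comp hu)
  · exact hu
  · exact hv

/-- A continuous metric on the normal bundle, together with the quotient `k` of its area form and
the area form of the volume form. -/
theorem exists_normal_metric [T2Space M] [CompactSpace M] (μ : VolumeForm M) {X : C1VectorField M}
    (hX : ∀ x, X x ≠ 0) :
    ∃ (n : ℕ) (P : M → R3 →ₗ[ℝ] EuclideanSpace ℝ (Fin n)) (k : M → ℝ),
      (∀ x (v : R3), P x v = 0 ↔ ∃ c : ℝ, v = c • (X x : R3)) ∧
      (Continuous fun v : TangentBundle (𝓡 3) M => P v.1 v.2) ∧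
      Continuous k ∧ (∀ x, 0 < k x) ∧
      ∀ x (a b : R3), k x ^ 2 * (μ.toFun x : R3 [⋀^Fin 3]→L[ℝ] ℝ) ![X x, a, b] ^ 2 =
        inner ℝ (P x a) (P x a) * inner ℝ (P x b) (P x b) - inner ℝ (P x a) (P x b) ^ 2 := by
  obtain ⟨n, D, hD, hDc⟩ := exists_immersion M
  have hPX : ∀ x (v : R3), normalProj (D x) (X x) v = 0 ↔ ∃ c : ℝ, v = c • (X x : R3) :=
    fun x v => normalProj_eq_zero_iff (hD x) (hX x) v
  choose k hk0 hk using fun x => exists_conformal_factor (f := μ.toFun x) (X := X x)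
    (P := normalProj (D x) (X x)) (μ.ne_zero x) (hX x) (hPX x)
  refine ⟨n, fun x => normalProj (D x) (X x), k, hPX, continuous_normalProj hD hDc hX,
    continuous_iff_continuousAt.2 fun p => ?_, hk0, hk⟩
  obtain ⟨v, w, hvw⟩ := exists_form_ne_zero (f := μ.toFun p) (X := X p) (μ.ne_zero p) (hX p)
  have hp := mem_chart_source R3 p
  have hv := continuousAt_constField (continuousAt_id (x := p)) hp (coord p ⟨p, v⟩)
  have hw := continuousAt_constField (continuousAt_id (x := p)) hp (coord p ⟨p, w⟩)
  have ha : constField p (coord p ⟨p, v⟩) p = v := constField_coord hp v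
  have hb : constField p (coord p ⟨p, w⟩) p = w := constField_coord hp w
  have hω := continuousAt_areaForm μ X hv hw
  have hPv := continuousAt_normalProj hD hDc hX hv
  have hPw := continuousAt_normalProj hD hDc hX hw
  have hne : μ.toFun p ![X p, constField p (coord p ⟨p, v⟩) p,
      constField p (coord p ⟨p, w⟩) p] ≠ 0 := by rw [ha, hb]; exact hvw
  -- Near `p`, `k` is the quotient of the two areas of a frame with constant chart coordinates, and
  -- such a quotient is continuous where the form does not vanish on the frame.
  refine ContinuousAt.congr ((((hPv.inner hPv).mul (hPw.inner hPw)).sub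
    ((hPv.inner hPw).pow 2)).div (hω.pow 2) (pow_ne_zero 2 hne)).sqrt ?_
  filter_upwards [hω.eventually_ne hne] with x hx
  exact conformal_factor_eq (hk0 x) (hk x _ _) hx

/-- Normal coordinates over the sets of a finite cover, with unitary transition functions. -/
theorem exists_local_normalCoord [T2Space M] [CompactSpace M] (μ : VolumeForm M)
    {X : C1VectorField M} (hX : ∀ x, X x ≠ 0) :
    ∃ (t : Finset M) (U : M → Set M) (g : M → M → M → Circle)
      (l : M → ∀ x : M, TangentSpace (𝓡 3) x →ₗ[ℝ] ℂ),
      (∀ p, IsOpen (U p)) ∧ ⋃ p : t, U p = univ ∧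
      (∀ p q, ContinuousOn (g p q) (U p ∩ U q)) ∧
      (∀ p q r, ∀ x ∈ U p ∩ U q ∩ U r, g p q x * g q r x = g p r x) ∧
      (∀ p, ∀ v : TangentBundle (𝓡 3) M, v.1 ∈ U p →
        ContinuousAt (fun v : TangentBundle (𝓡 3) M => l p v.1 v.2) v) ∧
      (∀ p, ∀ x ∈ U p, ∀ v w : TangentSpace (𝓡 3) x,
        (l p x v).re * (l p x w).im - (l p x v).im * (l p x w).re = μ.toFun x ![X x, v, w]) ∧
      ∀ p q, ∀ x ∈ U p ∩ U q, ∀ v, g p q x * l q x v = l p x v := by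
  obtain ⟨n, P, k, hP, hPc, hkc, hk0, hk⟩ := exists_normal_metric μ hX
  have hPX : ∀ x, P x (X x) = 0 := fun x => (hP x _).2 ⟨1, (one_smul ℝ (X x : R3)).symm⟩
  set f : M → R3 [⋀^Fin 3]→L[ℝ] ℝ := fun x => μ.toFun x
  have hc : ∀ p : M, ∃ v : TangentSpace (𝓡 3) p, P p v ≠ 0 := by
    intro p
    obtain ⟨v, w, hvw⟩ := exists_form_ne_zero (f := f p) (X := X p) (μ.ne_zero p) (hX p)
    refine ⟨v, fun h => hvw ?_⟩
    obtain ⟨c, hc⟩ := (hP p v).1 h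
    rw [hc]
    exact form_smul_left_eq_zero (f p) (X p) w c
  choose c hc using hc
  set e : M → M → R3 := fun p x => constField p (coord p ⟨p, c p⟩) x with he
  have hec : ∀ p, ∀ {Y : Type u} [TopologicalSpace Y] {b : Y → M} {y : Y}, ContinuousAt b y →
      b y ∈ (chartAt R3 p).source →
      ContinuousAt (fun y => (⟨b y, e p (b y)⟩ : TangentBundle (𝓡 3) M)) y :=
    fun p {Y} _ {b} {y} hb hy => continuousAt_constField hb hy _
  have hPe : ∀ p, ∀ {Y : Type u} [TopologicalSpace Y] {b : Y → M} {y : Y}, ContinuousAt b y →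
      b y ∈ (chartAt R3 p).source → ContinuousAt (fun y => P (b y) (e p (b y))) y :=
    fun p {Y} _ {b} {y} hb hy =>
      ContinuousAt.comp (g := fun v : TangentBundle (𝓡 3) M => P v.1 v.2)
        hPc.continuousAt (hec p hb hy)
  have hherm : ∀ p, ∀ {Y : Type u} [TopologicalSpace Y] {b : Y → M}
      {u : ∀ y, TangentSpace (𝓡 3) (b y)} {y : Y},
      ContinuousAt (fun y => (⟨b y, u y⟩ : TangentBundle (𝓡 3) M)) y →
      b y ∈ (chartAt R3 p).source → ContinuousAt (fun y =>
        hermitian (f (b y)) (X (b y)) (P (b y)) (k (b y)) (e p (b y)) (u y)) y := by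
    intro p Y _ b u y hu hy
    have hb : ContinuousAt b y := continuous_proj.continuousAt.comp hu
    have hPu : ContinuousAt (fun y => P (b y) (u y)) y :=
      ContinuousAt.comp (g := fun v : TangentBundle (𝓡 3) M => P v.1 v.2) hPc.continuousAt hu
    exact continuousAt_complex_mk ((hPe p hb hy).inner hPu)
      ((hkc.continuousAt.comp hb).mul (continuousAt_areaForm μ X (hec p hb hy) hu))
  -- On `U p` the reference vector `e p` has nonzero normal component, so it can serve as the
  -- direction of the real axis of the normal line.
  set U : M → Set M := fun p => {x | x ∈ (chartAt R3 p).source ∧ P x (e p x) ≠ 0}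
  have hU : ∀ p, IsOpen (U p) := by
    intro p
    rw [isOpen_iff_mem_nhds]
    intro x hx
    exact inter_mem ((chartAt R3 p).open_source.mem_nhds hx.1)
      ((hPe p continuousAt_id hx.1).eventually_ne hx.2)
  have hpU : ∀ p, p ∈ U p := by
    refine fun p => ⟨mem_chart_source R3 p, ?_⟩
    have : e p p = c p := constField_coord (mem_chart_source R3 p) _
    rw [this]
    exact hc p
  obtain ⟨t, ht⟩ := isCompact_univ.elim_finite_subcover U hU
    fun x _ => mem_iUnion.2 ⟨x, hpU x⟩
  have hne : ∀ p x, x ∈ U p → P x (e p x) ≠ 0 := fun p x hx => hx.2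
  have hg : ∀ p q x, x ∈ U p ∩ U q →
      (circleTransition (f x) (X x) (P x) (k x) (e p x) (e q x) : ℂ) =
        normalTransition (f x) (X x) (P x) (k x) (e p x) (e q x) := fun p q x hx =>
    coe_circleTransition (hPX x) (hk x) (hne p x hx.1) (hne q x hx.2)
  refine ⟨t, U, fun p q x => circleTransition (f x) (X x) (P x) (k x) (e p x) (e q x),
    fun p x =>
      { toFun := fun v => normalCoord (f x) (X x) (P x) (k x) (e p x) v
        map_add' := fun v w => normalCoord_add (f := f x) (X := X x) (P := P x) _ _ v w
        map_smul' := fun c v => normalCoord_smul (f := f x) (X := X x) (P := P x) _ _ v c },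
    hU, eq_univ_of_forall fun x => by simpa using ht (mem_univ x), ?_, ?_, ?_, ?_, ?_⟩
  · intro p q
    refine Topology.IsInducing.subtypeVal.continuousOn_iff.2 ?_
    refine ContinuousOn.congr (f := fun x =>
      normalTransition (f x) (X x) (P x) (k x) (e p x) (e q x)) (fun x hx => ?_) (hg p q)
    have h1 := hherm p (b := fun x : M => x) (u := fun x => e q x)
      (hec q continuousAt_id hx.2.1) hx.1.1
    have h2 := (hPe p continuousAt_id hx.1.1).norm
    have h3 := (hPe q continuousAt_id hx.2.1).norm
    refine (h1.div (Complex.continuous_ofReal.continuousAt.comp (h2.mul h3)) ?_).continuousWithinAt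
    exact Complex.ofReal_ne_zero.2 (mul_ne_zero (norm_ne_zero_iff.2 (hne p x hx.1))
      (norm_ne_zero_iff.2 (hne q x hx.2)))
  · intro p q r x hx
    refine Subtype.ext ?_
    rw [Circle.coe_mul, hg p q x hx.1, hg q r x ⟨hx.1.2, hx.2⟩, hg p r x ⟨hx.1.1, hx.2⟩]
    exact normalTransition_mul (hPX x) (hk x) (hne q x hx.1.2)
  · intro p v hv
    have h1 := hherm p (b := fun w : TangentBundle (𝓡 3) M => w.1)
      (u := fun w => w.2) (y := v) continuousAt_id hv.1
    have h2 := (hPe p continuous_proj.continuousAt hv.1 (y := v)).norm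
    have h3 : ContinuousAt (fun w : TangentBundle (𝓡 3) M => √(k w.1)) v :=
      (hkc.comp continuous_proj).continuousAt.sqrt
    refine h1.div (Complex.continuous_ofReal.continuousAt.comp (h2.mul h3)) ?_
    exact Complex.ofReal_ne_zero.2 (mul_ne_zero (norm_ne_zero_iff.2 (hne p v.1 hv))
      (Real.sqrt_pos.2 (hk0 v.1)).ne')
  · intro p x hx v w
    exact normalCoord_area (hPX x) (hk0 x) (hne p x hx) v w
  · intro p q x hx v
    rw [hg p q x hx]
    exact normalTransition_mul_normalCoord (hPX x) (hk x) (hne q x hx.2) v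

/-- The vanishing of `H²` kills the obstruction to trivializing the normal line bundle: the
transition functions are `ζ a / ζ b`, so the local coordinates multiplied by `(ζ a)⁻¹` agree on
overlaps. Unit complex factors rotate the coordinates and preserve area. -/
theorem exists_isNormalTrivialization [T2Space M] [CompactSpace M]
    (H : CechCohomologyVanishes M 2) (μ : VolumeForm M) {X : C1VectorField M}
    (hX : ∀ x, X x ≠ 0) : ∃ τ, IsNormalTrivialization μ X τ := by
  obtain ⟨t, U, g, l, hU, hUc, hg, hgc, hl, harea, hgl⟩ := exists_local_normalCoord μ hX
  obtain ⟨κ, V, r, ζ, hV, hVU, hζ, hζg⟩ := exists_coboundary H (U := fun i : t => U i)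
    (fun i => hU i) hUc (fun i j => hg i j) fun i j k => hgc i j k
  have hα : ∀ x, ∃ a, x ∈ V a := fun x => mem_iUnion.1 (hV.2 ▸ mem_univ x)
  choose α hα using hα
  set Λ : κ → ∀ x : M, TangentSpace (𝓡 3) x → ℂ := fun a x v =>
    ((ζ a x)⁻¹ : Circle) * l (r a) x v
  have hΛ : ∀ a b x v, x ∈ V a → x ∈ V b → Λ a x v = Λ b x v := by
    intro a b x v ha hb
    have h1 := hgl (r a) (r b) x ⟨hVU a ha, hVU b hb⟩ v
    rw [hζg a b x ⟨ha, hb⟩] at h1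
    simp only [Λ]
    rw [← h1, ← mul_assoc, ← Circle.coe_mul, div_eq_mul_inv, inv_mul_cancel_left]
  set τ : ∀ x : M, TangentSpace (𝓡 3) x →ₗ[ℝ] (Fin 2 → ℝ) := fun x =>
    { toFun := fun v => ![(Λ (α x) x v).re, (Λ (α x) x v).im]
      map_add' := by
        intro v w
        simp only [Λ, map_add, mul_add, Complex.add_re, Complex.add_im]
        funext i
        fin_cases i <;> rfl
      map_smul' := by
        intro c v
        simp only [Λ, map_smul, mul_smul_comm, Complex.smul_re, Complex.smul_im]
        funext i
        fin_cases i <;> rfl }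
  refine ⟨τ, isNormalTrivialization_of_area hX ?_ fun x v w => ?_⟩
  · rw [continuous_iff_continuousAt]
    intro v
    have hv := hα v.1
    have hn := (hV.1 (α v.1)).mem_nhds hv
    have h3 : ContinuousAt (fun w : TangentBundle (𝓡 3) M => Λ (α v.1) w.1 w.2) v :=
      ContinuousAt.mul (ContinuousAt.comp (g := fun z : Circle => (z : ℂ))
        (f := fun w : TangentBundle (𝓡 3) M => (ζ (α v.1) w.1)⁻¹)
        continuous_subtype_val.continuousAt (ContinuousAt.inv
          (ContinuousAt.comp (g := ζ (α v.1)) ((hζ _).continuousAt hn)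
            continuous_proj.continuousAt))) (hl _ v (hVU _ hv))
    have h4 : ContinuousAt (fun w : TangentBundle (𝓡 3) M =>
        ![(Λ (α v.1) w.1 w.2).re, (Λ (α v.1) w.1 w.2).im]) v := by
      refine continuousAt_pi.2 fun i => ?_
      fin_cases i
      · exact Complex.continuous_re.continuousAt.comp h3
      · exact Complex.continuous_im.continuousAt.comp h3
    refine h4.congr ?_
    filter_upwards [continuous_proj.continuousAt.preimage_mem_nhds hn] with w hw
    change _ = ![(Λ (α w.1) w.1 w.2).re, (Λ (α w.1) w.1 w.2).im]
    rw [hΛ _ _ w.1 w.2 (hα w.1) hw]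
  · rw [← harea (r (α x)) x (hVU _ (hα x)) v w]
    have h1 : Complex.normSq ((ζ (α x) x)⁻¹ : Circle) = 1 := Circle.normSq_coe _
    rw [Complex.normSq_apply] at h1
    change (Λ (α x) x v).re * (Λ (α x) x w).im - (Λ (α x) x v).im * (Λ (α x) x w).re = _
    simp only [Λ, Complex.mul_re, Complex.mul_im]
    linear_combination ((l (r (α x)) x v).re * (l (r (α x)) x w).im -
      (l (r (α x)) x v).im * (l (r (α x)) x w).re) * h1

end Trivialization

/-! ### The linearized flow in a normal trivialization -/

section LinearizedFlow

variable {M : Type u} [TopologicalSpace M] [ChartedSpace R3 M] [IsManifold (𝓡 3) ∞ M]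

theorem SL_eq_of_mulVec_eq {T : Type*} [AddCommGroup T] [Module ℝ T] {κ : T →ₗ[ℝ] (Fin 2 → ℝ)}
    (hκ : Function.Surjective κ) {A B : Matrix.SpecialLinearGroup (Fin 2) ℝ}
    (h : ∀ v, A.1.mulVec (κ v) = B.1.mulVec (κ v)) : A = B := by
  refine Subtype.ext (Matrix.ext_of_mulVec_single fun i => ?_)
  obtain ⟨v, hv⟩ := hκ (Pi.single i 1)
  rw [← hv]
  exact h v

/-- The continuous family of matrices that relates two continuous families of linear maps. -/
theorem exists_transition_matrix {Y : Type*} [TopologicalSpace Y] {b : Y → M} (hb : Continuous b)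
    {κ l : ∀ y, TangentSpace (𝓡 3) (b y) →ₗ[ℝ] (Fin 2 → ℝ)}
    (hκ : ∀ y, Function.Surjective (κ y)) (hl : ∀ y v, κ y v = 0 → l y v = 0)
    (hdet : ∀ y v w, l y v 0 * l y w 1 - l y v 1 * l y w 0 =
      κ y v 0 * κ y w 1 - κ y v 1 * κ y w 0)
    (hκc : ∀ (u : ∀ y, TangentSpace (𝓡 3) (b y)) (y₀ : Y),
      ContinuousAt (fun y => (⟨b y, u y⟩ : TangentBundle (𝓡 3) M)) y₀ →
      ContinuousAt (fun y => κ y (u y)) y₀)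
    (hlc : ∀ (u : ∀ y, TangentSpace (𝓡 3) (b y)) (y₀ : Y),
      ContinuousAt (fun y => (⟨b y, u y⟩ : TangentBundle (𝓡 3) M)) y₀ →
      ContinuousAt (fun y => l y (u y)) y₀) :
    ∃ A : Y → Matrix.SpecialLinearGroup (Fin 2) ℝ, Continuous A ∧
      ∀ y v, (A y).1.mulVec (κ y v) = l y v := by
  choose s₀ hs₀ using fun y => hκ y ![1, 0]
  choose s₁ hs₁ using fun y => hκ y ![0, 1]
  have hd : ∀ y, (!![l y (s₀ y) 0, l y (s₁ y) 0; l y (s₀ y) 1, l y (s₁ y) 1] :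
      Matrix (Fin 2) (Fin 2) ℝ).det = 1 := by
    intro y
    have h := hdet y (s₀ y) (s₁ y)
    rw [hs₀, hs₁] at h
    rw [Matrix.det_fin_two_of]
    simp only [Matrix.cons_val_zero, Matrix.cons_val_one] at h
    linarith
  set A : Y → Matrix.SpecialLinearGroup (Fin 2) ℝ := fun y => ⟨_, hd y⟩
  have hA : ∀ y v, (A y).1.mulVec (κ y v) = l y v := by
    intro y v
    have h0 : κ y (v - (κ y v 0 • s₀ y + κ y v 1 • s₁ y)) = 0 := by
      rw [map_sub, map_add, map_smul, map_smul, hs₀, hs₁]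
      funext i
      fin_cases i <;> simp
    have h1 := hl y _ h0
    rw [map_sub, map_add, map_smul, map_smul, sub_eq_zero] at h1
    rw [h1]
    funext i
    fin_cases i <;> simp [A, Matrix.mulVec, dotProduct, Fin.sum_univ_two, mul_comm]
  refine ⟨A, ?_, hA⟩
  have hent : ∀ i j, Continuous fun y => (A y).1 i j := by
    intro i j
    rw [continuous_iff_continuousAt]
    intro y₀
    have hp := mem_chart_source R3 (b y₀)
    have hu : ∀ c : R3, ContinuousAt (fun y => (⟨b y, constField (b y₀) c (b y)⟩ :
      TangentBundle (𝓡 3) M)) y₀ := fun c => continuousAt_constField hb.continuousAt hp c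
    set u : ∀ y, TangentSpace (𝓡 3) (b y) := fun y =>
      constField (b y₀) (coord (b y₀) ⟨b y₀, s₀ y₀⟩) (b y)
    set w : ∀ y, TangentSpace (𝓡 3) (b y) := fun y =>
      constField (b y₀) (coord (b y₀) ⟨b y₀, s₁ y₀⟩) (b y)
    have hκu : ∀ i, ContinuousAt (fun y => κ y (u y) i) y₀ :=
      fun i => continuousAt_pi.1 (hκc u y₀ (hu _)) i
    have hκw : ∀ i, ContinuousAt (fun y => κ y (w y) i) y₀ :=
      fun i => continuousAt_pi.1 (hκc w y₀ (hu _)) i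
    have hlu : ∀ i, ContinuousAt (fun y => l y (u y) i) y₀ :=
      fun i => continuousAt_pi.1 (hlc u y₀ (hu _)) i
    have hlw : ∀ i, ContinuousAt (fun y => l y (w y) i) y₀ :=
      fun i => continuousAt_pi.1 (hlc w y₀ (hu _)) i
    have hu0 : κ y₀ (u y₀) = ![1, 0] := by
      rw [← hs₀ y₀]
      exact congrArg (κ y₀) (constField_coord hp _)
    have hw0 : κ y₀ (w y₀) = ![0, 1] := by
      rw [← hs₁ y₀]
      exact congrArg (κ y₀) (constField_coord hp _)
    -- The chosen preimages `s₀`, `s₁` need not be continuous in `y`. The fields `u`, `w` are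
    -- continuous and coincide with them at `y₀`, so near `y₀` Cramer's rule with nonzero
    -- determinant `d` expresses the entries of `A` through continuous functions.
    set d : Y → ℝ := fun y => κ y (u y) 0 * κ y (w y) 1 - κ y (u y) 1 * κ y (w y) 0
    have hdc : ContinuousAt d y₀ := ((hκu 0).mul (hκw 1)).sub ((hκu 1).mul (hκw 0))
    have hd0 : d y₀ ≠ 0 := by simp [d, hu0, hw0]
    have hEu : ∀ y i, l y (u y) i = (A y).1 i 0 * κ y (u y) 0 + (A y).1 i 1 * κ y (u y) 1 := by
      intro y i
      rw [← hA]
      simp [Matrix.mulVec, dotProduct, Fin.sum_univ_two]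
    have hEw : ∀ y i, l y (w y) i = (A y).1 i 0 * κ y (w y) 0 + (A y).1 i 1 * κ y (w y) 1 := by
      intro y i
      rw [← hA]
      simp [Matrix.mulVec, dotProduct, Fin.sum_univ_two]
    have hev : ∀ᶠ y in 𝓝 y₀, d y ≠ 0 := hdc.eventually_ne hd0
    fin_cases j
    · refine ContinuousAt.congr (f := fun y =>
        (l y (u y) i * κ y (w y) 1 - l y (w y) i * κ y (u y) 1) / d y)
        ((((hlu i).mul (hκw 1)).sub ((hlw i).mul (hκu 1))).div hdc hd0) ?_
      filter_upwards [hev] with y hy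
      rw [div_eq_iff hy, hEu, hEw]
      simp only [d, Fin.zero_eta]
      ring
    · refine ContinuousAt.congr (f := fun y =>
        (l y (w y) i * κ y (u y) 0 - l y (u y) i * κ y (w y) 0) / d y)
        ((((hlw i).mul (hκu 0)).sub ((hlu i).mul (hκw 0))).div hdc hd0) ?_
      filter_upwards [hev] with y hy
      rw [div_eq_iff hy, hEu, hEw]
      simp only [d, Fin.mk_one]
      ring
  exact Continuous.subtype_mk (continuous_matrix hent) _

variable {μ : VolumeForm M}

theorem IsNormalTrivialization.apply_eq_zero_iff {X : C1VectorField M}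
    {τ : ∀ x : M, TangentSpace (𝓡 3) x →ₗ[ℝ] (Fin 2 → ℝ)} (hτ : IsNormalTrivialization μ X τ)
    (x : M) (v : TangentSpace (𝓡 3) x) : τ x v = 0 ↔ ∃ c : ℝ, c • X x = v := by
  rw [← LinearMap.mem_ker, hτ.ker_eq, Submodule.mem_span_singleton]

theorem IsLiftedLinearizedFlow.continuous_time {X : C1VectorField M}
    {τ : ∀ x : M, TangentSpace (𝓡 3) x →ₗ[ℝ] (Fin 2 → ℝ)} {Φ : ℝ → M → SL2Cover}
    (hΦ : IsLiftedLinearizedFlow X τ Φ) (x : M) :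
    Continuous fun t => Φ t x :=
  hΦ.continuous.comp (Continuous.prodMk_left x)

theorem IsLiftedLinearizedFlow.unique {X : C1VectorField M}
    {τ : ∀ x : M, TangentSpace (𝓡 3) x →ₗ[ℝ] (Fin 2 → ℝ)} {Φ Φ' : ℝ → M → SL2Cover}
    (hτ : IsNormalTrivialization μ X τ)
    (hΦ : IsLiftedLinearizedFlow X τ Φ) (hΦ' : IsLiftedLinearizedFlow X τ Φ') : Φ' = Φ := by
  funext t x
  refine congrFun (cover_eq_of_fst_eq (hΦ'.continuous_time x) (hΦ.continuous_time x) (fun t => ?_)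
    (y₀ := 0) ((hΦ'.zero x).trans (hΦ.zero x).symm)) t
  exact SL_eq_of_mulVec_eq (hτ.surjective x) fun v =>
    (hΦ'.linearized t x v).trans (hΦ.linearized t x v).symm

variable [T2Space M] [CompactSpace M]

/-- The linearized flows of a continuous family of vector fields, with a continuous family of normal
trivializations, have a jointly continuous lift. -/
theorem exists_isLiftedLinearizedFlow {Z : Type*} [TopologicalSpace Z] {X : Z → C1VectorField M}
    (hXc : Continuous X) (hX : ∀ z, IsVolumePreserving μ (X z))
    {τ : Z → ∀ x : M, TangentSpace (𝓡 3) x →ₗ[ℝ] (Fin 2 → ℝ)}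
    (hτ : ∀ z, IsNormalTrivialization μ (X z) (τ z))
    (hτc : Continuous fun q : Z × TangentBundle (𝓡 3) M => τ q.1 q.2.1 q.2.2) :
    ∃ Φ : Z → ℝ → M → SL2Cover, (Continuous fun q : ℝ × Z × M => Φ q.2.1 q.1 q.2.2) ∧
      ∀ z, IsLiftedLinearizedFlow (X z) (τ z) (Φ z) := by
  set κ : ∀ q : ℝ × Z × M, TangentSpace (𝓡 3) q.2.2 →ₗ[ℝ] (Fin 2 → ℝ) := fun q => τ q.2.1 q.2.2
  set l : ∀ q : ℝ × Z × M, TangentSpace (𝓡 3) q.2.2 →ₗ[ℝ] (Fin 2 → ℝ) := fun q =>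
    (τ q.2.1 (flow (X q.2.1) q.1 q.2.2)).comp
      (mfderiv (𝓡 3) (𝓡 3) (flow (X q.2.1) q.1) q.2.2).toLinearMap
  -- The linearized flow maps `X` to `X` and preserves `ι_X μ`. It therefore descends to the normal
  -- bundle, with determinant one.
  obtain ⟨A, hA, hAl⟩ := exists_transition_matrix (b := fun q : ℝ × Z × M => q.2.2)
    continuous_snd.snd (κ := κ) (l := l) (fun q => (hτ q.2.1).surjective _) (by
      intro q v hv
      obtain ⟨c, rfl⟩ := ((hτ q.2.1).apply_eq_zero_iff _ _).1 hv
      refine ((hτ q.2.1).apply_eq_zero_iff _ _).2 ⟨c, ?_⟩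
      rw [← mfderiv_flow_apply_field]
      exact (map_smul (mfderiv (𝓡 3) (𝓡 3) (flow (X q.2.1) q.1) q.2.2) c _).symm) (by
      intro q v w
      refine ((hτ q.2.1).area _ _ _).trans (Eq.trans ?_ ((hτ q.2.1).area _ _ _).symm)
      have h := form_mfderiv_flow (hX q.2.1) q.1 q.2.2 (X q.2.1 q.2.2) v w
      rw [mfderiv_flow_apply_field] at h
      exact h) (by
      intro u q hu
      exact ContinuousAt.comp (g := fun q : Z × TangentBundle (𝓡 3) M => τ q.1 q.2.1 q.2.2)
        hτc.continuousAt (continuous_snd.fst.continuousAt.prodMk hu)) (by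
      intro u q hu
      have h1 : ContinuousAt (fun q : ℝ × Z × M => tangentMap (𝓡 3) (𝓡 3) (flow (X q.2.1) q.1)
          ⟨q.2.2, u q⟩) q :=
        ContinuousAt.comp (g := fun z : C1VectorField M × ℝ × TangentBundle (𝓡 3) M =>
          tangentMap (𝓡 3) (𝓡 3) (flow z.1 z.2.1) z.2.2) continuous_tangentMap_flow.continuousAt
          ((hXc.comp continuous_snd.fst).continuousAt.prodMk (continuous_fst.continuousAt.prodMk hu))
      exact ContinuousAt.comp (g := fun q : Z × TangentBundle (𝓡 3) M => τ q.1 q.2.1 q.2.2)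
        hτc.continuousAt (continuous_snd.fst.continuousAt.prodMk h1))
  have key : ∀ (z : Z) (x : M) (F : M → M), F = id → ∀ v : TangentSpace (𝓡 3) x,
      τ z (F x) (mfderiv (𝓡 3) (𝓡 3) F x v) = τ z x v := by
    rintro z x _ rfl v
    rw [mfderiv_id]
    rfl
  obtain ⟨f, hf, hf0, hfA⟩ := exists_cover_lift hA (by
    rintro ⟨z, x⟩
    refine SL_eq_of_mulVec_eq ((hτ z).surjective x) fun v => ?_
    refine (hAl (0, z, x) v).trans ((key z x _ (funext (flow_zero (X z))) v).trans ?_)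
    rw [Matrix.SpecialLinearGroup.coe_one, Matrix.one_mulVec])
  refine ⟨fun z t x => f (t, z, x), hf, fun z => ⟨?_, fun x => hf0 _, fun t x v => ?_⟩⟩
  · exact hf.comp (continuous_fst.prodMk (continuous_const.prodMk continuous_snd))
  · rw [hfA]
    exact hAl (t, z, x) v

/-! ### The cocycle identity and the change of trivialization -/

section Single

variable {X : C1VectorField M} {τ τ' : ∀ x : M, TangentSpace (𝓡 3) x →ₗ[ℝ] (Fin 2 → ℝ)}
  {Φ Φ' : ℝ → M → SL2Cover}

/-- For the matrices this is the chain rule. Both sides are continuous in `S` and agree at `S = 0`,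
so uniqueness of lifts carries the identity to the cover. -/
theorem IsLiftedLinearizedFlow.map_add (hτ : IsNormalTrivialization μ X τ)
    (hΦ : IsLiftedLinearizedFlow X τ Φ) (S T : ℝ) (x : M) :
    Φ (S + T) x = Φ S (flow X T x) * Φ T x := by
  refine congrFun (cover_eq_of_fst_eq (f := fun S => Φ (S + T) x)
    (g := fun S => Φ S (flow X T x) * Φ T x) ?_ ?_ (fun S => ?_) (y₀ := 0) ?_) S
  · exact (hΦ.continuous_time x).comp (continuous_id.add continuous_const)
  · exact (hΦ.continuous_time _).mul continuous_const
  · refine SL_eq_of_mulVec_eq (hτ.surjective x) fun v => ?_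
    have h1 := hΦ.linearized (S + T) x v
    have h2 := hΦ.linearized T x v
    have h3 := hΦ.linearized S (flow X T x) (mfderiv (𝓡 3) (𝓡 3) (flow X T) x v)
    have key : ∀ F G H : M → M, F = G ∘ H → MDifferentiable (𝓡 3) (𝓡 3) G →
        MDifferentiable (𝓡 3) (𝓡 3) H → τ (F x) (mfderiv (𝓡 3) (𝓡 3) F x v) =
          τ (G (H x)) (mfderiv (𝓡 3) (𝓡 3) G (H x) (mfderiv (𝓡 3) (𝓡 3) H x v)) := by
      rintro _ G H rfl hG hH
      rw [mfderiv_comp x (hG _) (hH _)]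
      rfl
    have h4 := key (flow X (S + T)) (flow X S) (flow X T) (funext (flow_add X S T))
      (mdifferentiable_flow X S) (mdifferentiable_flow X T)
    rw [h1, h4, ← h3, ← h2, Matrix.mulVec_mulVec]
    rfl
  · rw [zero_add, hΦ.zero, one_mul]

/-- The lifted linearized flows for two normal trivializations are at bounded distance. -/
theorem IsLiftedLinearizedFlow.exists_abs_angle_sub_le (H : CechCohomologyVanishes M 1)
    (hτ : IsNormalTrivialization μ X τ) (hτ' : IsNormalTrivialization μ X τ')
    (hΦ : IsLiftedLinearizedFlow X τ Φ) (hΦ' : IsLiftedLinearizedFlow X τ' Φ') :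
    ∃ C : ℝ, ∀ t x, |(Φ' t x).1.2 0 - (Φ t x).1.2 0| ≤ C := by
  have hcont : ∀ {τ : ∀ x : M, TangentSpace (𝓡 3) x →ₗ[ℝ] (Fin 2 → ℝ)},
      IsNormalTrivialization μ X τ → ∀ (u : ∀ x : M, TangentSpace (𝓡 3) x) (x₀ : M),
      ContinuousAt (fun x => (⟨x, u x⟩ : TangentBundle (𝓡 3) M)) x₀ →
      ContinuousAt (fun x => τ x (u x)) x₀ := fun {τ} hτ u x₀ hu =>
    ContinuousAt.comp (g := fun v : TangentBundle (𝓡 3) M => τ v.1 v.2)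
      hτ.continuous.continuousAt hu
  obtain ⟨g, hg, hgτ⟩ := exists_transition_matrix (b := fun x : M => x) continuous_id
    (κ := τ) (l := τ') hτ.surjective
    (fun x v h => (hτ'.apply_eq_zero_iff x v).2 ((hτ.apply_eq_zero_iff x v).1 h))
    (fun x v w => (hτ'.area x v w).trans (hτ.area x v w).symm) (hcont hτ) (hcont hτ')
  -- Here `H¹ = 0` is used: the map `g` from `M` to `SL(2, ℝ)` lifts to the universal cover as soon
  -- as its first-column direction lifts to `ℝ`.
  obtain ⟨a, ha, hag⟩ := exists_lift_circle H (continuous_firstDirection.comp hg)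
  obtain ⟨G, hG, hGg, -⟩ := exists_cover_of_angle hg ha hag
  obtain ⟨B, hB⟩ := isCompact_univ.bddAbove_image
    (continuous_angle_zero.comp hG).abs.continuousOn
  have hB' : ∀ x, |(G x).1.2 0| ≤ B := fun x => hB (mem_image_of_mem _ (mem_univ x))
  have key : ∀ t x, Φ' t x * G x = G (flow X t x) * Φ t x := by
    intro t x
    refine congrFun (cover_eq_of_fst_eq (f := fun t => Φ' t x * G x)
      (g := fun t => G (flow X t x) * Φ t x) ?_ ?_ (fun t => ?_) (y₀ := 0) ?_) t
    · exact (hΦ'.continuous_time x).mul continuous_const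
    · exact (hG.comp (continuous_flow.comp
        (continuous_const.prodMk (continuous_id.prodMk continuous_const)))).mul
        (hΦ.continuous_time x)
    · refine SL_eq_of_mulVec_eq (hτ.surjective x) fun v => ?_
      have h1 := hΦ'.linearized t x v
      have h2 := hΦ.linearized t x v
      have h3 := hgτ x v
      have h4 := hgτ (flow X t x) (mfderiv (𝓡 3) (𝓡 3) (flow X t) x v)
      rw [← hGg] at h3 h4
      rw [← h3, ← h4, ← h2, Matrix.mulVec_mulVec, Matrix.mulVec_mulVec] at h1
      exact h1
    · rw [hΦ'.zero, hΦ.zero, flow_zero, one_mul, mul_one]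
  -- From `Φ' * G = (G ∘ φ) * Φ`: one defect for each of the two products, and one bound `B` for
  -- each of the two values of `G`.
  refine ⟨2 + 2 * B, fun t x => ?_⟩
  have h1 := abs_le.1 (abs_angle_mul_sub_le (Φ' t x) (G x))
  have h2 := abs_le.1 (abs_angle_mul_sub_le (G (flow X t x)) (Φ t x))
  have h3 := abs_le.1 (hB' x)
  have h4 := abs_le.1 (hB' (flow X t x))
  rw [key] at h1
  rw [abs_le]
  constructor <;> linarith

end Single

end LinearizedFlow

/-! ### The Ruelle density and the Ruelle invariant -/

section Density

variable {M : Type u} [MeasurableSpace M]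

/-- A bounded difference contributes at most a constant times `1 / T` in `L¹` of a finite measure.
This is why neither `ρ` nor the trivialization affects the limit. -/
theorem tendsto_eLpNorm_of_abs_sub_le {m : Measure M} [IsFiniteMeasure m] {b c : ℝ → M → ℝ}
    {R : M → ℝ} {C : ℝ} (h : ∀ T x, |c T x - b T x| ≤ C)
    (hb : ∀ T, Integrable (b T) m) (hc : ∀ T, Integrable (c T) m) (hR : Integrable R m)
    (hbR : Tendsto (fun T : ℝ => eLpNorm (fun x => 1 / T * b T x - R x) 1 m) atTop (𝓝 0)) :
    Tendsto (fun T : ℝ => eLpNorm (fun x => 1 / T * c T x - R x) 1 m) atTop (𝓝 0) := by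
  have h1 : Tendsto (fun T : ℝ => m univ ^ (1 : ℝ≥0∞).toReal⁻¹ * ENNReal.ofReal (|1 / T| * C))
      atTop (𝓝 0) := by
    have h2 : Tendsto (fun T : ℝ => |1 / T| * C) atTop (𝓝 0) := by
      have h3 : Tendsto (fun T : ℝ => 1 / T) atTop (𝓝 0) := by
        simpa only [one_div] using tendsto_inv_atTop_zero (𝕜 := ℝ)
      simpa using h3.abs.mul_const C
    have h3 := ENNReal.tendsto_ofReal h2
    rw [ENNReal.ofReal_zero] at h3
    have h4 := ENNReal.Tendsto.const_mul (a := m univ ^ (1 : ℝ≥0∞).toReal⁻¹) h3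
      (Or.inr (by simp))
    rwa [mul_zero] at h4
  have h2 := hbR.add h1
  rw [add_zero] at h2
  refine tendsto_of_tendsto_of_tendsto_of_le_of_le tendsto_const_nhds h2 (fun _ => zero_le)
    fun T => ?_
  have e : (fun x => 1 / T * c T x - R x) =
      (fun x => 1 / T * b T x - R x) + fun x => 1 / T * (c T x - b T x) := by
    funext x
    simp only [Pi.add_apply]
    ring
  change eLpNorm (fun x => 1 / T * c T x - R x) 1 m ≤ _
  rw [e]
  refine (eLpNorm_add_le (((hb T).const_mul _).sub hR).1
    (((hc T).sub (hb T)).const_mul _).1 le_rfl).trans (add_le_add le_rfl ?_)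
  refine eLpNorm_le_of_ae_bound (ae_of_all _ fun x => ?_)
  rw [Real.norm_eq_abs, abs_mul]
  exact mul_le_mul_of_nonneg_left (h T x) (abs_nonneg _)

theorem integrable_of_continuous [TopologicalSpace M] [CompactSpace M] [BorelSpace M] (m : Measure M)
    [IsFiniteMeasure m] {f : M → ℝ} (hf : Continuous f) : Integrable f m :=
  memLp_one_iff_integrable.1 (ContinuousMap.memLp m ℝ ⟨f, hf⟩)

theorem continuous_integral_continuousMap [TopologicalSpace M] [CompactSpace M] [BorelSpace M]
    (m : Measure M) [IsFiniteMeasure m] : Continuous fun f : C(M, ℝ) => ∫ x, f x ∂m := by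
  have h := continuous_integral.comp (ContinuousMap.toLp (E := ℝ) 1 m ℝ).continuous
  exact h.congr fun f => integral_congr_ae (ContinuousMap.coeFn_toLp m f)

end Density

/-! ### Existence, independence of choices, and rate of convergence -/

section Ruelle

variable {M : Type u} [TopologicalSpace M] [ChartedSpace R3 M] [IsManifold (𝓡 3) ∞ M]
  {X : C1VectorField M} {μ : VolumeForm M}
  {τ τ' : ∀ x : M, TangentSpace (𝓡 3) x →ₗ[ℝ] (Fin 2 → ℝ)} {Φ Φ' : ℝ → M → SL2Cover}

theorem IsLiftedLinearizedFlow.continuous_space (hΦ : IsLiftedLinearizedFlow X τ Φ) (t : ℝ) :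
    Continuous (Φ t) :=
  hΦ.continuous.comp (continuous_const.prodMk continuous_id)

section

variable [CompactSpace M] [MeasurableSpace M] [BorelSpace M]

theorem IsRuelleDensity.tendsto_integral_angle {ρ : SL2Cover → ℝ} {ru : M → ℝ}
    (h : IsRuelleDensity μ ρ Φ' ru) (hΦ : IsLiftedLinearizedFlow X τ Φ) {C : ℝ}
    (hC : ∀ T x, |(Φ T x).1.2 0 - ρ (Φ' T x)| ≤ C) :
    Tendsto (fun T : ℝ => 1 / T * ∫ x, (Φ T x).1.2 0 ∂μ.measure) atTop
      (𝓝 (∫ x, ru x ∂μ.measure)) := by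
  have hm : IsFiniteMeasure μ.measure := isFiniteMeasure_measure μ
  have hi : ∀ T, Integrable (fun x => (Φ T x).1.2 0) μ.measure := fun T =>
    integrable_of_continuous _ (continuous_angle_zero.comp (hΦ.continuous_space T))
  exact tendsto_integral_of_density hi
    (tendsto_eLpNorm_of_abs_sub_le hC h.integrable_rotation hi h.integrable h.tendsto) h.integrable

end

variable [T2Space M] [CompactSpace M]

/-- The angle of the lifted linearized flow is an almost additive cocycle. -/
theorem IsLiftedLinearizedFlow.exists_angle (hτ : IsNormalTrivialization μ X τ)
    (hΦ : IsLiftedLinearizedFlow X τ Φ) :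
    ∃ a : ℝ → C(M, ℝ), Continuous a ∧ a 0 = 0 ∧
      (∀ S T x, |a (S + T) x - a S (flow X T x) - a T x| ≤ 1) ∧
      ∀ T x, a T x = (Φ T x).1.2 0 := by
  refine ⟨ContinuousMap.curry ⟨fun z : ℝ × M => (Φ z.1 z.2).1.2 0,
    continuous_angle_zero.comp hΦ.continuous⟩, ContinuousMap.continuous _, ?_, ?_, fun _ _ => rfl⟩
  · ext x
    change (Φ 0 x).1.2 0 = 0
    rw [hΦ.zero]
    rfl
  · intro S T x
    change |(Φ (S + T) x).1.2 0 - (Φ S (flow X T x)).1.2 0 - (Φ T x).1.2 0| ≤ 1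
    rw [hΦ.map_add hτ]
    exact abs_angle_mul_sub_le _ _

variable [MeasurableSpace M] [BorelSpace M]

/-- The density is the limit for the angle, so a single `ru` serves for all `ρ`. -/
theorem exists_isRuelleDensity (hX : IsVolumePreserving μ X) (hτ : IsNormalTrivialization μ X τ)
    (hΦ : IsLiftedLinearizedFlow X τ Φ) :
    ∃ ru, ∀ ρ, IsRotationQuasimorphism ρ → IsRuelleDensity μ ρ Φ ru := by
  have hm : IsFiniteMeasure μ.measure := isFiniteMeasure_measure μ
  obtain ⟨a, ha, h0, hD, haΦ⟩ := hΦ.exists_angle hτ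
  obtain ⟨R, hR, hRa⟩ := exists_density (m := μ.measure) (φ := flow X)
    (fun t => (mdifferentiable_flow X t).continuous) (measurePreserving_flow μ hX)
    (flow_zero X) (flow_add X) ha h0 hD
  refine ⟨R, fun ρ hρ => ?_⟩
  have hρi : ∀ T, Integrable (fun x => ρ (Φ T x)) μ.measure := fun T =>
    integrable_of_continuous _ (hρ.continuous.comp (hΦ.continuous_space T))
  obtain ⟨C, hC⟩ := hρ.exists_abs_sub_angle_le
  refine ⟨hR, hρi, tendsto_eLpNorm_of_abs_sub_le (b := fun T x => a T x) (C := C)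
    (fun T x => ?_) (fun T => integrable_of_continuous _ (a T).continuous) hρi hR hRa⟩
  rw [haΦ]
  exact hC _

theorem tendsto_ruelleInvariant (H : CechCohomologyVanishes M 1) (hX : IsVolumePreserving μ X)
    (hτ : IsNormalTrivialization μ X τ) (hΦ : IsLiftedLinearizedFlow X τ Φ) :
    Tendsto (fun T : ℝ => 1 / T * ∫ x, (Φ T x).1.2 0 ∂μ.measure) atTop
      (𝓝 (ruelleInvariant μ X)) := by
  obtain ⟨ru, hru⟩ := exists_isRuelleDensity hX hτ hΦ
  -- The invariant is an arbitrary choice among admissible values. Existence for the given data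
  -- shows that the chosen value is indeed realized, by some `τ'` and `Φ'` that may differ from `τ`
  -- and `Φ`.
  obtain ⟨τ', Φ', ru', hτ', hΦ', hru', he⟩ : ∃ τ' Φ' ru', IsNormalTrivialization μ X τ' ∧
      IsLiftedLinearizedFlow X τ' Φ' ∧ IsRuelleDensity μ rotationNumber Φ' ru' ∧
      ruelleInvariant μ X = ∫ x, ru' x ∂μ.measure :=
    Classical.epsilon_spec (p := fun r : ℝ => ∃ τ Φ ru, IsNormalTrivialization μ X τ ∧
      IsLiftedLinearizedFlow X τ Φ ∧ IsRuelleDensity μ rotationNumber Φ ru ∧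
      r = ∫ x, ru x ∂μ.measure)
      ⟨_, τ, Φ, ru, hτ, hΦ, hru _ isRotationQuasimorphism_rotationNumber, rfl⟩
  rw [he]
  obtain ⟨C, hC⟩ := isRotationQuasimorphism_rotationNumber.exists_abs_sub_angle_le
  obtain ⟨C', hC'⟩ := IsLiftedLinearizedFlow.exists_abs_angle_sub_le H hτ hτ' hΦ hΦ'
  refine hru'.tendsto_integral_angle hΦ (C := C' + C) fun T x => ?_
  have h1 := abs_le.1 (hC (Φ' T x))
  have h2 := abs_le.1 (hC' T x)
  exact abs_le.2 ⟨by linarith, by linarith⟩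

theorem integral_eq_ruelleInvariant (H : CechCohomologyVanishes M 1)
    (hX : IsVolumePreserving μ X) (hτ : IsNormalTrivialization μ X τ)
    (hΦ : IsLiftedLinearizedFlow X τ Φ) {ρ : SL2Cover → ℝ} (hρ : IsRotationQuasimorphism ρ)
    {ru : M → ℝ} (hru : IsRuelleDensity μ ρ Φ ru) :
    ∫ x, ru x ∂μ.measure = ruelleInvariant μ X := by
  obtain ⟨C, hC⟩ := hρ.exists_abs_sub_angle_le
  exact tendsto_nhds_unique (hru.tendsto_integral_angle hΦ fun T x => by
    rw [abs_sub_comm]; exact hC _) (tendsto_ruelleInvariant H hX hτ hΦ)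

theorem abs_integral_angle_sub_ruelleInvariant_le (H : CechCohomologyVanishes M 1)
    (hX : IsVolumePreserving μ X) (hτ : IsNormalTrivialization μ X τ)
    (hΦ : IsLiftedLinearizedFlow X τ Φ) {T : ℝ} (hT : 0 < T) :
    |1 / T * ∫ x, (Φ T x).1.2 0 ∂μ.measure - ruelleInvariant μ X| ≤
      μ.measure.real univ / T := by
  have hm : IsFiniteMeasure μ.measure := isFiniteMeasure_measure μ
  obtain ⟨a, ha, h0, hD, haΦ⟩ := hΦ.exists_angle hτ
  have h := tendsto_ruelleInvariant H hX hτ hΦ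
  simp only [← haΦ] at h ⊢
  have h1 := abs_integral_sub_le (measurePreserving_flow μ hX) h0 hD h hT
  rwa [one_mul] at h1

end Ruelle

/-! ### Continuity of the Ruelle invariant -/

section Continuity

/-- Subtracting multiples of `X` moves `v` and `w` into the plane `ker θ` without changing the value
of the form. Modulo that plane `X` is `θ X • Y`, and the form vanishes on three vectors of a plane.
-/
theorem form_project_along (f : R3 [⋀^Fin 3]→L[ℝ] ℝ) {θ : R3 →ₗ[ℝ] ℝ} {Y X : R3} (hY : θ Y = 1)
    (hX : θ X ≠ 0) (v w : R3) :
    θ X * f ![Y, v - (θ v / θ X) • X, w - (θ w / θ X) • X] = f ![X, v, w] := by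
  have hk : ∀ u, θ (u - (θ u / θ X) • X) = 0 := fun u => by
    rw [map_sub, map_smul, smul_eq_mul, div_mul_cancel₀ _ hX, sub_self]
  have hcyc : ∀ a b c, f ![a, b, c] = f ![b, c, a] := fun a b c => by
    rw [form_swap01, ← form_swap12 f b a c]
  have hs : ∀ u (c : ℝ), f ![X, u, c • X] = 0 := fun u c => by
    rw [form_swap12, form_smul_left_eq_zero, neg_zero]
  have h1 : f ![X, v - (θ v / θ X) • X, w - (θ w / θ X) • X] = f ![X, v, w] := by
    rw [sub_eq_add_neg w, ← neg_smul, form_add_right, hs, add_zero, form_swap12,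
      sub_eq_add_neg v, ← neg_smul, form_add_right, hs, add_zero, form_swap12, neg_neg]
  rw [← h1]
  generalize hv : v - (θ v / θ X) • X = v'
  generalize hw : w - (θ w / θ X) • X = w'
  have hv0 : θ v' = 0 := hv ▸ hk v
  have hw0 : θ w' = 0 := hw ▸ hk w
  have h2 := congrArg θ (form_cramer f Y (X + (-θ X) • Y) v' w')
  simp only [map_sub, map_add, map_smul, hv0, hw0, hY, smul_eq_mul, map_zero, mul_zero, mul_one,
    sub_zero, add_zero, add_neg_cancel] at h2
  rw [hcyc, form_add_right, form_smul_right, ← hcyc, ← hcyc Y] at h2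
  linarith

variable {M : Type u} [TopologicalSpace M] [ChartedSpace R3 M] [IsManifold (𝓡 3) ∞ M]
  [T2Space M] [CompactSpace M] {X₀ : C1VectorField M} {μ : VolumeForm M}
  {τ₀ : ∀ x : M, TangentSpace (𝓡 3) x →ₗ[ℝ] (Fin 2 → ℝ)}

/-- A continuous family of covectors that is positive on a nowhere vanishing vector field. -/
theorem exists_covector (hX₀ : ∀ x, X₀ x ≠ 0) :
    ∃ θ : ∀ x : M, TangentSpace (𝓡 3) x →ₗ[ℝ] ℝ,
      (Continuous fun v : TangentBundle (𝓡 3) M => θ v.1 v.2) ∧ ∀ x, θ x (X₀ x) = 1 := by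
  obtain ⟨n, D, hD, hDc⟩ := exists_immersion M
  have hne : ∀ x, inner ℝ (D x (X₀ x)) (D x (X₀ x)) ≠ 0 := fun x =>
    (real_inner_self_pos.2 fun h => hX₀ x (hD x (h.trans (map_zero _).symm))).ne'
  have hc : Continuous fun x => D x (X₀ x) :=
    hDc.comp (continuous_eval_field.comp (continuous_const.prodMk continuous_id))
  have hc' : Continuous fun v : TangentBundle (𝓡 3) M => D v.1 (X₀ v.1) :=
    hc.comp continuous_proj
  refine ⟨fun x => (inner ℝ (D x (X₀ x)) (D x (X₀ x)))⁻¹ • (innerₛₗ ℝ (D x (X₀ x))).comp (D x),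
    ?_, fun x => inv_mul_cancel₀ (hne x)⟩
  exact ((hc'.inner hc').inv₀ fun v => hne v.1).mul (hc'.inner hDc)

/-- A normal trivialization extends to a continuous family of normal trivializations of all nearby
vector fields. -/
theorem IsNormalTrivialization.exists_family (hτ₀ : IsNormalTrivialization μ X₀ τ₀)
    (hX₀ : ∀ x, X₀ x ≠ 0) :
    ∃ Z ∈ 𝓝 X₀, ∃ τ : Z → ∀ x : M, TangentSpace (𝓡 3) x →ₗ[ℝ] (Fin 2 → ℝ),
      (Continuous fun q : Z × TangentBundle (𝓡 3) M => τ q.1 q.2.1 q.2.2) ∧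
        ∀ z : Z, IsNormalTrivialization μ z.1 (τ z) := by
  obtain ⟨θ, hθc, hθ⟩ := exists_covector hX₀
  have hev : Continuous fun q : C1VectorField M × M => θ q.2 (q.1 q.2) :=
    hθc.comp continuous_eval_field
  have hZ : ∀ᶠ X : C1VectorField M in 𝓝 X₀, ∀ x ∈ (univ : Set M), 0 < θ x (X x) := by
    refine isCompact_univ.eventually_forall_of_forall_eventually fun x _ => ?_
    exact hev.continuousAt.eventually_const_lt
      (lt_of_lt_of_eq one_pos (hθ x).symm : 0 < θ x (X₀ x))
  set Z : Set (C1VectorField M) := {X | ∀ x ∈ (univ : Set M), 0 < θ x (X x)}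
  have hpos : ∀ (z : Z) x, 0 < θ x (z.1 x) := fun z x => z.2 x (mem_univ x)
  -- Project along `X` onto `ker θ` and apply `τ₀`: this kills `X`. By `form_project_along` the area
  -- is then off by the factor `θ X`, and scaling both coordinates by its square root corrects this.
  set τ : Z → ∀ x : M, TangentSpace (𝓡 3) x →ₗ[ℝ] (Fin 2 → ℝ) := fun z x =>
    √(θ x (z.1 x)) • (τ₀ x - (θ x).smulRight ((θ x (z.1 x))⁻¹ • τ₀ x (z.1 x)))
  have hτ : ∀ z x (v : TangentSpace (𝓡 3) x), τ z x v =
      √(θ x (z.1 x)) • (τ₀ x v - θ x v • (θ x (z.1 x))⁻¹ • τ₀ x (z.1 x)) := fun _ _ _ => rfl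
  have hc : Continuous fun q : Z × TangentBundle (𝓡 3) M => τ q.1 q.2.1 q.2.2 := by
    have h1 : Continuous fun q : Z × TangentBundle (𝓡 3) M =>
        ((q.1.1, q.2.1) : C1VectorField M × M) :=
      (continuous_subtype_val.comp continuous_fst).prodMk (continuous_proj.comp continuous_snd)
    have h2 : Continuous fun q : Z × TangentBundle (𝓡 3) M => θ q.2.1 (q.1.1 q.2.1) :=
      hev.comp h1
    have h3 : Continuous fun q : Z × TangentBundle (𝓡 3) M => τ₀ q.2.1 (q.1.1 q.2.1) :=
      hτ₀.continuous.comp (continuous_eval_field.comp h1)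
    exact (Real.continuous_sqrt.comp h2).smul ((hτ₀.continuous.comp continuous_snd).sub
      ((hθc.comp continuous_snd).smul ((h2.inv₀ fun q => (hpos _ _).ne').smul h3)))
  refine ⟨Z, hZ, τ, hc, fun z => isNormalTrivialization_of_area (fun x h => ?_)
    (hc.comp (continuous_const.prodMk continuous_id)) fun x v w => ?_⟩
  · have h1 := hpos z x
    rw [h, map_zero] at h1
    exact h1.false
  · have h1 := form_project_along (μ.toFun x) (θ := θ x) (Y := X₀ x) (X := z.1 x) (hθ x)
      (hpos z x).ne' v w
    have h2 := hτ₀.area x (v - (θ x v / θ x (z.1 x)) • z.1 x) (w - (θ x w / θ x (z.1 x)) • z.1 x)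
    have h3 : ∀ u : TangentSpace (𝓡 3) x, τ z x u =
        √(θ x (z.1 x)) • τ₀ x (u - (θ x u / θ x (z.1 x)) • z.1 x) := fun u => by
      rw [hτ, map_sub, map_smul, smul_smul, div_eq_mul_inv]
    have h4 := Real.mul_self_sqrt (hpos z x).le
    refine Eq.trans ?_ h1
    refine Eq.trans ?_ (congrArg (fun r => θ x (z.1 x) * r) h2)
    rw [h3, h3]
    simp only [Pi.smul_apply, smul_eq_mul]
    linear_combination (τ₀ x (v - (θ x v / θ x (z.1 x)) • z.1 x) 0 *
      τ₀ x (w - (θ x w / θ x (z.1 x)) • z.1 x) 1 - τ₀ x (v - (θ x v / θ x (z.1 x)) • z.1 x) 1 *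
      τ₀ x (w - (θ x w / θ x (z.1 x)) • z.1 x) 0) * h4

/-- Near `X₀` the trivializations and lifted flows can be chosen jointly continuous in the field, so
each finite-time average is continuous. The averages converge uniformly at the rate `vol / T`. -/
theorem continuous_ruelleInvariant [MeasurableSpace M] [BorelSpace M]
    (H1 : CechCohomologyVanishes M 1) (H2 : CechCohomologyVanishes M 2) (μ : VolumeForm M) :
    Continuous fun X : nonvanishingVolumePreserving μ => ruelleInvariant μ X := by
  rw [continuous_iff_continuousAt]
  intro X₀
  obtain ⟨τ₀, hτ₀⟩ := exists_isNormalTrivialization H2 μ X₀.2.2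
  obtain ⟨Z, hZ, τ, hτc, hτ⟩ := hτ₀.exists_family X₀.2.2
  set W : Set (nonvanishingVolumePreserving μ) := Subtype.val ⁻¹' Z
  have hW : W ∈ 𝓝 X₀ := continuous_subtype_val.continuousAt.preimage_mem_nhds hZ
  refine ContinuousOn.continuousAt (s := W) ?_ hW
  rw [continuousOn_iff_continuous_domRestrict]
  set r : W → Z := fun w => ⟨w.1.1, w.2⟩
  have hr : Continuous r :=
    (continuous_subtype_val.comp continuous_subtype_val).subtype_mk _
  obtain ⟨Φ, hΦc, hΦ⟩ := exists_isLiftedLinearizedFlow (X := fun w : W => w.1.1)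
    (τ := fun w => τ (r w)) (continuous_subtype_val.comp continuous_subtype_val)
    (fun w => w.1.2.1) (fun w => hτ (r w))
    (hτc.comp ((hr.comp continuous_fst).prodMk continuous_snd))
  have hm : IsFiniteMeasure μ.measure := isFiniteMeasure_measure μ
  have hF : ∀ T : ℝ, Continuous fun w : W => 1 / T * ∫ x, (Φ w T x).1.2 0 ∂μ.measure := by
    intro T
    have h1 : Continuous fun q : W × M => (Φ q.1 T q.2).1.2 0 :=
      continuous_angle_zero.comp (hΦc.comp (continuous_const.prodMk continuous_id))
    exact continuous_const.mul ((continuous_integral_continuousMap μ.measure).comp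
      (ContinuousMap.curry ⟨_, h1⟩).continuous)
  have hlim : Tendsto (fun T : ℝ => μ.measure.real univ / T) atTop (𝓝 0) :=
    tendsto_const_nhds.div_atTop tendsto_id
  refine TendstoUniformly.continuous (F := fun (T : ℝ) (w : W) =>
    1 / T * ∫ x, (Φ w T x).1.2 0 ∂μ.measure) (p := atTop) ?_
    (Eventually.of_forall hF).frequently
  rw [Metric.tendstoUniformly_iff]
  intro ε hε
  filter_upwards [hlim.eventually_lt_const hε, eventually_gt_atTop 0] with T hT hT0 w
  rw [dist_comm, Real.dist_eq]
  exact (abs_integral_angle_sub_ruelleInvariant_le H1 w.1.2.1 (hτ (r w)) (hΦ w) hT0).trans_lt hT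

end Continuity

end RuelleInvariant

end

/-! ### The main theorem -/

theorem mainTheorem10 {M : Type*} [TopologicalSpace M] [T2Space M] [CompactSpace M]
    [ChartedSpace RuelleInvariant.R3 M] [IsManifold (𝓡 3) ∞ M]
    [MeasurableSpace M] [BorelSpace M]
    (hH1 : RuelleInvariant.CechCohomologyVanishes M 1)
    (hH2 : RuelleInvariant.CechCohomologyVanishes M 2)
    (μ : RuelleInvariant.VolumeForm M) :
    -- the Ruelle invariant is well defined
    (∀ X ∈ RuelleInvariant.nonvanishingVolumePreserving μ,
      (∃ τ, RuelleInvariant.IsNormalTrivialization μ X τ) ∧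
      ∀ τ, RuelleInvariant.IsNormalTrivialization μ X τ →
        ∃ Φ, RuelleInvariant.IsLiftedLinearizedFlow X τ Φ ∧
          (∀ Φ', RuelleInvariant.IsLiftedLinearizedFlow X τ Φ' → Φ' = Φ) ∧
          ∀ ρ, RuelleInvariant.IsRotationQuasimorphism ρ →
            ∃ ru, RuelleInvariant.IsRuelleDensity μ ρ Φ ru ∧
              ∫ x, ru x ∂μ.measure = RuelleInvariant.ruelleInvariant μ X) ∧
    -- and continuous in the C¹-topology
    Continuous (fun X : RuelleInvariant.nonvanishingVolumePreserving μ =>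
      RuelleInvariant.ruelleInvariant μ X) := by
  refine ⟨fun X hX => ⟨RuelleInvariant.exists_isNormalTrivialization hH2 μ hX.2, fun τ hτ => ?_⟩,
    RuelleInvariant.continuous_ruelleInvariant hH1 hH2 μ⟩
  -- A single vector field is a family over a one-point parameter space.
  obtain ⟨Φ, -, hΦ⟩ := RuelleInvariant.exists_isLiftedLinearizedFlow (Z := Unit) (X := fun _ => X)
    (τ := fun _ => τ) continuous_const (fun _ => hX.1) (fun _ => hτ)
    (hτ.continuous.comp continuous_snd)
  obtain ⟨ru, hru⟩ := RuelleInvariant.exists_isRuelleDensity hX.1 hτ (hΦ ())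
  exact ⟨Φ (), hΦ (), fun Φ' hΦ' => (hΦ ()).unique hτ hΦ', fun ρ hρ => ⟨ru, hru ρ hρ,
    RuelleInvariant.integral_eq_ruelleInvariant hH1 hX.1 hτ (hΦ ()) hρ (hru ρ hρ)⟩⟩
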